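/- **Setting.** Let $(X,d,\mu)$ be a space of homogeneous type: $X$ is a non-empty set; $d:X\times X\to[0,\infty)$ satisfies $d(x,x)=0$, $d(x,y)=d(y,x)$ and $d(x,y)\le A_0(d(x,z)+d(z,y))$ for some constant $A_0\ge1$; a set $U$ is open if it contains with each of its points $x$ some ball $B(x,r)=\{y:d(x,y)<r\}$, $r>0$; and $\mu$ is a (outer) regular measure on the $\sigma$-algebra generated by the open sets and the balls such that, for some constant $C_\mu\ge 1$, $0<\mu(B(x,2r))\le C_\mu\,\mu(B(x,r))<\infty$ for all $x\in X$, $r>0$. For measurable $p:X\to[0,\infty)$ put $p_-=\operatorname{ess\,inf}_X p$, $p_+=\operatorname{ess\,sup}_X p$. Let $\mathscr P$ be the set of measurable $p:X\to[1,\infty)$ with $1<p_-\le p_+<\infty$, and $\mathscr P_0$ the set of measurable $p:X\to[0,\infty)$ with $0<p_-\le p_+<\infty$. Let $LH$ be the set of $p:X\to\mathbb R$ for which there are $C\ge 0$, $p_\infty\in\mathbb R$ and $x_0\in X$ with $|p(x)-p(y)|\le C/\log(e+1/d(x,y))$ whenever $d(x,y)<\frac12$, and $|p(x)-p_\infty|\le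 C/\log(e+d(x,x_0))$ for all $x$. For $r(\cdot)\in\mathscr P_0$ put $\|f\|_{r(\cdot)}=\inf\{\lambda>0:\int_X|f(x)/\lambda|^{r(x)}\,d\mu\le1\}$, where the upper integral is used if the integrand is not measurable; $p'(\cdot)=p(\cdot)/(p(\cdot)-1)$. A weight is a measurable function $\omega:X\to[0,\infty]$ that is integrable over every ball and satisfies $0<\omega<\infty$ almost everywhere; $\|f\|_{L^{p(\cdot)}(X,\omega)}=\|\omega f\|_{p(\cdot)}$. Let $p_1(\cdot),\dots,p_m(\cdot)\in LH\cap\mathscr P$, $\frac1{p(\cdot)}=\sum_{i=1}^m\frac1{p_i(\cdot)}$, let $\eta\in[0,m)$ be a constant and $q(\cdot)\in\mathscr P_0$ with $\frac1{p(\cdot)}-\frac1{q(\cdot)}=\eta$, and let $\omega_1,\dots,\omega_m$ be weights, $\omega=\prod_{i=1}^m\omega_i$, $\vec\omega=(\omega_1,\dots,\omega_m)$. With suprema over all balls $B\subseteq X$, put $$\mathscr M_\eta(\vec f)(x)=\sup_{B\ni x}\mu(B)^\eta\prod_{i=1}^m\frac1{\mu(B)}\int_B|f_i|\,d\mu,\qquad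 [\vec\omega]_{A_{\vec p(\cdot),q(\cdot)}(X)}=\sup_{B}\mu(B)^{\eta-m}\|\omega\chi_B\|_{q(\cdot)}\prod_{i=1}^m\|\omega_i^{-1}\chi_B\|_{p_i'(\cdot)},$$ and say $\vec\omega\in A_{\vec p(\cdot),q(\cdot)}(X)$ if the latter is finite. Let $\|\mathscr M_\eta\|\in[0,\infty]$ be the least $C$ such that $\|\mathscr M_\eta(\vec f)\|_{L^{q(\cdot)}(X,\omega)}\le C\prod_{i=1}^m\|f_i\|_{L^{p_i(\cdot)}(X,\omega_i)}$ for all measurable $f_i\in L^{p_i(\cdot)}(X,\omega_i)$; $\mathscr M_\eta$ is bounded if $\|\mathscr M_\eta\|<\infty$. **Theorem.** $\mathscr M_\eta$ is bounded from $L^{p_1(\cdot)}(X,\omega_1)\times\cdots\times L^{p_m(\cdot)}(X,\omega_m)$ to $L^{q(\cdot)}(X,\omega)$ if and only if $\vec\omega\in A_{\vec p(\cdot),q(\cdot)}(X)$. Moreover, there is a constant $C>0$ depending only on $\vec p(\cdot)$ such that $$[\vec\omega]_{A_{\vec p(\cdot),q(\cdot)}(X)}\le C\,\|\mathscr M_\eta\|,$$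 and if $\vec\omega\in A_{\vec p(\cdot),q(\cdot)}(X)$, then $\|\mathscr M_\eta\|\le C_{\vec\omega,\eta,m,\mu,X,\vec p(\cdot)}$ for a finite constant depending only on the quantities indicated. -/

import Mathlib

open MeasureTheory
open scoped ENNReal NNReal

noncomputable section

namespace HomType

variable {X : Type*}

/-- The quasi-metric ball `B(x, r) = {y : d(x, y) < r}`. -/
def qball (d : X → X → ℝ) (x : X) (r : ℝ) : Set X := {y | d x y < r}

/-- `d : X × X → [0, ∞)` is a quasi-metric. -/
structure IsQuasiMetric (d : X → X → ℝ) : Prop where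
  nonneg : ∀ x y, 0 ≤ d x y
  self : ∀ x, d x x = 0
  symm : ∀ x y, d x y = d y x
  quasi_triangle : ∃ A₀ : ℝ, 1 ≤ A₀ ∧ ∀ x y z, d x y ≤ A₀ * (d x z + d z y)

/-- The topology of a quasi-metric: `U` is open iff it contains a ball around each of its points.
(Balls themselves need not be open.) -/
@[reducible]
def quasiTopology (d : X → X → ℝ) : TopologicalSpace X where
  IsOpen U := ∀ x ∈ U, ∃ r > 0, qball d x r ⊆ U
  isOpen_univ := fun _ _ => ⟨1, one_pos, Set.subset_univ _⟩
  isOpen_inter := by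
    intro U V hU hV x hx
    obtain ⟨r, hr, hrU⟩ := hU x hx.1
    obtain ⟨s, hs, hsV⟩ := hV x hx.2
    exact ⟨min r s, lt_min hr hs, fun y hy =>
      ⟨hrU (lt_of_lt_of_le hy (min_le_left r s)), hsV (lt_of_lt_of_le hy (min_le_right r s))⟩⟩
  isOpen_sUnion := by
    intro S hS x hx
    obtain ⟨U, hU, hxU⟩ := hx
    obtain ⟨r, hr, hrU⟩ := hS U hU x hxU
    exact ⟨r, hr, fun y hy => ⟨U, hU, hrU hy⟩⟩

/-- The σ-algebra generated by the open sets and the quasi-metric balls. -/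
@[reducible]
def ballBorel (d : X → X → ℝ) : MeasurableSpace X :=
  MeasurableSpace.generateFrom
    ({U | @IsOpen X (quasiTopology d) U} ∪ {B | ∃ x r, 0 < r ∧ B = qball d x r})

/-- `(X, d, μ)` is a space of homogeneous type. -/
structure IsHomogeneousType [mX : MeasurableSpace X] (d : X → X → ℝ) (μ : Measure X) :
    Prop where
  nonempty : Nonempty X
  quasiMetric : IsQuasiMetric d
  sigmaAlgebra : mX = ballBorel d
  regular : @Measure.OuterRegular X mX (quasiTopology d) μ
  doubling : ∃ Cμ : ℝ≥0, 1 ≤ Cμ ∧ ∀ (x : X) (r : ℝ), 0 < r →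
    0 < μ (qball d x (2 * r)) ∧ μ (qball d x (2 * r)) ≤ Cμ * μ (qball d x r) ∧
      μ (qball d x r) < ∞

/-- Local log-Hölder continuity. (When `d x y = 0` the bound only says `|p x - p y| ≤ C`; there
`p x = p y` holds anyway for functions measurable with respect to `ballBorel d`.) -/
def LH0 (d : X → X → ℝ) (p : X → ℝ) : Prop :=
  ∃ C : ℝ, ∀ x y, d x y < 1 / 2 → |p x - p y| ≤ C / Real.log (Real.exp 1 + 1 / d x y)

/-- Log-Hölder continuity at infinity, with respect to some base point. -/
def LHinfty (d : X → X → ℝ) (p : X → ℝ) : Prop :=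
  ∃ (x₀ : X) (pinf C : ℝ), ∀ x, |p x - pinf| ≤ C / Real.log (Real.exp 1 + d x x₀)

/-- Global log-Hölder continuity. -/
def LH (d : X → X → ℝ) (p : X → ℝ) : Prop := LH0 d p ∧ LHinfty d p

variable [MeasurableSpace X]

/-- The class `𝒫`: measurable `p : X → [1, ∞)` with `1 < p₋ ≤ p₊ < ∞`. -/
structure ExpP (μ : Measure X) (p : X → ℝ) : Prop where
  measurable : Measurable p
  one_le : ∀ x, 1 ≤ p x
  one_lt_essInf : 1 < essInf (fun x => ENNReal.ofReal (p x)) μ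
  essSup_lt_top : essSup (fun x => ENNReal.ofReal (p x)) μ < ∞

/-- The class `𝒫₀`: measurable `p : X → [0, ∞)` with `0 < p₋ ≤ p₊ < ∞`. -/
structure ExpP0 (μ : Measure X) (p : X → ℝ) : Prop where
  measurable : Measurable p
  nonneg : ∀ x, 0 ≤ p x
  essInf_pos : 0 < essInf (fun x => ENNReal.ofReal (p x)) μ
  essSup_lt_top : essSup (fun x => ENNReal.ofReal (p x)) μ < ∞

/-- The upper integral of a nonnegative function. It is the Lebesgue integral `∫⁻` on measurable
functions; it is needed since balls need not be open, so that a supremum over all balls need not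
be measurable. -/
def upperIntegral (μ : Measure X) (f : X → ℝ≥0∞) : ℝ≥0∞ :=
  ⨅ (g : X → ℝ≥0∞) (_ : Measurable g) (_ : ∀ x, f x ≤ g x), ∫⁻ x, g x ∂μ

/-- The modular `∫ |f(x)|^{p(x)} dμ` of a (finite-valued) exponent, for nonnegative functions. -/
def modular (μ : Measure X) (p : X → ℝ) (f : X → ℝ≥0∞) : ℝ≥0∞ :=
  upperIntegral μ (fun x => f x ^ p x)

/-- The Luxemburg norm `inf {t > 0 : ρ(f / t) ≤ 1}` of `L^{p(·)}(X)`, with `inf ∅ = ∞`. -/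
def lux (μ : Measure X) (p : X → ℝ) (f : X → ℝ≥0∞) : ℝ≥0∞ :=
  ⨅ (t : ℝ≥0) (_ : 0 < t) (_ : modular μ p (fun x => f x / t) ≤ 1), (t : ℝ≥0∞)

/-- The norm of the weighted space `L^{p(·)}(X, ω)`: the norm of `ω f` in `L^{p(·)}(X)`. -/
def wlux (μ : Measure X) (p : X → ℝ) (ω f : X → ℝ≥0∞) : ℝ≥0∞ :=
  lux μ p (fun x => ω x * f x)

/-- A weight: a measurable function `X → [0, ∞]`, integrable over balls, positive and finite
almost everywhere. -/
structure IsWeight (d : X → X → ℝ) (μ : Measure X) (ω : X → ℝ≥0∞) : Prop where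
  measurable : Measurable ω
  locInt : ∀ (x : X) (r : ℝ), 0 < r → ∫⁻ y in qball d x r, ω y ∂μ < ∞
  pos : ∀ᵐ x ∂μ, 0 < ω x
  lt_top : ∀ᵐ x ∂μ, ω x < ∞

/-- The multilinear fractional averaging operator `μ(B)^η ∏ᵢ ⟨|fᵢ|⟩_B χ_B(x)`. -/
def fracAverage {m : ℕ} (μ : Measure X) (η : ℝ) (B : Set X) (f : Fin m → X → ℝ) :
    X → ℝ≥0∞ :=
  B.indicator fun _ => μ B ^ η * ∏ i, ((μ B)⁻¹ * ∫⁻ y in B, ‖f i y‖ₑ ∂μ)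

/-- The multilinear fractional maximal operator: the supremum of `fracAverage` over all balls. -/
def fracMaximal {m : ℕ} (d : X → X → ℝ) (μ : Measure X) (η : ℝ) (f : Fin m → X → ℝ) (x : X) :
    ℝ≥0∞ :=
  ⨆ (c : X) (r : ℝ) (_ : 0 < r), fracAverage μ η (qball d c r) f x

/-- The constant `[ω⃗]` of the class `A_{p⃗(·), q(·)}(X)`, where the last component of the multiple
weight is the product of the others. -/
def apqConst {m : ℕ} (d : X → X → ℝ) (μ : Measure X) (η : ℝ) (p : Fin m → X → ℝ) (q : X → ℝ)
    (ω : Fin m → X → ℝ≥0∞) : ℝ≥0∞ :=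
  ⨆ (c : X) (r : ℝ) (_ : 0 < r),
    μ (qball d c r) ^ (η - m) *
      lux μ q ((qball d c r).indicator fun x => ∏ i, ω i x) *
      ∏ i, lux μ (fun x => (p i x).conjExponent) ((qball d c r).indicator fun x => (ω i x)⁻¹)

/-- `C` is an admissible constant in `‖T f⃗‖_{L^{q(·)}(v)} ≤ C ∏ᵢ ‖fᵢ‖_{L^{pᵢ(·)}(ωᵢ)}` for all
`fᵢ ∈ L^{pᵢ(·)}(X, ωᵢ)`. -/
def HasBound {m : ℕ} (μ : Measure X) (p : Fin m → X → ℝ) (ω : Fin m → X → ℝ≥0∞) (q : X → ℝ)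
    (v : X → ℝ≥0∞) (T : (Fin m → X → ℝ) → X → ℝ≥0∞) (C : ℝ≥0) : Prop :=
  ∀ f : Fin m → X → ℝ, (∀ i, Measurable (f i)) →
    (∀ i, wlux μ (p i) (ω i) (fun x => ‖f i x‖ₑ) < ∞) →
    wlux μ q v (T f) ≤ C * ∏ i, wlux μ (p i) (ω i) (fun x => ‖f i x‖ₑ)

/-- `T` is bounded from `∏ᵢ L^{pᵢ(·)}(X, ωᵢ)` to `L^{q(·)}(X, v)`. -/
def IsBoundedOp {m : ℕ} (μ : Measure X) (p : Fin m → X → ℝ) (ω : Fin m → X → ℝ≥0∞)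
    (q : X → ℝ) (v : X → ℝ≥0∞) (T : (Fin m → X → ℝ) → X → ℝ≥0∞) : Prop :=
  ∃ C : ℝ≥0, HasBound μ p ω q v T C

/-- The operator norm from `∏ᵢ L^{pᵢ(·)}(X, ωᵢ)` to `L^{q(·)}(X, v)`, `∞` if unbounded. -/
def opNorm {m : ℕ} (μ : Measure X) (p : Fin m → X → ℝ) (ω : Fin m → X → ℝ≥0∞) (q : X → ℝ)
    (v : X → ℝ≥0∞) (T : (Fin m → X → ℝ) → X → ℝ≥0∞) : ℝ≥0∞ :=
  ⨅ (C : ℝ≥0) (_ : HasBound μ p ω q v T C), (C : ℝ≥0∞)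

end HomType

end

/-! ### Balls, measurability and points at distance zero. -/

namespace HomType

variable {X : Type*}

/-! Necessity is duality. For `t_i` below the norm of `ω_i⁻¹ χ_B` in `L^{p_i'(·)}` there is a
function in the unit ball of `L^{p_i(·)}(ω_i)` with integral at least `t_i` over `B`. On `B` the
maximal function of such a tuple is at least `μ(B)^{η-m} ∏ t_i`, and letting the `t_i` increase to
the norms loses nothing (`exists_dual_function`, `apqConst_le_of_hasBound`).

Sufficiency works with the measures `σ_i = ω_i^{-p_i'} μ` and `W = ω^q μ` and with the norms
`n_i(B)`, `N(B)` that enter the condition. Since `1/q + ∑ 1/p_i' = m - η`, the condition bounds from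
below, by a multiple of `1/μ(B)`, a weighted geometric mean of the densities normalized to have
integral one over `B`. No density can be large on much of `B`, so none can be small on much of `B`:
each charges `E ⊆ B` at least like a power of `μ(E)/μ(B)` (`ofReal_le_lintegral_of_le_prod`). This
bound of `A_∞` type is the field `lower` of `WeightPair`.

It makes the norms of balls vary at most polynomially and, in an unbounded space, tend to infinity.
With log-Hölder continuity, `n(B)^{p(y)-p(z)}` is then bounded on balls of bounded norm
(`exists_n_rpow_le`), while elsewhere exponents are exchanged for their limits at the price of an
integrable error `(e + d(x, x₀))^{-M}` (`rpow_le_exchange`). Hence `σ(B)` behaves like `n(B)^{ρ(z)}`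
or `n(B)^{ρ_∞}`, the measures are doubling, and their maximal operators are bounded on `L^t`, `t >
1`.

For `g` in the unit ball of `L^{p(·)}(σ)`, the number `∫_B g dσ / n(B)` is at most `2`, and its
power `p(z)`, or `p_∞` on balls of large norm, is at most `C σ(B) inf_B Z` with `∫ Z dσ ≤ C`
(`exists_linear_estimate`). Young's inequality, available because `q ∑ 1/p_i ≥ 1`, multiplies these
estimates: the power `q(z)` of the normalized multilinear average is at most a sum of terms
`(σ_i(B)/W(B)) inf_B Z_i`, up to the error. The quotient of two different measures is removed by
`(σ_i(B) W(B))^{1/2} ≤ C ∫_B (s_i t)^{1/2} dμ`, where `s_i` and `t` are the densities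
(`exists_sqrt_mul_le`): the square root of a term is at most a `W`-average of `h_i = (s_i Z_i /
t)^{1/2}`, and `∫ h_i² dW ≤ ∫ Z_i dσ_i`. The `L²` bound for the maximal operator of `W` concludes
(`exists_maximal_estimate`). -/

lemma mem_qball_self {d : X → X → ℝ} (hd : IsQuasiMetric d) {x : X} {r : ℝ} (hr : 0 < r) :
    x ∈ qball d x r := by
  simpa [qball, hd.self x] using hr

lemma qball_mono (d : X → X → ℝ) (x : X) {r s : ℝ} (h : r ≤ s) : qball d x r ⊆ qball d x s :=
  fun _ hy => lt_of_lt_of_le hy h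

lemma iUnion_qball_nat (d : X → X → ℝ) (x : X) : ⋃ n : ℕ, qball d x (n + 1) = Set.univ := by
  refine Set.eq_univ_of_forall fun y => ?_
  obtain ⟨n, hn⟩ := exists_nat_gt (d x y)
  exact Set.mem_iUnion.2 ⟨n, hn.trans (by linarith)⟩

variable [MeasurableSpace X] {d : X → X → ℝ} {μ : Measure X}

lemma IsHomogeneousType.measurableSet_qball (hX : IsHomogeneousType d μ) (x : X) {r : ℝ}
    (hr : 0 < r) : MeasurableSet (qball d x r) := by
  rw [hX.sigmaAlgebra]
  exact MeasurableSpace.measurableSet_generateFrom (Or.inr ⟨x, r, hr, rfl⟩)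

lemma IsHomogeneousType.measurable_dist_left (hX : IsHomogeneousType d μ) (x : X) :
    Measurable (fun y => d x y) := by
  refine measurable_of_Iio fun r => ?_
  rcases le_or_gt r 0 with hr | hr
  · convert MeasurableSet.empty
    ext y
    simpa using hr.trans (hX.quasiMetric.nonneg x y)
  · exact hX.measurableSet_qball x hr

lemma IsHomogeneousType.measurable_dist_right (hX : IsHomogeneousType d μ) (x : X) :
    Measurable (fun y => d y x) := by
  simpa only [hX.quasiMetric.symm _ x] using hX.measurable_dist_left x

lemma IsHomogeneousType.measure_qball_lt_top (hX : IsHomogeneousType d μ) (x : X) (r : ℝ) :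
    μ (qball d x r) < ∞ := by
  obtain ⟨C, -, h⟩ := hX.doubling
  exact lt_of_le_of_lt (measure_mono (qball_mono d x (le_max_left r 1)))
    (h x (max r 1) (by positivity)).2.2

lemma IsHomogeneousType.measure_qball_pos (hX : IsHomogeneousType d μ) (x : X) {r : ℝ}
    (hr : 0 < r) : 0 < μ (qball d x r) := by
  obtain ⟨C, -, h⟩ := hX.doubling
  have := (h x (r / 2) (by positivity)).1
  rwa [mul_div_cancel₀ r two_ne_zero] at this

lemma IsHomogeneousType.sigmaFinite (hX : IsHomogeneousType d μ) : SigmaFinite μ := by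
  obtain ⟨x⟩ := hX.nonempty
  exact ⟨⟨⟨fun n : ℕ => qball d x (n + 1), fun _ => trivial,
    fun n => hX.measure_qball_lt_top _ _, iUnion_qball_nat d x⟩⟩⟩

/-- Doubling in power form. -/
lemma IsHomogeneousType.exists_measure_qball_le_pow (hX : IsHomogeneousType d μ) :
    ∃ (C : ℝ) (D : ℕ), 0 < C ∧ ∀ (x : X) (r R : ℝ), 0 < r → r ≤ R →
      μ.real (qball d x R) ≤ C * (R / r) ^ D * μ.real (qball d x r) := by
  obtain ⟨C, hC1, h⟩ := hX.doubling
  -- A natural exponent with `Cμ < 2 ^ D` serves in place of the logarithm of the doubling constant.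
  obtain ⟨D, hD⟩ := pow_unbounded_of_one_lt (C : ℝ) (one_lt_two)
  refine ⟨2 ^ D, D, by positivity, fun x r R hr hrR => ?_⟩
  have step : ∀ k : ℕ, μ.real (qball d x (2 ^ k * r)) ≤ (2 ^ D) ^ k * μ.real (qball d x r) := by
    intro k
    induction k with
    | zero => simp
    | succ k ih =>
      have h1 := (h x (2 ^ k * r) (by positivity)).2.1
      have h2 : μ.real (qball d x (2 * (2 ^ k * r))) ≤ C * μ.real (qball d x (2 ^ k * r)) := by
        have := ENNReal.toReal_mono
          (ENNReal.mul_ne_top ENNReal.coe_ne_top (hX.measure_qball_lt_top _ _).ne) h1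
        simpa [Measure.real] using this
      have h3 : (2 : ℝ) ^ (k + 1) * r = 2 * (2 ^ k * r) := by ring
      rw [h3]
      calc _ ≤ C * μ.real (qball d x (2 ^ k * r)) := h2
        _ ≤ 2 ^ D * ((2 ^ D) ^ k * μ.real (qball d x r)) := by gcongr
        _ = _ := by ring
  obtain ⟨k, hk1, hk2⟩ := exists_nat_pow_near ((one_le_div hr).2 hrR) one_lt_two
  have hR : R ≤ 2 ^ (k + 1) * r := by
    rw [div_lt_iff₀ hr] at hk2; exact hk2.le
  calc μ.real (qball d x R) ≤ μ.real (qball d x (2 ^ (k + 1) * r)) :=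
        measureReal_mono (qball_mono d x hR) (hX.measure_qball_lt_top _ _).ne
    _ ≤ (2 ^ D) ^ (k + 1) * μ.real (qball d x r) := step _
    _ = 2 ^ D * (2 ^ k) ^ D * μ.real (qball d x r) := by
        rw [← pow_mul, ← pow_mul, ← pow_add]; ring_nf
    _ ≤ _ := by gcongr

/-- By outer regularity, measurable functions do not separate points at distance zero, up to a
null set. -/
lemma IsHomogeneousType.exists_null_eq_of_dist_eq_zero (hX : IsHomogeneousType d μ) {p : X → ℝ}
    (hp : Measurable p) :
    ∃ N : Set X, μ N = 0 ∧ ∀ x ∉ N, ∀ y ∉ N, d x y = 0 → p x = p y := by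
  obtain ⟨x₀⟩ := hX.nonempty
  -- For one level `a` and one ball, the exceptional set consists of the points lying in all the
  -- chosen open neighbourhoods of both `{p < a}` and its complement; it is null by outer
  -- regularity. An open set containing `x` contains every point at distance zero from `x`, so a
  -- point `y` separated from such an `x` by `a` falls into that set.
  have hsep : ∀ (a : ℚ) (n : ℕ), ∃ N : Set X, μ N = 0 ∧
      ∀ x ∈ qball d x₀ (n + 1), ∀ y ∈ qball d x₀ (n + 1), y ∉ N → d x y = 0 →
        p x < a → p y < a := by
    intro a n
    set B := qball d x₀ (n + 1)
    have hB : MeasurableSet B := hX.measurableSet_qball _ (by positivity)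
    set A := B ∩ {x | p x < a}
    set A' := B ∩ {x | ¬ p x < a}
    have hA : MeasurableSet A := hB.inter (hp measurableSet_Iio)
    have hA' : MeasurableSet A' := hB.inter (hp measurableSet_Iio).compl
    have hfin : μ B ≠ ∞ := (hX.measure_qball_lt_top _ _).ne
    have hex : ∀ T ⊆ B, MeasurableSet T → ∀ k : ℕ, ∃ U : Set X, T ⊆ U ∧
        (∀ x ∈ U, ∃ r > 0, qball d x r ⊆ U) ∧ MeasurableSet U ∧
        μ (U \ T) ≤ ((k : ℝ≥0∞) + 1)⁻¹ := by
      intro T hTB hT k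
      have hTfin : μ T ≠ ∞ := measure_ne_top_of_subset hTB hfin
      obtain ⟨U, hTU, hU, hlt⟩ := hX.regular.outerRegular hT (μ T + ((k : ℝ≥0∞) + 1)⁻¹)
        (ENNReal.lt_add_right hTfin (by simp))
      have hUm : MeasurableSet U := by
        rw [hX.sigmaAlgebra]
        exact MeasurableSpace.measurableSet_generateFrom (Or.inl hU)
      refine ⟨U, hTU, hU, hUm, ?_⟩
      rw [measure_sdiff hTU hT.nullMeasurableSet hTfin]
      exact tsub_le_iff_left.2 hlt.le
    choose U hU1 hU2 hU3 hU4 using hex A Set.inter_subset_left hA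
    choose V hV1 hV2 hV3 hV4 using hex A' Set.inter_subset_left hA'
    refine ⟨⋂ k, (U k ∩ V k ∩ B), ?_, ?_⟩
    · have hle : ∀ k : ℕ, μ (⋂ k, (U k ∩ V k ∩ B)) ≤ 2 * ((k : ℝ≥0∞) + 1)⁻¹ := by
        intro k
        calc μ (⋂ k, (U k ∩ V k ∩ B)) ≤ μ ((U k \ A) ∪ (V k \ A')) := by
              refine measure_mono fun x hx => ?_
              obtain ⟨⟨h1, h2⟩, h3⟩ := Set.mem_iInter.1 hx k
              by_cases h : p x < a
              · exact Or.inr ⟨h2, fun h' => h'.2 h⟩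
              · exact Or.inl ⟨h1, fun h' => h h'.2⟩
          _ ≤ μ (U k \ A) + μ (V k \ A') := measure_union_le _ _
          _ ≤ _ := by rw [two_mul]; exact add_le_add (hU4 k) (hV4 k)
      have hlim : Filter.Tendsto (fun k : ℕ => 2 * ((k : ℝ≥0∞) + 1)⁻¹) Filter.atTop (nhds 0) := by
        have h1 : Filter.Tendsto (fun k : ℕ => (((k + 1 : ℕ) : ℝ≥0∞))⁻¹) Filter.atTop (nhds 0) :=
          (Filter.tendsto_add_atTop_iff_nat 1).2 ENNReal.tendsto_inv_nat_nhds_zero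
        have := ENNReal.Tendsto.const_mul h1 (a := 2) (Or.inr (by simp))
        simpa using this
      exact le_antisymm (ge_of_tendsto' hlim hle) bot_le
    · intro x hx y hy hyN hxy hpx
      by_contra hpy
      refine hyN (Set.mem_iInter.2 fun k => ⟨⟨?_, hV1 k ⟨hy, hpy⟩⟩, hy⟩)
      obtain ⟨r, hr, hrU⟩ := hU2 k x (hU1 k ⟨hx, hpx⟩)
      exact hrU (by simpa [qball, hxy] using hr)
  choose N hN0 hN using hsep
  refine ⟨⋃ a, ⋃ n, N a n, ?_, ?_⟩
  · exact measure_iUnion_null fun a => measure_iUnion_null fun n => hN0 a n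
  · have key : ∀ x ∉ (⋃ a, ⋃ n, N a n), ∀ y ∉ (⋃ a, ⋃ n, N a n), d x y = 0 → p y ≤ p x := by
      intro x hx y hy hxy
      by_contra! hlt
      obtain ⟨a, ha1, ha2⟩ := exists_rat_btwn hlt
      obtain ⟨n, hn⟩ := exists_nat_gt (max (d x₀ x) (d x₀ y))
      have h1 : x ∈ qball d x₀ (n + 1) := (lt_of_le_of_lt (le_max_left _ _) hn).trans (by linarith)
      have h2 : y ∈ qball d x₀ (n + 1) := (lt_of_le_of_lt (le_max_right _ _) hn).trans (by linarith)
      have hy' : y ∉ N a n := fun h => hy (Set.mem_iUnion.2 ⟨a, Set.mem_iUnion.2 ⟨n, h⟩⟩)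
      exact absurd (hN a n x h1 y h2 hy' hxy ha1) (not_lt.2 ha2.le)
    intro x hx y hy hxy
    exact le_antisymm (key y hy x hx (by rwa [hX.quasiMetric.symm])) (key x hx y hy hxy)

end HomType

/-! ### The maximal operator of a doubling measure. -/

namespace HomType

variable {X : Type*} [MeasurableSpace X] {d : X → X → ℝ} {μ : Measure X}

/-- A measure that is positive, finite and doubling on quasi-metric balls. -/
structure IsDoublingOn (d : X → X → ℝ) (ν : Measure X) : Prop where
  pos : ∀ x r, 0 < r → 0 < ν (qball d x r)
  lt_top : ∀ x r, 0 < r → ν (qball d x r) < ∞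
  doubling : ∀ K : ℝ, 1 ≤ K → ∃ C : ℝ≥0, ∀ x r, 0 < r → ν (qball d x (K * r)) ≤ C * ν (qball d x r)

/-- The weak type estimate for the uncentred maximal operator of a doubling measure. -/
lemma IsDoublingOn.exists_weak_type (hX : IsHomogeneousType d μ) {ν : Measure X}
    (hν : IsDoublingOn d ν) :
    ∃ C : ℝ≥0, ∀ h : X → ℝ≥0∞, ∀ T : ℝ≥0∞, ∃ U : Set X, MeasurableSet U ∧
      (∀ x r, 0 < r → T * ν (qball d x r) < ∫⁻ y in qball d x r, h y ∂ν → qball d x r ⊆ U) ∧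
      T * ν U ≤ C * ∫⁻ y, h y ∂ν := by
  obtain ⟨A, hA1, hA⟩ := hX.quasiMetric.quasi_triangle
  -- If a ball of radius at most `2 s` meets a ball of radius `s`, two uses of the quasi-triangle
  -- inequality put it into the `K`-fold enlargement of the latter.
  set K : ℝ := A * (1 + 4 * A) with hK
  have hK1 : 1 ≤ K := by nlinarith
  obtain ⟨C, hC⟩ := hν.doubling K hK1
  refine ⟨C, fun h T => ?_⟩
  -- Radii are capped by `R` because the Vitali selection needs bounded radii; the estimate is
  -- uniform in `R` and passes to the increasing union.
  set V : ℕ → Set X := fun R => ⋃ (c : X × ℝ) (_ : 0 < c.2 ∧ c.2 ≤ R ∧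
    T * ν (qball d c.1 c.2) < ∫⁻ y in qball d c.1 c.2, h y ∂ν), qball d c.1 c.2 with hV
  have hVle : ∀ R, T * ν (V R) ≤ C * ∫⁻ y, h y ∂ν := by
    intro R
    set t : Set (X × ℝ) := {c | 0 < c.2 ∧ c.2 ≤ R ∧
      T * ν (qball d c.1 c.2) < ∫⁻ y in qball d c.1 c.2, h y ∂ν}
    obtain ⟨u, hut, hdisj, hcov⟩ := Vitali.exists_disjoint_subfamily_covering_enlargement
      (fun c : X × ℝ => qball d c.1 c.2) t (fun c => c.2) 2 one_lt_two (fun c hc => hc.1.le) R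
      (fun c hc => hc.2.1) (fun c hc => ⟨c.1, mem_qball_self hX.quasiMetric hc.1⟩)
    have hsf := hX.sigmaFinite
    -- The selected balls are disjoint and have positive measure for the σ-finite measure `μ`.
    have hucount : u.Countable := by
      have := Measure.countable_meas_pos_of_disjoint_iUnion (μ := μ)
        (As := fun c : u => qball d c.1.1 c.1.2)
        (fun c => hX.measurableSet_qball _ (hut c.2).1)
        (fun a b hab => hdisj a.2 b.2 (fun h' => hab (Subtype.ext h')))
      have huniv : {i : u | 0 < μ (qball d i.1.1 i.1.2)} = Set.univ :=
        Set.eq_univ_of_forall fun c => hX.measure_qball_pos _ (hut c.2).1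
      rw [huniv] at this
      exact Set.countable_coe_iff.1 (Set.countable_univ_iff.1 this)
    have hsub : V R ⊆ ⋃ c ∈ u, qball d c.1 (K * c.2) := by
      intro y hy
      simp only [hV, Set.mem_iUnion] at hy
      obtain ⟨c, hc, hyc⟩ := hy
      obtain ⟨b, hbu, ⟨z, hzc, hzb⟩, hcb⟩ := hcov c hc
      refine Set.mem_iUnion₂.2 ⟨b, hbu, ?_⟩
      have h1 : d c.1 y < c.2 := hyc
      have h2 : d c.1 z < c.2 := hzc
      have h3 : d b.1 z < b.2 := hzb
      have hb : 0 < b.2 := (hut hbu).1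
      have h4 := hA b.1 y z
      have h5 := hA z y c.1
      rw [hX.quasiMetric.symm z c.1] at h5
      have h6 : d z y ≤ A * (2 * b.2 + 2 * b.2) := h5.trans (by gcongr <;> linarith)
      change d b.1 y < K * b.2
      calc d b.1 y ≤ A * (d b.1 z + d z y) := h4
        _ < A * (b.2 + A * (2 * b.2 + 2 * b.2)) := by
            have : 0 < A := by linarith
            gcongr A * ?_
            linarith
        _ = K * b.2 := by rw [hK]; ring
    calc T * ν (V R) ≤ T * ν (⋃ c ∈ u, qball d c.1 (K * c.2)) := by gcongr
      _ ≤ T * ∑' c : u, ν (qball d c.1.1 (K * c.1.2)) := by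
          gcongr; exact measure_biUnion_le ν hucount _
      _ ≤ T * ∑' c : u, C * ν (qball d c.1.1 c.1.2) := by
          gcongr with c; exact hC _ _ (hut c.2).1
      _ = C * ∑' c : u, T * ν (qball d c.1.1 c.1.2) := by
          rw [ENNReal.tsum_mul_left, ENNReal.tsum_mul_left]; ring
      _ ≤ C * ∑' c : u, ∫⁻ y in qball d c.1.1 c.1.2, h y ∂ν := by
          gcongr with c; exact (hut c.2).2.2.le
      _ = C * ∫⁻ y in ⋃ c ∈ u, qball d c.1 c.2, h y ∂ν := by
          rw [lintegral_biUnion hucount (fun c hc => hX.measurableSet_qball _ (hut hc).1) hdisj]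
      _ ≤ C * ∫⁻ y, h y ∂ν := by gcongr; exact Measure.restrict_le_self
  have hmono : Monotone V := by
    intro R R' hRR' y hy
    simp only [hV, Set.mem_iUnion] at hy ⊢
    obtain ⟨c, hc, hyc⟩ := hy
    exact ⟨c, ⟨hc.1, hc.2.1.trans (by exact_mod_cast hRR'), hc.2.2⟩, hyc⟩
  -- An uncountable union of balls, which need not be open, may fail to be measurable; a measurable
  -- hull of the same measure replaces it.
  refine ⟨toMeasurable ν (⋃ R, V R), measurableSet_toMeasurable _ _, ?_, ?_⟩
  · intro x r hr hlt
    refine subset_trans ?_ (subset_toMeasurable _ _)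
    obtain ⟨R, hR⟩ := exists_nat_ge r
    intro y hy
    refine Set.mem_iUnion.2 ⟨R, ?_⟩
    simp only [hV, Set.mem_iUnion]
    exact ⟨(x, r), ⟨hr, hR, hlt⟩, hy⟩
  · rw [measure_toMeasurable, hmono.measure_iUnion, ENNReal.mul_iSup]
    exact iSup_le hVle

/-- The sum over the dyadic scales below `a` is geometric with ratio `2 ^ (-s)`, hence comparable to
its largest term. It sums the weak type estimates over the levels. -/
lemma tsum_int_two_rpow_le {s : ℝ} (hs : 0 < s) :
    ∃ C : ℝ≥0, ∀ a : ℝ≥0∞, ∑' k : ℤ, (if (2 : ℝ≥0∞) ^ (k : ℝ) < a then ((2 : ℝ≥0∞) ^ (k : ℝ)) ^ s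
      else 0) ≤ C * a ^ s := by
  set q : ℝ≥0∞ := (2 : ℝ≥0∞) ^ (-s) with hq
  have hq1 : q < 1 := ENNReal.rpow_lt_one_of_one_lt_of_neg (by norm_num) (by linarith)
  have hCfin : (1 - q)⁻¹ ≠ ∞ := ENNReal.inv_ne_top.2 (tsub_pos_of_lt hq1).ne'
  have hC1 : 1 ≤ (1 - q)⁻¹ := ENNReal.one_le_inv.2 tsub_le_self
  refine ⟨((1 - q)⁻¹).toNNReal, fun a => ?_⟩
  rw [ENNReal.coe_toNNReal hCfin]
  rcases eq_or_ne a 0 with rfl | ha0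
  · simp
  rcases eq_or_ne a ∞ with rfl | hatop
  · rw [ENNReal.top_rpow_of_pos hs, ENNReal.mul_top (by positivity)]
    exact le_top
  obtain ⟨j, hj1, hj2⟩ := ENNReal.exists_mem_Ioc_zpow ha0 hatop (y := 2) (by norm_num) (by simp)
  have hsupp : Function.support (fun k : ℤ => if (2 : ℝ≥0∞) ^ (k : ℝ) < a then
      ((2 : ℝ≥0∞) ^ (k : ℝ)) ^ s else 0) ⊆ Set.range (fun i : ℕ => j - (i : ℤ)) := by
    intro k hk
    have hka : (2 : ℝ≥0∞) ^ (k : ℝ) < a := by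
      by_contra h
      exact hk (if_neg h)
    have : (2 : ℝ≥0∞) ^ (k : ℝ) < (2 : ℝ≥0∞) ^ ((j + 1 : ℤ) : ℝ) := by
      rw [ENNReal.rpow_intCast 2 (j + 1)]; exact hka.trans_le hj2
    have hkj : k < j + 1 := by
      by_contra! h
      exact absurd this (not_lt.2 (ENNReal.rpow_le_rpow_of_exponent_le (by norm_num)
        (by exact_mod_cast h)))
    exact ⟨(j - k).toNat, by simp only; omega⟩
  have hinj : Function.Injective (fun i : ℕ => j - (i : ℤ)) := fun a b h => by
    simp only at h; omega
  rw [← hinj.tsum_eq hsupp]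
  calc ∑' i : ℕ, (if (2 : ℝ≥0∞) ^ (((j - (i : ℤ) : ℤ)) : ℝ) < a then
        ((2 : ℝ≥0∞) ^ ((j - (i : ℤ) : ℤ) : ℝ)) ^ s else 0)
      ≤ ∑' i : ℕ, ((2 : ℝ≥0∞) ^ (j : ℝ)) ^ s * q ^ i := by
        refine ENNReal.tsum_le_tsum fun i => ?_
        split_ifs
        · rw [hq, ← ENNReal.rpow_natCast, ← ENNReal.rpow_mul, ← ENNReal.rpow_mul,
            ← ENNReal.rpow_mul, ← ENNReal.rpow_add _ _ (by norm_num) (by norm_num)]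
          push_cast
          exact le_of_eq (by ring_nf)
        · exact bot_le
    _ = ((2 : ℝ≥0∞) ^ (j : ℝ)) ^ s * (1 - q)⁻¹ := by
        rw [ENNReal.tsum_mul_left, ENNReal.tsum_geometric]
    _ ≤ (1 - q)⁻¹ * a ^ s := by
        rw [mul_comm]
        gcongr
        rw [ENNReal.rpow_intCast]; exact hj1.le

/-- The uncentred maximal function of a doubling measure has a measurable majorant that is
bounded in `L^t`, `t > 1`. -/
lemma IsDoublingOn.exists_maximal_majorant (hX : IsHomogeneousType d μ) {ν : Measure X}
    (hν : IsDoublingOn d ν) {t : ℝ} (ht : 1 < t) :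
    ∃ C : ℝ≥0, ∀ h : X → ℝ≥0∞, Measurable h → ∃ H : X → ℝ≥0∞, Measurable H ∧
      (∀ x r, 0 < r → ∀ y ∈ qball d x r,
        (ν (qball d x r))⁻¹ * ∫⁻ z in qball d x r, h z ∂ν ≤ H y) ∧
      ∫⁻ y, H y ^ t ∂ν ≤ C * ∫⁻ y, h y ^ t ∂ν := by
  obtain ⟨C₁, hC₁⟩ := hν.exists_weak_type hX
  obtain ⟨C₂, hC₂⟩ := tsum_int_two_rpow_le (sub_pos.2 ht)
  refine ⟨((2 : ℝ≥0∞) ^ (2 * t)).toNNReal * C₁ * C₂, fun h hh => ?_⟩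
  -- the part of `h` above the level `2 ^ k`
  set hk : ℤ → X → ℝ≥0∞ := fun k => {y | (2 : ℝ≥0∞) ^ (k : ℝ) < h y}.indicator h
  have hset : ∀ k : ℤ, MeasurableSet {y | (2 : ℝ≥0∞) ^ (k : ℝ) < h y} :=
    fun k => measurableSet_lt measurable_const hh
  -- Where a ball average of `h` exceeds `2 ^ (k + 1)`, the average of the truncation `hk k` exceeds
  -- `2 ^ k`, since the discarded part is at most `2 ^ k`; so the ball lies in `U k`.
  choose U hUm hUsub hUle using fun k : ℤ => hC₁ (hk k) ((2 : ℝ≥0∞) ^ (k : ℝ))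
  -- An average in `(2 ^ j, 2 ^ (j + 1)]` puts its ball into `U (j - 1)`, whence the exponent `k +
  -- 2`.
  set H : X → ℝ≥0∞ := fun y => ⨆ k : ℤ, (U k).indicator (fun _ => (2 : ℝ≥0∞) ^ ((k : ℝ) + 2)) y
  have hHge : ∀ k, ∀ y ∈ U k, (2 : ℝ≥0∞) ^ ((k : ℝ) + 2) ≤ H y := fun k y hy =>
    le_iSup_of_le k (by rw [Set.indicator_of_mem hy])
  have hHm : Measurable H := Measurable.iSup fun k => measurable_const.indicator (hUm k)
  refine ⟨H, hHm, ?_, ?_⟩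
  · intro x r hr y hy
    set B := qball d x r
    have hB0 := (hν.pos x r hr).ne'
    have hBt := (hν.lt_top x r hr).ne
    set A := (ν B)⁻¹ * ∫⁻ z in B, h z ∂ν with hA
    have hmem : ∀ k : ℤ, (2 : ℝ≥0∞) ^ ((k : ℝ) + 1) < A → y ∈ U k := by
      intro k hkA
      refine hUsub k x r hr ?_ hy
      have h1 : (2 : ℝ≥0∞) ^ ((k : ℝ) + 1) * ν B < ∫⁻ z in B, h z ∂ν := by
        rw [hA, mul_comm, ← div_eq_mul_inv] at hkA
        exact (ENNReal.lt_div_iff_mul_lt (Or.inl hB0) (Or.inl hBt)).1 hkA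
      have h2 : ∫⁻ z in B, h z ∂ν ≤ (2 : ℝ≥0∞) ^ (k : ℝ) * ν B + ∫⁻ z in B, hk k z ∂ν := by
        calc ∫⁻ z in B, h z ∂ν ≤ ∫⁻ z in B, ((2 : ℝ≥0∞) ^ (k : ℝ) + hk k z) ∂ν := by
              refine lintegral_mono fun z => ?_
              by_cases hz : (2 : ℝ≥0∞) ^ (k : ℝ) < h z
              · have : hk k z = h z := Set.indicator_of_mem (by exact hz) h
                rw [this]; exact le_add_self
              · exact le_add_right (not_lt.1 hz)
          _ = _ := by
              rw [lintegral_add_left measurable_const, setLIntegral_const]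
      by_contra! h3
      refine absurd h1 (not_lt.2 (h2.trans ((add_le_add_right h3 _).trans ?_)))
      rw [ENNReal.rpow_add _ _ (by norm_num) (by norm_num), ENNReal.rpow_one, ← two_mul]
      exact le_of_eq (by ring)
    rcases eq_or_ne A 0 with h0 | h0
    · rw [h0]; exact bot_le
    rcases eq_or_ne A ∞ with h1 | h1
    · refine le_of_forall_lt fun b hb => ?_
      rcases eq_or_ne b 0 with rfl | hb0
      · refine lt_of_lt_of_le ?_ (hHge 0 y (hmem 0 (by simp [h1])))
        exact ENNReal.rpow_pos (by norm_num) (by norm_num)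
      obtain ⟨j, -, hj⟩ := ENNReal.exists_mem_Ioc_zpow hb0 (hb.trans_le le_top).ne (y := 2)
        (by norm_num) (by simp)
      refine lt_of_lt_of_le (hj.trans_lt ?_)
        (hHge j y (hmem j (by rw [h1]; finiteness)))
      rw [← ENNReal.rpow_intCast]
      exact ENNReal.rpow_lt_rpow_of_exponent_lt (by norm_num) (by simp) (by push_cast; linarith)
    obtain ⟨j, hj1, hj2⟩ := ENNReal.exists_mem_Ioc_zpow h0 h1 (y := 2) (by norm_num) (by simp)
    have hj3 := hHge (j - 1) y (hmem (j - 1) (by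
      rw [← ENNReal.rpow_intCast] at hj1; push_cast; simpa using hj1))
    refine hj2.trans (le_trans (le_of_eq ?_) hj3)
    rw [← ENNReal.rpow_intCast]; push_cast; ring_nf
  -- The supremum is replaced by the sum over the levels. After the weak type estimate and an
  -- exchange of sum and integral, what remains at each point is a geometric sum over the levels `2
  -- ^ k < h y`.
  · have hpt : ∀ y, H y ^ t ≤ ∑' k : ℤ, (U k).indicator
        (fun _ => ((2 : ℝ≥0∞) ^ ((k : ℝ) + 2)) ^ t) y := by
      intro y
      have h1 : H y ≤ (∑' k : ℤ, (U k).indicator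
        (fun _ => ((2 : ℝ≥0∞) ^ ((k : ℝ) + 2)) ^ t) y) ^ (1 / t) := by
        refine iSup_le fun k => ?_
        by_cases hy : y ∈ U k
        · rw [Set.indicator_of_mem hy, one_div, ENNReal.le_rpow_inv_iff (by linarith)]
          refine le_trans ?_ (ENNReal.le_tsum k)
          rw [Set.indicator_of_mem hy]
        · rw [Set.indicator_of_notMem hy]; exact bot_le
      rwa [one_div, ENNReal.le_rpow_inv_iff (by linarith)] at h1
    have hterm : ∀ k : ℤ, ((2 : ℝ≥0∞) ^ ((k : ℝ) + 2)) ^ t * ν (U k) ≤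
        2 ^ (2 * t) * C₁ * ∫⁻ y, ((2 : ℝ≥0∞) ^ (k : ℝ)) ^ (t - 1) * hk k y ∂ν := by
      intro k
      have e : ((2 : ℝ≥0∞) ^ ((k : ℝ) + 2)) ^ t =
          2 ^ (2 * t) * ((2 : ℝ≥0∞) ^ (k : ℝ)) ^ (t - 1) * (2 : ℝ≥0∞) ^ (k : ℝ) := by
        rw [← ENNReal.rpow_mul, ← ENNReal.rpow_mul, ← ENNReal.rpow_add _ _ (by norm_num) (by norm_num),
          ← ENNReal.rpow_add _ _ (by norm_num) (by norm_num)]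
        ring_nf
      rw [e, lintegral_const_mul _ (hh.indicator (hset k))]
      calc _ = 2 ^ (2 * t) * ((2 : ℝ≥0∞) ^ (k : ℝ)) ^ (t - 1) * ((2 : ℝ≥0∞) ^ (k : ℝ) * ν (U k)) := by
            ring
        _ ≤ 2 ^ (2 * t) * ((2 : ℝ≥0∞) ^ (k : ℝ)) ^ (t - 1) * (C₁ * ∫⁻ y, hk k y ∂ν) := by
            exact mul_le_mul_right (hUle k) _
        _ = _ := by ring
    calc ∫⁻ y, H y ^ t ∂ν ≤ ∫⁻ y, (∑' k : ℤ, (U k).indicator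
        (fun _ => ((2 : ℝ≥0∞) ^ ((k : ℝ) + 2)) ^ t) y) ∂ν := lintegral_mono hpt
      _ = ∑' k : ℤ, ((2 : ℝ≥0∞) ^ ((k : ℝ) + 2)) ^ t * ν (U k) := by
          rw [lintegral_tsum fun k => (measurable_const.indicator (hUm k)).aemeasurable]
          congr with k
          rw [lintegral_indicator_const (hUm k)]
      _ ≤ ∑' k : ℤ, 2 ^ (2 * t) * C₁ * ∫⁻ y, ((2 : ℝ≥0∞) ^ (k : ℝ)) ^ (t - 1) * hk k y ∂ν :=
          ENNReal.tsum_le_tsum hterm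
      _ = 2 ^ (2 * t) * C₁ * ∫⁻ y, (∑' k : ℤ, ((2 : ℝ≥0∞) ^ (k : ℝ)) ^ (t - 1) * hk k y) ∂ν := by
          rw [ENNReal.tsum_mul_left, lintegral_tsum fun k =>
            ((hh.indicator (hset k)).const_mul _).aemeasurable]
      _ ≤ 2 ^ (2 * t) * C₁ * ∫⁻ y, C₂ * h y ^ t ∂ν := by
          gcongr with y
          have e : ∀ k : ℤ, ((2 : ℝ≥0∞) ^ (k : ℝ)) ^ (t - 1) * hk k y =
              (if (2 : ℝ≥0∞) ^ (k : ℝ) < h y then ((2 : ℝ≥0∞) ^ (k : ℝ)) ^ (t - 1) else 0) * h y := by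
            intro k
            by_cases hy : (2 : ℝ≥0∞) ^ (k : ℝ) < h y
            · have : hk k y = h y := Set.indicator_of_mem (by exact hy) h
              rw [this, if_pos hy]
            · have : hk k y = 0 := Set.indicator_of_notMem (by exact hy) h
              rw [this, if_neg hy]; simp
          simp_rw [e]
          rw [ENNReal.tsum_mul_right]
          calc _ ≤ C₂ * h y ^ (t - 1) * h y := by gcongr; exact hC₂ _
            _ = C₂ * (h y ^ (t - 1) * h y ^ (1 : ℝ)) := by rw [ENNReal.rpow_one]; ring
            _ = C₂ * h y ^ t := by
                rw [← ENNReal.rpow_add_of_nonneg _ _ (by linarith) (by linarith)]; simp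
      _ = _ := by
          rw [lintegral_const_mul _ (hh.pow_const t)]
          push_cast
          rw [ENNReal.coe_toNNReal (ENNReal.rpow_lt_top_of_nonneg (by linarith) (by simp)).ne]
          ring

end HomType

/-! ### Upper integral, modular and Luxemburg norm. -/

namespace HomType

variable {X : Type*} [MeasurableSpace X] {d : X → X → ℝ} {μ : Measure X}

/-- The value `∞` on a measurable null set containing the exceptional points turns an almost
everywhere majorant into an everywhere one without changing its integral. -/
lemma upperIntegral_le_of_ae {f g : X → ℝ≥0∞} (hg : Measurable g) (h : ∀ᵐ x ∂μ, f x ≤ g x) :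
    upperIntegral μ f ≤ ∫⁻ x, g x ∂μ := by
  obtain ⟨N, hN, hNm, hN0⟩ := exists_measurable_superset_of_null h
  set g' : X → ℝ≥0∞ := fun x => g x + N.indicator (fun _ => ∞) x with hg'
  have hgm : Measurable (N.indicator (fun _ => (∞ : ℝ≥0∞))) := measurable_const.indicator hNm
  have hle : upperIntegral μ f ≤ ∫⁻ x, g' x ∂μ := by
    refine iInf_le_of_le g' (iInf_le_of_le (hg.add hgm) (iInf_le_of_le (fun x => ?_) le_rfl))
    by_cases hx : x ∈ N
    · simp [hg', hx]
    · have : f x ≤ g x := by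
        by_contra hc
        exact hx (hN hc)
      exact le_add_right this
  refine hle.trans (le_of_eq ?_)
  rw [lintegral_add_left hg, lintegral_indicator_const hNm, hN0]
  simp

lemma lintegral_le_upperIntegral (f : X → ℝ≥0∞) : ∫⁻ x, f x ∂μ ≤ upperIntegral μ f :=
  le_iInf fun _ => le_iInf fun _ => le_iInf fun h => lintegral_mono h

lemma upperIntegral_eq {f : X → ℝ≥0∞} (hf : Measurable f) :
    upperIntegral μ f = ∫⁻ x, f x ∂μ :=
  le_antisymm (upperIntegral_le_of_ae hf (Filter.Eventually.of_forall fun _ => le_rfl))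
    (lintegral_le_upperIntegral f)

lemma upperIntegral_mono {f g : X → ℝ≥0∞} (h : ∀ x, f x ≤ g x) :
    upperIntegral μ f ≤ upperIntegral μ g :=
  le_iInf fun k => le_iInf fun hk => le_iInf fun hgk =>
    iInf_le_of_le k (iInf_le_of_le hk (iInf_le_of_le (fun x => (h x).trans (hgk x)) le_rfl))

lemma modular_mono {p : X → ℝ} (hp : ∀ x, 0 ≤ p x) {f g : X → ℝ≥0∞} (h : ∀ x, f x ≤ g x) :
    modular μ p f ≤ modular μ p g :=
  upperIntegral_mono fun x => ENNReal.rpow_le_rpow (h x) (hp x)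

lemma lux_le {p : X → ℝ} {f : X → ℝ≥0∞} {t : ℝ≥0} (ht : 0 < t)
    (h : modular μ p (fun x => f x / t) ≤ 1) : lux μ p f ≤ t :=
  iInf_le_of_le t (iInf_le_of_le ht (iInf_le_of_le h le_rfl))

lemma lux_mono {p : X → ℝ} (hp : ∀ x, 0 ≤ p x) {f g : X → ℝ≥0∞} (h : ∀ x, f x ≤ g x) :
    lux μ p f ≤ lux μ p g := by
  refine le_iInf fun t => le_iInf fun ht => le_iInf fun hg => lux_le ht (le_trans ?_ hg)
  exact modular_mono hp fun x => by gcongr; exact h x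

lemma modular_le_one_of_lux_lt {p : X → ℝ} (hp : ∀ x, 0 ≤ p x) {f : X → ℝ≥0∞} {t : ℝ≥0}
    (h : lux μ p f < t) : modular μ p (fun x => f x / t) ≤ 1 := by
  simp only [lux, iInf_lt_iff] at h
  obtain ⟨s, hs, hs1, hst⟩ := h
  refine le_trans (modular_mono hp fun x => ?_) hs1
  exact ENNReal.div_le_div_left hst.le _

lemma mul_lux_le {p : X → ℝ} {f : X → ℝ≥0∞} (c : ℝ≥0) :
    c * lux μ p f ≤ lux μ p (fun x => c * f x) := by
  rcases eq_or_ne c 0 with rfl | hc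
  · simp
  have hc' : 0 < c := pos_iff_ne_zero.2 hc
  refine le_iInf fun t => le_iInf fun ht => le_iInf fun h => ?_
  have : lux μ p f ≤ ((t / c : ℝ≥0) : ℝ≥0∞) := by
    refine lux_le (by positivity) (le_trans (le_of_eq ?_) h)
    congr with x
    rw [ENNReal.coe_div hc, ENNReal.div_eq_inv_mul, ENNReal.inv_div (by simp) (by simp [hc]),
      ENNReal.div_eq_inv_mul, ENNReal.div_eq_inv_mul]
    ring
  calc (c : ℝ≥0∞) * lux μ p f ≤ c * ((t / c : ℝ≥0) : ℝ≥0∞) := by gcongr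
    _ = t := by rw [← ENNReal.coe_mul, mul_div_cancel₀ _ hc]

lemma lintegral_const_mul_rpow_le {p : X → ℝ} {a b : ℝ} (hp : ∀ᵐ x ∂μ, a ≤ p x ∧ p x ≤ b)
    (ha : 0 ≤ a) {c : ℝ≥0} (hc : 1 ≤ c) (F : X → ℝ≥0∞) :
    ∫⁻ x, (c * F x) ^ p x ∂μ ≤ (c : ℝ≥0∞) ^ b * ∫⁻ x, F x ^ p x ∂μ := by
  rw [← lintegral_const_mul' _ _ (by
    exact ENNReal.rpow_ne_top_of_nonneg' (by simpa using lt_of_lt_of_le one_pos hc) (by simp))]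
  refine lintegral_mono_ae ?_
  filter_upwards [hp] with x hx
  rw [ENNReal.mul_rpow_of_nonneg _ _ (ha.trans hx.1)]
  gcongr
  · exact_mod_cast hc
  · exact hx.2

/-- Boundedness of the exponent makes the modular continuous under scaling: a factor `c ≥ 1` costs
at most `c ^ b`. Division by more than the norm gives a modular at most one, division by less gives
one above one, and `c → 1⁺` closes the gap. This normalizes the density of a weight on each ball. -/
lemma lintegral_rpow_div_lux {p : X → ℝ} (hpm : Measurable p) (hp0 : ∀ x, 0 ≤ p x) {a b : ℝ}
    (ha : 0 < a) (hp : ∀ᵐ x ∂μ, a ≤ p x ∧ p x ≤ b) {f : X → ℝ≥0∞} (hf : Measurable f)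
    (h0 : lux μ p f ≠ 0) (htop : lux μ p f ≠ ∞) :
    ∫⁻ x, (f x / lux μ p f) ^ p x ∂μ = 1 := by
  lift lux μ p f to ℝ≥0 using htop with n hn
  have hn0 : n ≠ 0 := by simpa using h0
  have hnpos : 0 < n := pos_iff_ne_zero.2 hn0
  have hmod : ∀ t : ℝ≥0, modular μ p (fun x => f x / t) = ∫⁻ x, (f x / t) ^ p x ∂μ :=
    fun t => upperIntegral_eq ((hf.div_const _).pow hpm)
  have hdiv : ∀ (u v : ℝ≥0), u ≠ 0 → v ≠ 0 → ∀ x, f x / u = ((v / u : ℝ≥0) : ℝ≥0∞) * (f x / v) := by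
    intro u v hu hv x
    have hv' : (v : ℝ≥0∞) ≠ 0 := by simpa
    rw [ENNReal.coe_div hu, div_eq_mul_inv, div_eq_mul_inv, div_eq_mul_inv]
    calc f x * (u : ℝ≥0∞)⁻¹ = f x * (u : ℝ≥0∞)⁻¹ * (v * (v : ℝ≥0∞)⁻¹) := by
          rw [ENNReal.mul_inv_cancel hv' (by simp), mul_one]
      _ = _ := by ring
  have hlim : Filter.Tendsto (fun c : ℝ≥0 => (c : ℝ≥0∞) ^ b) (nhdsWithin 1 (Set.Ioi 1)) (nhds 1) := by
    have h1 : Continuous (fun c : ℝ≥0 => (c : ℝ≥0∞) ^ b) :=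
      ENNReal.continuous_rpow_const.comp ENNReal.continuous_coe
    have := h1.tendsto 1
    simp only [ENNReal.coe_one, ENNReal.one_rpow] at this
    exact this.mono_left nhdsWithin_le_nhds
  have hne : (nhdsWithin (1 : ℝ≥0) (Set.Ioi 1)).NeBot := inferInstance
  apply le_antisymm
  · refine ge_of_tendsto hlim ?_
    filter_upwards [self_mem_nhdsWithin] with c hc
    have hc1 : 1 < c := hc
    have hc0 : c * n ≠ 0 := mul_ne_zero (by positivity) hn0
    have h1 : lux μ p f < ((c * n : ℝ≥0) : ℝ≥0∞) := by
      rw [← hn]; exact_mod_cast lt_mul_of_one_lt_left hnpos hc1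
    have h2 := modular_le_one_of_lux_lt hp0 h1
    rw [hmod] at h2
    have h3 : c * n / n = c := by field_simp
    calc ∫⁻ x, (f x / n) ^ p x ∂μ = ∫⁻ x, ((c : ℝ≥0∞) * (f x / (c * n : ℝ≥0))) ^ p x ∂μ := by
          simp_rw [hdiv n (c * n) hn0 hc0, h3]
      _ ≤ (c : ℝ≥0∞) ^ b * ∫⁻ x, (f x / (c * n : ℝ≥0)) ^ p x ∂μ :=
          lintegral_const_mul_rpow_le hp ha.le hc1.le _
      _ ≤ (c : ℝ≥0∞) ^ b * 1 := by gcongr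
      _ = _ := mul_one _
  · have hlim2 := ENNReal.Tendsto.mul_const (b := ∫⁻ x, (f x / n) ^ p x ∂μ) hlim
      (Or.inl one_ne_zero)
    rw [one_mul] at hlim2
    refine ge_of_tendsto hlim2 ?_
    filter_upwards [self_mem_nhdsWithin] with c hc
    have hc1 : 1 < c := hc
    have hcpos : 0 < c := by positivity
    have hc0 : n / c ≠ 0 := by positivity
    have h1 : ((n / c : ℝ≥0) : ℝ≥0∞) < lux μ p f := by
      rw [← hn]; exact_mod_cast div_lt_self hnpos hc1
    have h2 : 1 < modular μ p (fun x => f x / (n / c : ℝ≥0)) := by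
      by_contra! h
      exact absurd (lux_le (by positivity) h) (not_le.2 h1)
    rw [hmod] at h2
    have h3 : n / (n / c) = c := by field_simp
    calc (1 : ℝ≥0∞) ≤ ∫⁻ x, (f x / (n / c : ℝ≥0)) ^ p x ∂μ := h2.le
      _ = ∫⁻ x, ((c : ℝ≥0∞) * (f x / n)) ^ p x ∂μ := by
          simp_rw [hdiv (n / c) n hc0 hn0, h3]
      _ ≤ _ := lintegral_const_mul_rpow_le hp ha.le hc1.le _

/-- If the norm vanishes, the modular of `c f` is at most one for every `c ≥ 1`, while it is at
least `c ^ a` times the modular of `f`. -/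
lemma ae_eq_zero_of_lux_eq_zero {p : X → ℝ} (hpm : Measurable p) (hp0 : ∀ x, 0 ≤ p x) {a : ℝ}
    (ha : 0 < a) (hp : ∀ᵐ x ∂μ, a ≤ p x) {f : X → ℝ≥0∞} (hf : Measurable f)
    (h0 : lux μ p f = 0) : ∀ᵐ x ∂μ, f x = 0 := by
  have hle : ∀ c : ℝ≥0, 1 ≤ c → ∫⁻ x, f x ^ p x ∂μ ≤ ((c : ℝ≥0∞) ^ a)⁻¹ := by
    intro c hc
    have hc0 : c ≠ 0 := (lt_of_lt_of_le one_pos hc).ne'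
    have hcc : (c : ℝ≥0∞) ≠ 0 := by simpa
    have h1 : lux μ p f < ((c⁻¹ : ℝ≥0) : ℝ≥0∞) := by
      rw [h0]; exact_mod_cast inv_pos.2 (pos_iff_ne_zero.2 hc0)
    have h2 := modular_le_one_of_lux_lt hp0 h1
    have h3 : modular μ p (fun x => f x / ((c⁻¹ : ℝ≥0) : ℝ≥0∞)) = ∫⁻ x, (c * f x) ^ p x ∂μ := by
      rw [modular, upperIntegral_eq ((hf.div_const _).pow hpm)]
      simp_rw [ENNReal.coe_inv hc0, div_eq_mul_inv, inv_inv, mul_comm]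
    rw [h3] at h2
    have h4 : (c : ℝ≥0∞) ^ a * ∫⁻ x, f x ^ p x ∂μ ≤ 1 := by
      refine le_trans ?_ h2
      rw [← lintegral_const_mul _ (hf.pow hpm)]
      refine lintegral_mono_ae ?_
      filter_upwards [hp] with x hx
      rw [ENNReal.mul_rpow_of_nonneg _ _ (hp0 x)]
      gcongr
      exact_mod_cast hc
    rw [← one_div]
    refine (ENNReal.le_div_iff_mul_le (Or.inl ?_) (Or.inl ?_)).2 (by rwa [mul_comm])
    · simp [hc0]
    · exact ENNReal.rpow_ne_top_of_nonneg ha.le (by simp)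
  have hlim : Filter.Tendsto (fun c : ℝ≥0 => ((c : ℝ≥0∞) ^ a)⁻¹) Filter.atTop (nhds 0) := by
    rw [← ENNReal.inv_top]
    refine tendsto_inv_iff.2 ?_
    exact (ENNReal.tendsto_rpow_at_top ha).comp
      (ENNReal.tendsto_coe_nhds_top.2 Filter.tendsto_id)
  have hz : ∫⁻ x, f x ^ p x ∂μ = 0 :=
    le_antisymm (ge_of_tendsto hlim (Filter.eventually_atTop.2 ⟨1, hle⟩)) bot_le
  rw [lintegral_eq_zero_iff (hf.pow hpm)] at hz
  filter_upwards [hz, hp] with x hx hpx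
  have : f x ^ p x = 0 := hx
  rw [ENNReal.rpow_eq_zero_iff] at this
  rcases this with h | h
  · exact h.1
  · linarith [h.2]

/-- Division of `f` by `C ^ (1 / a) ≥ 1` divides `f ^ p` by at least `C`. Only an almost everywhere
majorant is required to be measurable, not `f`: in this form it applies to maximal functions. -/
lemma lux_lt_top_of_lintegral {p : X → ℝ} {a : ℝ} (ha : 0 < a)
    (hp : ∀ᵐ x ∂μ, a ≤ p x) {f : X → ℝ≥0∞} {Ψ : X → ℝ≥0∞} (hΨ : Measurable Ψ)
    (hle : ∀ᵐ x ∂μ, f x ^ p x ≤ Ψ x) {C : ℝ≥0} (hC : 1 ≤ C) (h_int : ∫⁻ x, Ψ x ∂μ ≤ C) :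
    lux μ p f ≤ ((C ^ (1 / a) : ℝ≥0) : ℝ≥0∞) := by
  have hCpos : 0 < C := lt_of_lt_of_le one_pos hC
  set t : ℝ≥0 := C ^ (1 / a) with ht
  have htpos : 0 < t := NNReal.rpow_pos hCpos
  have ht1 : 1 ≤ t := NNReal.one_le_rpow hC (by positivity)
  refine lux_le htpos ?_
  refine (upperIntegral_le_of_ae (hΨ.const_mul (C : ℝ≥0∞)⁻¹) ?_).trans ?_
  · filter_upwards [hp, hle] with x hx hx2
    rw [div_eq_mul_inv, ENNReal.mul_rpow_of_nonneg _ _ (ha.le.trans hx), mul_comm]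
    gcongr
    rw [← ENNReal.coe_inv htpos.ne', ← ENNReal.coe_inv hCpos.ne', 
      ← ENNReal.coe_rpow_of_nonneg _ (ha.le.trans hx)]
    refine ENNReal.coe_le_coe.2 ?_
    rw [NNReal.inv_rpow]
    gcongr
    calc C = t ^ a := by rw [ht, ← NNReal.rpow_mul]; field_simp; simp
      _ ≤ t ^ p x := NNReal.rpow_le_rpow_of_exponent_le ht1 hx
  · rw [lintegral_const_mul _ hΨ]
    calc (C : ℝ≥0∞)⁻¹ * ∫⁻ x, Ψ x ∂μ ≤ (C : ℝ≥0∞)⁻¹ * C := by gcongr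
      _ = 1 := ENNReal.inv_mul_cancel (by simpa using hCpos.ne') (by simp)

lemma ExpP.exists_bounds {p : X → ℝ} (hp : ExpP μ p) :
    ∃ a b : ℝ, 1 < a ∧ ∀ᵐ x ∂μ, a ≤ p x ∧ p x ≤ b := by
  obtain ⟨a, ha1, ha2⟩ := exists_between hp.one_lt_essInf
  have hat : a ≠ ∞ := (ha2.trans_le le_top).ne
  refine ⟨a.toReal, (essSup (fun x => ENNReal.ofReal (p x)) μ).toReal, ?_, ?_⟩
  · rwa [← ENNReal.ofReal_lt_ofReal_iff_of_nonneg zero_le_one, ENNReal.ofReal_one,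
      ENNReal.ofReal_toReal hat]
  · filter_upwards [ae_lt_of_lt_essInf ha2, ENNReal.ae_le_essSup (fun x => ENNReal.ofReal (p x))]
      with x h1 h2
    have hp0 : 0 ≤ p x := zero_le_one.trans (hp.one_le x)
    refine ⟨?_, ?_⟩
    · have := ENNReal.toReal_mono (by simp) h1.le
      rwa [ENNReal.toReal_ofReal hp0] at this
    · have := ENNReal.toReal_mono hp.essSup_lt_top.ne h2
      rwa [ENNReal.toReal_ofReal hp0] at this

lemma ExpP0.exists_bounds {p : X → ℝ} (hp : ExpP0 μ p) :
    ∃ a b : ℝ, 0 < a ∧ ∀ᵐ x ∂μ, a ≤ p x ∧ p x ≤ b := by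
  obtain ⟨a, ha1, ha2⟩ := exists_between hp.essInf_pos
  have hat : a ≠ ∞ := (ha2.trans_le le_top).ne
  refine ⟨a.toReal, (essSup (fun x => ENNReal.ofReal (p x)) μ).toReal, ?_, ?_⟩
  · exact ENNReal.toReal_pos ha1.ne' hat
  · filter_upwards [ae_lt_of_lt_essInf ha2, ENNReal.ae_le_essSup (fun x => ENNReal.ofReal (p x))]
      with x h1 h2
    have hp0 : 0 ≤ p x := hp.nonneg x
    refine ⟨?_, ?_⟩
    · have := ENNReal.toReal_mono (by simp) h1.le
      rwa [ENNReal.toReal_ofReal hp0] at this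
    · have := ENNReal.toReal_mono hp.essSup_lt_top.ne h2
      rwa [ENNReal.toReal_ofReal hp0] at this

lemma ExpP.conjExponent_nonneg {p : X → ℝ} (hp : ExpP μ p) (x : X) :
    0 ≤ (p x).conjExponent :=
  div_nonneg (zero_le_one.trans (hp.one_le x)) (sub_nonneg.2 (hp.one_le x))

lemma ExpP.measurable_conjExponent {p : X → ℝ} (hp : ExpP μ p) :
    Measurable fun x => (p x).conjExponent :=
  hp.measurable.div (hp.measurable.sub_const 1)

lemma conjExponent_mem {p a b : ℝ} (ha : 1 < a) (h : a ≤ p ∧ p ≤ b) :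
    1 ≤ p.conjExponent ∧ p.conjExponent ≤ a.conjExponent := by
  have hp : 1 < p := ha.trans_le h.1
  have e : ∀ t : ℝ, 1 < t → t.conjExponent = 1 + 1 / (t - 1) := by
    intro t ht
    have : t - 1 ≠ 0 := by linarith
    rw [Real.conjExponent]; field_simp; ring
  rw [e p hp, e a ha]
  have : 0 < a - 1 := by linarith
  refine ⟨by have : 0 < p - 1 := by linarith
             linarith [one_div_pos.2 this], ?_⟩
  gcongr
  exact h.1

end HomType

/-! ### Necessity of the weight condition. -/

namespace HomType

variable {X : Type*} [MeasurableSpace X] {d : X → X → ℝ} {μ : Measure X}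

/-- The norm of `ω⁻¹ χ_B` in `L^{p'(·)}` is attained by testing against the unit ball of
`L^{p(·)}(X, ω)`. -/
lemma exists_dual_function (hX : IsHomogeneousType d μ) {p : X → ℝ} (hp : ExpP μ p)
    {ω : X → ℝ≥0∞} (hω : IsWeight d μ ω) (c : X) {r : ℝ} (hr : 0 < r) {t : ℝ≥0} (ht : 0 < t)
    (hlt : t < lux μ (fun x => (p x).conjExponent) ((qball d c r).indicator fun x => (ω x)⁻¹)) :
    ∃ f : X → ℝ, Measurable f ∧ wlux μ p ω (fun x => ‖f x‖ₑ) ≤ 1 ∧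
      (t : ℝ≥0∞) ≤ ∫⁻ x in qball d c r, ‖f x‖ₑ ∂μ := by
  obtain ⟨a, b, ha, hab⟩ := hp.exists_bounds
  set B := qball d c r
  have hB : MeasurableSet B := hX.measurableSet_qball c hr
  set p' : X → ℝ := fun x => (p x).conjExponent with hp'
  have hp'm : Measurable p' := hp.measurable_conjExponent
  have hp'0 : ∀ x, 0 ≤ p' x := hp.conjExponent_nonneg
  -- The extremal function for Hölder's inequality is a multiple of `φ`, whose integral over `B`
  -- exceeds one because `t` lies below the norm.
  set φ : X → ℝ≥0∞ := fun x => ((ω x)⁻¹ / t) ^ p' x with hφ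
  have hφm : Measurable φ := (hω.measurable.inv.div_const _).pow hp'm
  have htt : (t : ℝ≥0∞) ≠ 0 := by simpa using ht.ne'
  have hmod : 1 < ∫⁻ x in B, φ x ∂μ := by
    by_contra! hle
    refine absurd (lux_le ht ?_) (not_le.2 hlt)
    refine (upperIntegral_le_of_ae (hφm.indicator hB) ?_).trans ?_
    · filter_upwards [hab] with x hx
      by_cases hxB : x ∈ B
      · simp [hxB, hφ, hp']
      · have := (conjExponent_mem ha hx).1
        simp only [hxB, not_false_eq_true, Set.indicator_of_notMem, ENNReal.zero_div]
        rw [ENNReal.zero_rpow_of_pos (by linarith)]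
    · rwa [lintegral_indicator hB]
  -- Restricting to the set where `ω⁻¹` is at most `k` makes the integral of `φ` finite; for large
  -- `k` it still exceeds one.
  set S : ℕ → Set X := fun k => B ∩ {x | (ω x)⁻¹ ≤ k} with hS
  have hSm : ∀ k, MeasurableSet (S k) := fun k =>
    hB.inter (measurableSet_le hω.measurable.inv measurable_const)
  have hSmono : Monotone S := fun k l hkl x hx => ⟨hx.1,
    (show (ω x)⁻¹ ≤ (k : ℝ≥0∞) from hx.2).trans (by exact_mod_cast hkl)⟩
  obtain ⟨k, hk⟩ : ∃ k, 1 < ∫⁻ x in S k, φ x ∂μ := by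
    have h1 : ∫⁻ x in B, φ x ∂μ = μ.withDensity φ (⋃ k, S k) := by
      rw [withDensity_apply _ (MeasurableSet.iUnion hSm)]
      refine setLIntegral_congr ?_
      filter_upwards [hω.pos] with x hx
      refine propext ⟨fun hxB => ?_, fun hx' => ?_⟩
      · obtain ⟨k, hk⟩ := ENNReal.exists_nat_gt (ENNReal.inv_ne_top.2 hx.ne')
        exact Set.mem_iUnion.2 ⟨k, hxB, hk.le⟩
      · obtain ⟨k, hk⟩ := Set.mem_iUnion.1 hx'
        exact hk.1
    rw [h1, hSmono.measure_iUnion, lt_iSup_iff] at hmod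
    obtain ⟨k, hk⟩ := hmod
    exact ⟨k, by rwa [withDensity_apply _ (hSm k)] at hk⟩
  set A := ∫⁻ x in S k, φ x ∂μ with hA
  have hφS : ∀ x ∈ S k, φ x ≠ ∞ := fun x hx =>
    ENNReal.rpow_ne_top_of_nonneg (hp'0 x)
      (ENNReal.div_ne_top (ne_top_of_le_ne_top (by simp) hx.2) htt)
  have hAtop : A ≠ ∞ := by
    refine ne_of_lt (lt_of_le_of_lt ?_ (ENNReal.mul_lt_top (a := (max 1 ((k : ℝ≥0∞) / t)) ^ a.conjExponent)
      (b := μ B) ?_ (hX.measure_qball_lt_top c r)))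
    · calc A ≤ ∫⁻ x in S k, (max 1 ((k : ℝ≥0∞) / t)) ^ a.conjExponent ∂μ := by
            refine lintegral_mono_ae ?_
            filter_upwards [ae_restrict_of_ae hab, ae_restrict_mem (hSm k)] with x hx hxS
            calc φ x ≤ (max 1 ((k : ℝ≥0∞) / t)) ^ p' x := by
                  refine ENNReal.rpow_le_rpow (le_max_of_le_right ?_) (hp'0 x)
                  gcongr; exact hxS.2
              _ ≤ _ := ENNReal.rpow_le_rpow_of_exponent_le (le_max_left _ _)
                  (conjExponent_mem ha hx).2
        _ = (max 1 ((k : ℝ≥0∞) / t)) ^ a.conjExponent * μ (S k) := by rw [setLIntegral_const]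
        _ ≤ _ := by gcongr; exact Set.inter_subset_left
    · refine ENNReal.rpow_lt_top_of_nonneg ?_ ?_
      · exact div_nonneg (by linarith) (by linarith)
      · exact (max_lt ENNReal.one_lt_top (ENNReal.div_lt_top (by simp) htt)).ne
  have hA0 : A ≠ 0 := (one_pos.trans hk).ne'
  have hfn : ∀ x, ‖((S k).indicator (fun x => φ x * t / A) x).toReal‖ₑ =
      (S k).indicator (fun x => φ x * t / A) x := by
    intro x
    rw [Real.enorm_eq_ofReal ENNReal.toReal_nonneg, ENNReal.ofReal_toReal]
    by_cases hx : x ∈ S k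
    · rw [Set.indicator_of_mem hx]
      exact ENNReal.div_ne_top (ENNReal.mul_ne_top (hφS x hx) (by simp)) hA0
    · simp [hx]
  -- With `u = ω⁻¹ / t` this function satisfies `ω f = u ^ (p' - 1) / A` on `S k`. As `(p' - 1) p =
  -- p'` and `A > 1`, its modular is at most `∫ φ / A = 1`, while its integral is exactly `t`.
  refine ⟨fun x => ((S k).indicator (fun x => φ x * t / A) x).toReal, ?_, ?_, ?_⟩
  · exact (((hφm.mul_const _).div_const _).indicator (hSm k)).ennreal_toReal
  · simp_rw [wlux, hfn]
    refine lux_le one_pos ?_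
    refine (upperIntegral_le_of_ae ((hφm.div_const A).indicator (hSm k)) ?_).trans ?_
    · filter_upwards [hab, hω.pos, hω.lt_top] with x hx h0 htop
      have hp1 : 1 < p x := ha.trans_le hx.1
      by_cases hxS : x ∈ S k
      swap
      · simp only [hxS, not_false_eq_true, Set.indicator_of_notMem, mul_zero, ENNReal.zero_div]
        rw [ENNReal.zero_rpow_of_pos (by linarith)]
      simp only [hxS, Set.indicator_of_mem, ENNReal.coe_one, div_one]
      set u := (ω x)⁻¹ / t with hu
      have hu0 : u ≠ 0 := ENNReal.div_ne_zero.2 ⟨ENNReal.inv_ne_zero.2 htop.ne, by simp⟩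
      have hut : u ≠ ∞ := ENNReal.div_ne_top (ENNReal.inv_ne_top.2 h0.ne') htt
      have hui : ω x * t = u⁻¹ := by
        rw [hu, ENNReal.inv_div (Or.inl (by simp)) (Or.inl htt), div_eq_mul_inv, inv_inv, mul_comm]
      have e1 : ω x * (φ x * t / A) = u ^ (p' x - 1) / A := by
        calc ω x * (φ x * t / A) = (ω x * t) * φ x / A := by
              simp only [div_eq_mul_inv]; ring
          _ = _ := by
              have : φ x = u ^ p' x := rfl
              rw [hui, this, ENNReal.rpow_sub _ _ hu0 hut, ENNReal.rpow_one]
              simp only [div_eq_mul_inv]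
              ring
      have e2 : (p' x - 1) * p x = p' x := by
        have : p x - 1 ≠ 0 := by linarith
        simp only [hp', Real.conjExponent]; field_simp; ring
      rw [e1, ENNReal.div_rpow_of_nonneg _ _ (by linarith), ← ENNReal.rpow_mul, e2]
      gcongr
      calc A = A ^ (1 : ℝ) := (ENNReal.rpow_one _).symm
        _ ≤ A ^ p x := ENNReal.rpow_le_rpow_of_exponent_le hk.le hp1.le
    · rw [lintegral_indicator (hSm k)]
      simp_rw [div_eq_mul_inv]
      rw [lintegral_mul_const _ hφm, ENNReal.mul_inv_cancel hA0 hAtop]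
  · simp_rw [hfn]
    rw [lintegral_indicator (hSm k), Measure.restrict_restrict (hSm k),
      Set.inter_eq_left.2 (show S k ⊆ B from Set.inter_subset_left)]
    simp_rw [div_eq_mul_inv, mul_assoc]
    rw [lintegral_mul_const _ hφm, ← hA, mul_comm (t : ℝ≥0∞), ← mul_assoc,
      ENNReal.mul_inv_cancel hA0 hAtop, one_mul]

lemma lux_indicator_pos (hX : IsHomogeneousType d μ) {p : X → ℝ} (hpm : Measurable p)
    (hp0 : ∀ x, 0 ≤ p x) {a : ℝ} (ha : 0 < a) (hp : ∀ᵐ x ∂μ, a ≤ p x) {v : X → ℝ≥0∞}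
    (hv : Measurable v) (hvpos : ∀ᵐ x ∂μ, 0 < v x) (c : X) {r : ℝ} (hr : 0 < r) :
    lux μ p ((qball d c r).indicator v) ≠ 0 := by
  intro h0
  have h1 := ae_eq_zero_of_lux_eq_zero hpm hp0 ha hp
    (hv.indicator (hX.measurableSet_qball c hr)) h0
  have h2 : ∀ᵐ x ∂μ, x ∉ qball d c r := by
    filter_upwards [h1, hvpos] with x hx hx2 hxB
    rw [Set.indicator_of_mem hxB] at hx
    exact hx2.ne' hx
  exact (hX.measure_qball_pos c hr).ne' (by simpa [ae_iff] using h2)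

/-- The `A_{p⃗(·), q(·)}` constant is at most any bound for the fractional maximal operator. -/
lemma apqConst_le_of_hasBound (hX : IsHomogeneousType d μ) {m : ℕ} {p : Fin m → X → ℝ}
    (hp : ∀ i, ExpP μ (p i)) {q : X → ℝ} (hq : ExpP0 μ q) {η : ℝ} {ω : Fin m → X → ℝ≥0∞}
    (hω : ∀ i, IsWeight d μ (ω i)) {C : ℝ≥0}
    (hC : HasBound μ p ω q (fun x => ∏ i, ω i x) (fracMaximal d μ η) C) :
    apqConst d μ η p q ω ≤ C := by
  refine iSup_le fun c => iSup_le fun r => iSup_le fun hr => ?_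
  set B := qball d c r with hB
  set N := lux μ q (B.indicator fun x => ∏ i, ω i x) with hN
  set n : Fin m → ℝ≥0∞ :=
    fun i => lux μ (fun x => (p i x).conjExponent) (B.indicator fun x => (ω i x)⁻¹) with hn
  have hμ0 : μ B ≠ 0 := (hX.measure_qball_pos c hr).ne'
  have hμt : μ B ≠ ∞ := (hX.measure_qball_lt_top c r).ne
  have hn0 : ∀ i, n i ≠ 0 := by
    intro i
    obtain ⟨a, b, ha, hab⟩ := (hp i).exists_bounds
    refine lux_indicator_pos hX (hp i).measurable_conjExponent (hp i).conjExponent_nonneg one_pos ?_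
      (hω i).measurable.inv ?_ c hr
    · filter_upwards [hab] with x hx using (conjExponent_mem ha hx).1
    · filter_upwards [(hω i).lt_top] with x hx using ENNReal.inv_pos.2 hx.ne
  -- The dual norms may still be infinite here; finite numbers strictly below them suffice and are
  -- sent to the norms at the end.
  have key : ∀ t : Fin m → ℝ≥0, (∀ i, 0 < t i) → (∀ i, t i < n i) →
      μ B ^ (η - m) * N * ∏ i, (t i : ℝ≥0∞) ≤ C := by
    intro t ht0 htn
    choose f hf hfle hft using fun i => exists_dual_function hX (hp i) (hω i) c hr (ht0 i) (htn i)
    have h1 := hC f hf (fun i => (hfle i).trans_lt ENNReal.one_lt_top)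
    have hct : μ B ^ (η - m) * ∏ i, (t i : ℝ≥0∞) ≠ ∞ :=
      ENNReal.mul_ne_top (ENNReal.rpow_ne_top_of_ne_zero hμ0 hμt)
        (ENNReal.prod_ne_top fun i _ => ENNReal.coe_ne_top)
    have h2 : μ B ^ (η - m) * N * ∏ i, (t i : ℝ≥0∞) ≤
        wlux μ q (fun x => ∏ i, ω i x) (fracMaximal d μ η f) := by
      calc μ B ^ (η - m) * N * ∏ i, (t i : ℝ≥0∞)
          = ((μ B ^ (η - m) * ∏ i, (t i : ℝ≥0∞)).toNNReal : ℝ≥0∞) * N := by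
            rw [ENNReal.coe_toNNReal hct]; ring
        _ ≤ _ := mul_lux_le _
        _ ≤ _ := by
            refine lux_mono hq.nonneg fun x => ?_
            rw [ENNReal.coe_toNNReal hct]
            by_cases hx : x ∈ B
            swap
            · simp [hx]
            rw [Set.indicator_of_mem hx, mul_comm]
            refine mul_le_mul_right ?_ _
            have h3 : fracAverage μ η B f x ≤ fracMaximal d μ η f x :=
              le_iSup_of_le c (le_iSup_of_le r (le_iSup_of_le hr le_rfl))
            refine le_trans ?_ h3
            rw [fracAverage, Set.indicator_of_mem hx, ENNReal.rpow_sub _ _ hμ0 hμt,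
              Finset.prod_mul_distrib, Finset.prod_const, Finset.card_univ, Fintype.card_fin,
              ENNReal.rpow_natCast, div_eq_mul_inv, ENNReal.inv_pow, mul_assoc]
            gcongr with i
            exact hft i
    refine h2.trans (h1.trans ?_)
    calc _ ≤ (C : ℝ≥0∞) * ∏ _i : Fin m, 1 := by gcongr with i; exact hfle i
      _ = C := by simp
  have hseq : ∀ i, ∃ u : ℕ → ℝ≥0, (∀ k, 0 < u k ∧ (u k : ℝ≥0∞) < n i) ∧
      Filter.Tendsto (fun k => (u k : ℝ≥0∞)) Filter.atTop (nhds (n i)) := by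
    intro i
    obtain ⟨u, -, hu1, hu2⟩ := exists_seq_strictMono_tendsto' (pos_iff_ne_zero.2 (hn0 i))
    refine ⟨fun k => (u k).toNNReal, fun k => ?_, ?_⟩
    · have hne : u k ≠ ∞ := ((hu1 k).2.trans_le le_top).ne
      exact ⟨ENNReal.toNNReal_pos (hu1 k).1.ne' hne, by
        rw [ENNReal.coe_toNNReal hne]; exact (hu1 k).2⟩
    · refine hu2.congr fun k => ?_
      rw [ENNReal.coe_toNNReal ((hu1 k).2.trans_le le_top).ne]
  choose u hu1 hu2 using hseq
  have hprod : ∀ s : Finset (Fin m), Filter.Tendsto (fun k => ∏ i ∈ s, (u i k : ℝ≥0∞))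
      Filter.atTop (nhds (∏ i ∈ s, n i)) := by
    intro s
    induction s using Finset.induction_on with
    | empty => simp
    | insert i s hi ih =>
      simp_rw [Finset.prod_insert hi]
      exact ENNReal.Tendsto.mul (hu2 i) (Or.inl (hn0 i)) ih
        (Or.inl (Finset.prod_ne_zero_iff.2 fun j _ => hn0 j))
  have hlim := ENNReal.Tendsto.const_mul (a := μ B ^ (η - m) * N) (hprod Finset.univ)
    (Or.inl (Finset.prod_ne_zero_iff.2 fun j _ => hn0 j))
  exact le_of_tendsto' hlim fun k => key (fun i => u i k) (fun i => (hu1 i k).1)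
    (fun i => (hu1 i k).2)

end HomType

/-! ### Weight pairs and the growth of the norms of balls. -/

namespace HomType

variable {X : Type*}

/-- The regularized distance `e + d(x, x₀)` to the base point. -/
noncomputable def rad (d : X → X → ℝ) (x₀ x : X) : ℝ := Real.exp 1 + d x x₀

/-- Exponents that are bounded and log-Hölder continuous on the set `G`, locally (with points at
distance zero included) and at infinity. -/
structure IsLogHolderOn (d : X → X → ℝ) (x₀ : X) (G : Set X) (p : X → ℝ) (a b K pinf : ℝ) :
    Prop where
  pos : 0 < a
  mem : ∀ x ∈ G, a ≤ p x ∧ p x ≤ b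
  mem_inf : a ≤ pinf ∧ pinf ≤ b
  loc : ∀ x ∈ G, ∀ y ∈ G, ∀ r, 0 < r → d x y < r →
    |p x - p y| * Real.log (Real.exp 1 + 1 / r) ≤ K
  inf : ∀ x ∈ G, |p x - pinf| * Real.log (rad d x₀ x) ≤ K

/-- A measure `σ` with an exponent `ρ` such that `n x r` is the norm of `χ_{B(x, r)}` in
`L^{ρ(·)}(σ)` and the normalized measures `n x r ^ (-ρ) σ` on balls are controlled from below by
`μ`. -/
structure WeightPair [MeasurableSpace X] (d : X → X → ℝ) (μ : Measure X) (x₀ : X) (G : Set X) where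
  σ : Measure X
  ρ : X → ℝ
  n : X → ℝ → ℝ
  a : ℝ
  b : ℝ
  K : ℝ
  ρinf : ℝ
  c : ℝ
  D : ℝ
  measurable : Measurable ρ
  null : σ Gᶜ = 0
  lh : IsLogHolderOn d x₀ G ρ a b K ρinf
  n_pos : ∀ x r, 0 < r → 0 < n x r
  modular_eq : ∀ x r, 0 < r → ∫⁻ y in qball d x r, ENNReal.ofReal (n x r ^ (-ρ y)) ∂σ = 1
  c_pos : 0 < c
  D_nonneg : 0 ≤ D
  lower : ∀ x r, 0 < r → ∀ E ⊆ qball d x r, MeasurableSet E →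
    ENNReal.ofReal (c * (μ.real E / μ.real (qball d x r)) ^ D) ≤
      ∫⁻ y in E, ENNReal.ofReal (n x r ^ (-ρ y)) ∂σ

variable [MeasurableSpace X] {d : X → X → ℝ} {μ : Measure X} {x₀ : X} {G : Set X}

lemma IsHomogeneousType.exp_one_le_rad (hX : IsHomogeneousType d μ) (x₀ x : X) :
    Real.exp 1 ≤ rad d x₀ x := by
  have := hX.quasiMetric.nonneg x x₀
  unfold rad; linarith

lemma two_lt_exp_one : (2 : ℝ) < Real.exp 1 := by
  have := Real.add_one_lt_exp (x := 1) one_ne_zero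
  linarith

lemma IsHomogeneousType.one_lt_rad (hX : IsHomogeneousType d μ) (x₀ x : X) :
    1 < rad d x₀ x := by
  linarith [hX.exp_one_le_rad x₀ x, two_lt_exp_one]

lemma IsHomogeneousType.measurable_rad (hX : IsHomogeneousType d μ) (x₀ : X) :
    Measurable (rad d x₀) :=
  measurable_const.add (hX.measurable_dist_right x₀)

lemma IsHomogeneousType.one_le_log_rad (hX : IsHomogeneousType d μ) (x₀ x : X) :
    1 ≤ Real.log (rad d x₀ x) := by
  rw [Real.le_log_iff_exp_le (by linarith [hX.one_lt_rad x₀ x])]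
  exact hX.exp_one_le_rad x₀ x

namespace WeightPair

variable (P : WeightPair d μ x₀ G)

/-- The modular of `χ_E / u` in `L^{ρ(·)}(σ)`. -/
noncomputable def Φ (E : Set X) (u : ℝ) : ℝ≥0∞ := ∫⁻ y in E, ENNReal.ofReal (u ^ (-P.ρ y)) ∂P.σ

lemma ae_mem : ∀ᵐ y ∂P.σ, y ∈ G := by
  rw [ae_iff]; exact P.null

lemma measurable_ofReal_rpow (u : ℝ) : Measurable fun y => ENNReal.ofReal (u ^ (-P.ρ y)) := by
  have := P.measurable
  fun_prop

lemma b_pos : 0 < P.b := P.lh.pos.trans_le (P.lh.mem_inf.1.trans P.lh.mem_inf.2)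

lemma Φ_mul_le {E : Set X} {u v : ℝ} (hu : 0 < u) (huv : u ≤ v) :
    P.Φ E v ≤ ENNReal.ofReal ((u / v) ^ P.a) * P.Φ E u := by
  unfold Φ
  rw [← lintegral_const_mul _ (P.measurable_ofReal_rpow u)]
  refine lintegral_mono_ae ?_
  filter_upwards [ae_restrict_of_ae P.ae_mem] with y hy
  have hv : 0 < v := hu.trans_le huv
  rw [← ENNReal.ofReal_mul (by positivity)]
  refine ENNReal.ofReal_le_ofReal ?_
  calc v ^ (-P.ρ y) = (u / v) ^ P.ρ y * u ^ (-P.ρ y) := by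
        rw [Real.rpow_neg hu.le, Real.rpow_neg hv.le, Real.div_rpow hu.le hv.le]
        have := Real.rpow_pos_of_pos hu (P.ρ y)
        field_simp
    _ ≤ _ := by
        gcongr ?_ * _
        exact Real.rpow_le_rpow_of_exponent_ge (by positivity) ((div_le_one hv).2 huv)
          (P.lh.mem y hy).1

lemma Φ_qball {x : X} {r : ℝ} (hr : 0 < r) : P.Φ (qball d x r) (P.n x r) = 1 :=
  P.modular_eq x r hr

lemma Φ_mono {E F : Set X} (h : E ⊆ F) (u : ℝ) : P.Φ E u ≤ P.Φ F u :=
  lintegral_mono_set h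

/-- The norm of a ball solves `Φ B u = 1`; a larger solution on the smaller ball would, by
`Φ_mul_le`, push its modular below one. -/
lemma n_mono {x y : X} {r s : ℝ} (hr : 0 < r) (hs : 0 < s) (h : qball d x r ⊆ qball d y s) :
    P.n x r ≤ P.n y s := by
  by_contra! hlt
  have hpos := P.n_pos y s hs
  have h1 : P.Φ (qball d x r) (P.n x r) ≤ ENNReal.ofReal ((P.n y s / P.n x r) ^ P.a) * 1 := by
    refine (P.Φ_mul_le hpos hlt.le).trans ?_
    gcongr
    exact (P.Φ_mono h _).trans (P.Φ_qball hs).le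
  rw [P.Φ_qball hr, mul_one, ENNReal.one_le_ofReal] at h1
  have h2 : (P.n y s / P.n x r) ^ P.a < 1 :=
    Real.rpow_lt_one (by have := P.n_pos x r hr; positivity)
      ((div_lt_one (P.n_pos x r hr)).2 hlt) P.lh.pos
  linarith

/-- At the norm of the larger ball, the modular of the smaller one is bounded from below by `lower`
and from above by a power of the quotient of the two norms. -/
lemma le_n_of_subset {x y : X} {r s : ℝ} (hX : IsHomogeneousType d μ) (hr : 0 < r) (hs : 0 < s)
    (h : qball d x r ⊆ qball d y s) :
    (P.c * (μ.real (qball d x r) / μ.real (qball d y s)) ^ P.D) ^ (1 / P.a) * P.n y s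
      ≤ P.n x r := by
  have hle := P.n_mono hr hs h
  have h0 := P.n_pos x r hr
  have h0' := P.n_pos y s hs
  have h1 := P.lower y s hs _ h (hX.measurableSet_qball x hr)
  have h2 := P.Φ_mul_le (E := qball d x r) h0 hle
  rw [P.Φ_qball hr, mul_one] at h2
  have h3 := h1.trans h2
  rw [ENNReal.ofReal_le_ofReal_iff (by positivity)] at h3
  have hc := P.c_pos
  have h4 : (P.c * (μ.real (qball d x r) / μ.real (qball d y s)) ^ P.D) ^ (1 / P.a)
      ≤ P.n x r / P.n y s := by
    calc _ ≤ ((P.n x r / P.n y s) ^ P.a) ^ (1 / P.a) := by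
          have := P.lh.pos
          gcongr
      _ = P.n x r / P.n y s := by
          rw [← Real.rpow_mul (by positivity), mul_one_div_cancel P.lh.pos.ne', Real.rpow_one]
  rwa [le_div_iff₀ h0'] at h4

/-- Power-type doubling of the norms of characteristic functions of balls. -/
lemma exists_le_n (hX : IsHomogeneousType d μ) : ∃ c D : ℝ, 0 < c ∧ 0 ≤ D ∧
    ∀ x r R, 0 < r → r ≤ R → c * (r / R) ^ D * P.n x R ≤ P.n x r := by
  obtain ⟨C, k, hC, h⟩ := hX.exists_measure_qball_le_pow
  have hc := P.c_pos
  have ha := P.lh.pos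
  have hD := P.D_nonneg
  refine ⟨(P.c * (C⁻¹) ^ P.D) ^ (1 / P.a), k * P.D / P.a, by positivity, by positivity,
    fun x r R hr hrR => ?_⟩
  have hR : 0 < R := hr.trans_le hrR
  refine le_trans ?_ (P.le_n_of_subset hX hr hR (qball_mono d x hrR))
  have hn := P.n_pos x R hR
  gcongr ?_ * _
  have hpos : 0 < μ.real (qball d x R) :=
    ENNReal.toReal_pos (hX.measure_qball_pos x hR).ne' (hX.measure_qball_lt_top x R).ne
  have h1 : C⁻¹ * (r / R) ^ k ≤ μ.real (qball d x r) / μ.real (qball d x R) := by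
    rw [le_div_iff₀ hpos]
    calc C⁻¹ * (r / R) ^ k * μ.real (qball d x R)
        ≤ C⁻¹ * (r / R) ^ k * (C * (R / r) ^ k * μ.real (qball d x r)) := by
          gcongr; exact h x r R hr hrR
      _ = (C⁻¹ * C) * ((r / R) ^ k * (R / r) ^ k) * μ.real (qball d x r) := by ring
      _ = _ := by
          rw [← mul_pow, inv_mul_cancel₀ hC.ne', div_mul_div_cancel₀ hR.ne', div_self hr.ne']
          simp
  calc (P.c * C⁻¹ ^ P.D) ^ (1 / P.a) * (r / R) ^ (k * P.D / P.a)
      = (P.c * (C⁻¹ * (r / R) ^ k) ^ P.D) ^ (1 / P.a) := by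
        have hrR0 : 0 ≤ r / R := by positivity
        rw [Real.mul_rpow (x := C⁻¹) (by positivity) (by positivity), ← mul_assoc,
          Real.mul_rpow (x := P.c * C⁻¹ ^ P.D) (by positivity) (by positivity),
          ← Real.rpow_natCast, ← Real.rpow_mul hrR0, ← Real.rpow_mul hrR0]
        congr 2; ring
    _ ≤ _ := by gcongr

/-- A ball about `x` of radius comparable to `rad d x₀ x` contains the unit ball about the base
point, whose norm is a fixed positive number; `exists_le_n` then descends to the radius `r`. -/
lemma exists_le_n_of_le_one (hX : IsHomogeneousType d μ) : ∃ c D : ℝ, 0 < c ∧ 0 ≤ D ∧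
    ∀ x r, 0 < r → r ≤ 1 → c * (r / rad d x₀ x) ^ D ≤ P.n x r := by
  obtain ⟨c, D, hc, hD, h⟩ := P.exists_le_n hX
  obtain ⟨A, hA1, hA⟩ := hX.quasiMetric.quasi_triangle
  have hA0 : 0 < A := by linarith
  have hn := P.n_pos x₀ 1 one_pos
  refine ⟨c * (1 / A) ^ D * P.n x₀ 1, D, by positivity, hD, fun x r hr hr1 => ?_⟩
  have hrad := hX.one_lt_rad x₀ x
  have hR1 : 1 ≤ A * rad d x₀ x := by nlinarith
  refine le_trans ?_ (h x r (A * rad d x₀ x) hr (hr1.trans hR1))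
  have hsub : qball d x₀ 1 ⊆ qball d x (A * rad d x₀ x) := by
    intro u hu
    have h1 : d x₀ u < 1 := hu
    refine (hA x u x₀).trans_lt ?_
    have := two_lt_exp_one
    unfold rad
    exact mul_lt_mul_of_pos_left (by linarith) hA0
  have hle := P.n_mono one_pos (by positivity) hsub
  have hr0 : 0 ≤ r / rad d x₀ x := by positivity
  calc c * (1 / A) ^ D * P.n x₀ 1 * (r / rad d x₀ x) ^ D
      = c * (r / (A * rad d x₀ x)) ^ D * P.n x₀ 1 := by
        rw [show r / (A * rad d x₀ x) = (1 / A) * (r / rad d x₀ x) by field_simp,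
          Real.mul_rpow (by positivity) hr0]
        ring
    _ ≤ _ := by gcongr

lemma exists_n_base_le (hX : IsHomogeneousType d μ) : ∃ C D : ℝ, 0 < C ∧ 0 ≤ D ∧
    ∀ R, 1 ≤ R → P.n x₀ R ≤ C * R ^ D := by
  obtain ⟨c, D, hc, hD, h⟩ := P.exists_le_n hX
  have hn := P.n_pos x₀ 1 one_pos
  refine ⟨c⁻¹ * P.n x₀ 1, D, by positivity, hD, fun R hR => ?_⟩
  have h1 := h x₀ 1 R one_pos hR
  have hRD : 0 < R ^ D := by positivity
  rw [Real.div_rpow zero_le_one (by linarith), Real.one_rpow] at h1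
  calc P.n x₀ R = c⁻¹ * R ^ D * (c * (1 / R ^ D) * P.n x₀ R) := by field_simp
    _ ≤ c⁻¹ * R ^ D * P.n x₀ 1 := by gcongr
    _ = _ := by ring

lemma exists_n_mul_le (hX : IsHomogeneousType d μ) {L : ℝ} (hL : 1 ≤ L) : ∃ C : ℝ, 0 < C ∧
    ∀ x r, 0 < r → P.n x (L * r) ≤ C * P.n x r := by
  obtain ⟨c, D, hc, hD, h⟩ := P.exists_le_n hX
  have hL0 : 0 < L := by linarith
  refine ⟨c⁻¹ * L ^ D, by positivity, fun x r hr => ?_⟩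
  have h1 := h x r (L * r) hr (by nlinarith)
  have e : r / (L * r) = 1 / L := by field_simp
  rw [e, Real.div_rpow zero_le_one hL0.le, Real.one_rpow] at h1
  calc P.n x (L * r) = c⁻¹ * L ^ D * (c * (1 / L ^ D) * P.n x (L * r)) := by
        have := Real.rpow_pos_of_pos hL0 D
        field_simp
    _ ≤ _ := by gcongr

/-- A crude comparison that ignores the oscillation of `ρ`. It serves for finiteness and polynomial
growth of `σ`; `exists_measure_comparable` replaces it where the exact power of the norm matters. -/
lemma measure_le_Φ {E : Set X} {u : ℝ} (hu : 0 < u) :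
    P.σ E ≤ ENNReal.ofReal ((max 1 u) ^ P.b) * P.Φ E u := by
  unfold Φ
  rw [← lintegral_const_mul _ (P.measurable_ofReal_rpow u), ← setLIntegral_one]
  refine lintegral_mono_ae ?_
  filter_upwards [ae_restrict_of_ae P.ae_mem] with y hy
  rw [← ENNReal.ofReal_mul (by positivity), ENNReal.one_le_ofReal]
  have hm := P.lh.mem y hy
  have ha := P.lh.pos
  calc (1 : ℝ) = u ^ (P.ρ y) * u ^ (-P.ρ y) := by
        rw [← Real.rpow_add hu]; simp
    _ ≤ _ := by
        gcongr ?_ * _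
        calc u ^ P.ρ y ≤ (max 1 u) ^ P.ρ y := by gcongr; exacts [by linarith, le_max_right _ _]
          _ ≤ _ := by
            gcongr
            · exact le_max_left _ _
            · exact hm.2

lemma Φ_le_measure {E : Set X} {u : ℝ} (hu : 0 < u) :
    P.Φ E u ≤ ENNReal.ofReal ((max 1 u⁻¹) ^ P.b) * P.σ E := by
  unfold Φ
  rw [← setLIntegral_const]
  refine lintegral_mono_ae ?_
  filter_upwards [ae_restrict_of_ae P.ae_mem] with y hy
  refine ENNReal.ofReal_le_ofReal ?_
  have hm := P.lh.mem y hy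
  have ha := P.lh.pos
  rw [Real.rpow_neg hu.le, ← Real.inv_rpow hu.le]
  calc u⁻¹ ^ P.ρ y ≤ (max 1 u⁻¹) ^ P.ρ y := by gcongr; exacts [by linarith, le_max_right _ _]
    _ ≤ _ := by
        gcongr
        · exact le_max_left _ _
        · exact hm.2

lemma measure_qball_lt_top (x : X) {r : ℝ} (hr : 0 < r) : P.σ (qball d x r) < ∞ := by
  refine (P.measure_le_Φ (P.n_pos x r hr)).trans_lt ?_
  rw [P.Φ_qball hr, mul_one]
  exact ENNReal.ofReal_lt_top

lemma measure_qball_pos (x : X) {r : ℝ} (hr : 0 < r) : 0 < P.σ (qball d x r) := by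
  have h := P.Φ_le_measure (E := qball d x r) (P.n_pos x r hr)
  rw [P.Φ_qball hr] at h
  rw [pos_iff_ne_zero]
  intro h0
  rw [h0, mul_zero] at h
  exact absurd h (by simp)

/-- The norms of the balls about the base point, hence their `σ`-measures, grow at most
polynomially, and a high negative power of the distance beats this growth. Such powers are the
errors in every exchange of exponents. -/
lemma exists_lintegral_rad_lt_top (hX : IsHomogeneousType d μ) : ∃ M₀ : ℝ, ∀ M, M₀ ≤ M →
    ∫⁻ x, ENNReal.ofReal (rad d x₀ x ^ (-M)) ∂P.σ < ∞ := by
  obtain ⟨C, D, hC, hD, h⟩ := P.exists_n_base_le hX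
  have hb := P.b_pos
  -- The measure of the ball of radius `k + 1` is at most a multiple of `(k + 1) ^ (D b)`, so the
  -- summable factor `(k + 1) ^ (-2)` is left over.
  refine ⟨D * P.b + 2, fun M hM => ?_⟩
  have hpt : ∀ x, ENNReal.ofReal (rad d x₀ x ^ (-M)) ≤ ∑' k : ℕ, (qball d x₀ (k + 1)).indicator
      (fun _ => ENNReal.ofReal (((k : ℝ) + 1) ^ (-M))) x := by
    intro x
    have hd := hX.quasiMetric.nonneg x x₀
    have hx : x ∈ qball d x₀ (⌊d x x₀⌋₊ + 1) := by
      change d x₀ x < _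
      rw [hX.quasiMetric.symm]; exact Nat.lt_floor_add_one _
    refine le_trans ?_ (ENNReal.le_tsum ⌊d x x₀⌋₊)
    rw [Set.indicator_of_mem hx]
    refine ENNReal.ofReal_le_ofReal ?_
    have h1 : (⌊d x x₀⌋₊ : ℝ) + 1 ≤ rad d x₀ x := by
      have := Nat.floor_le hd
      have := two_lt_exp_one
      unfold rad; linarith
    exact Real.rpow_le_rpow_of_nonpos (by positivity) h1 (by nlinarith [mul_nonneg hD hb.le])
  have hterm : ∀ k : ℕ, ENNReal.ofReal (((k : ℝ) + 1) ^ (-M)) * P.σ (qball d x₀ (k + 1)) ≤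
      ENNReal.ofReal ((max 1 C) ^ P.b * ((k : ℝ) + 1) ^ (-2 : ℝ)) := by
    intro k
    have hk1 : (1 : ℝ) ≤ (k : ℝ) + 1 := by linarith [(Nat.cast_nonneg k : (0 : ℝ) ≤ k)]
    have hk0 : (0 : ℝ) < (k : ℝ) + 1 := by linarith
    have hσ := P.measure_le_Φ (E := qball d x₀ (k + 1)) (P.n_pos x₀ _ hk0)
    rw [P.Φ_qball hk0, mul_one] at hσ
    refine (mul_le_mul_right hσ _).trans ?_
    rw [← ENNReal.ofReal_mul (by positivity)]
    refine ENNReal.ofReal_le_ofReal ?_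
    have hmax : max 1 (P.n x₀ (k + 1)) ≤ max 1 C * ((k : ℝ) + 1) ^ D := by
      have h1 : (1 : ℝ) ≤ ((k : ℝ) + 1) ^ D := Real.one_le_rpow hk1 hD
      refine max_le ?_ ((h _ hk1).trans (by gcongr; exact le_max_right _ _))
      calc (1 : ℝ) = 1 * 1 := by ring
        _ ≤ _ := by gcongr; exact le_max_left _ _
    calc ((k : ℝ) + 1) ^ (-M) * (max 1 (P.n x₀ (k + 1))) ^ P.b
        ≤ ((k : ℝ) + 1) ^ (-(D * P.b + 2)) * (max 1 C * ((k : ℝ) + 1) ^ D) ^ P.b := by gcongr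
      _ = (max 1 C) ^ P.b * (((k : ℝ) + 1) ^ (-(D * P.b + 2)) * ((k : ℝ) + 1) ^ (D * P.b)) := by
          rw [Real.mul_rpow (by positivity) (by positivity), ← Real.rpow_mul hk0.le]; ring
      _ = _ := by rw [← Real.rpow_add hk0]; ring_nf
  calc ∫⁻ x, ENNReal.ofReal (rad d x₀ x ^ (-M)) ∂P.σ
      ≤ ∫⁻ x, (∑' k : ℕ, (qball d x₀ (k + 1)).indicator
        (fun _ => ENNReal.ofReal (((k : ℝ) + 1) ^ (-M))) x) ∂P.σ := lintegral_mono hpt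
    _ = ∑' k : ℕ, ENNReal.ofReal (((k : ℝ) + 1) ^ (-M)) * P.σ (qball d x₀ (k + 1)) := by
        have hm : ∀ k : ℕ, MeasurableSet (qball d x₀ ((k : ℝ) + 1)) :=
          fun k => hX.measurableSet_qball x₀ (by positivity)
        rw [lintegral_tsum fun k => (measurable_const.indicator (hm k)).aemeasurable]
        congr with k
        rw [lintegral_indicator_const (hm k)]
    _ ≤ ∑' k : ℕ, ENNReal.ofReal ((max 1 C) ^ P.b * ((k : ℝ) + 1) ^ (-2 : ℝ)) :=
        ENNReal.tsum_le_tsum hterm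
    _ < ∞ := by
        have hs : Summable fun k : ℕ => (max 1 C) ^ P.b * ((k : ℝ) + 1) ^ (-2 : ℝ) := by
          refine Summable.mul_left _ ?_
          have := (summable_nat_add_iff 1).2 (Real.summable_nat_rpow (p := -2).2 (by norm_num))
          simpa using this
        rw [← ENNReal.ofReal_tsum_of_nonneg (fun k => by positivity) hs]
        exact ENNReal.ofReal_lt_top

end WeightPair

end HomType

/-! ### Balls of bounded norm and the oscillation of exponents. -/

namespace HomType

variable {X : Type*} [MeasurableSpace X] {d : X → X → ℝ} {μ : Measure X} {x₀ : X} {G : Set X}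

namespace WeightPair

variable (P : WeightPair d μ x₀ G)

/-- On unbounded spaces the norms of large balls tend to infinity. -/
lemma exists_lt_n_base (hX : IsHomogeneousType d μ) (hunb : ∀ T : ℝ, ∃ y, T < d y x₀) (L : ℝ) :
    ∃ R, 0 < R ∧ ∀ R', R ≤ R' → L < P.n x₀ R' := by
  suffices h : ∃ R, 0 < R ∧ L < P.n x₀ R by
    obtain ⟨R, hR, hlt⟩ := h
    exact ⟨R, hR, fun R' hR' => hlt.trans_le
      (P.n_mono hR (hR.trans_le hR') (qball_mono d x₀ hR'))⟩
  -- If the norms of the balls about `x₀` stayed bounded, `σ` would be finite with vanishing tails.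
  -- A ball about a far point `y`, with radius proportional to `d y x₀`, lies in a tail; yet by
  -- doubling it has at least the share `κ` of the `μ`-measure of a ball about `x₀`, so `lower`
  -- gives it a fixed amount of `σ`-measure.
  by_contra! hL
  have hb := P.b_pos
  obtain ⟨A, hA1, hA⟩ := hX.quasiMetric.quasi_triangle
  obtain ⟨C, k, hC, hdoub⟩ := hX.exists_measure_qball_le_pow
  have hA0 : 0 < A := by linarith
  have hn1 := P.n_pos x₀ 1 one_pos
  -- the total mass is finite
  have hfin : P.σ Set.univ ≠ ∞ := by
    have hmono : Monotone fun j : ℕ => qball d x₀ ((j : ℝ) + 1) := fun i j hij =>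
      qball_mono d x₀ (by gcongr)
    rw [← iUnion_qball_nat d x₀, hmono.measure_iUnion]
    refine ne_top_of_le_ne_top (b := ENNReal.ofReal ((max 1 L) ^ P.b)) ENNReal.ofReal_ne_top
      (iSup_le fun j => ?_)
    have hj : (0 : ℝ) < (j : ℝ) + 1 := by positivity
    refine (P.measure_le_Φ (P.n_pos x₀ _ hj)).trans ?_
    rw [P.Φ_qball hj, mul_one]
    gcongr
    exact hL _ hj
  have htail : Filter.Tendsto (fun j : ℕ => P.σ {z | (j : ℝ) ≤ d z x₀}) Filter.atTop (nhds 0) := by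
    have h0 : ⋂ j : ℕ, {z | (j : ℝ) ≤ d z x₀} = ∅ := by
      ext z
      simp only [Set.mem_iInter, Set.mem_ofPred_eq, Set.mem_empty_iff_false, iff_false, not_forall,
        not_le]
      exact exists_nat_gt _
    have := tendsto_measure_iInter_atTop (μ := P.σ) (s := fun j : ℕ => {z | (j : ℝ) ≤ d z x₀})
      (fun j => (measurableSet_le measurable_const
        (hX.measurable_dist_right x₀)).nullMeasurableSet)
      (fun i j hij z (hz : (j : ℝ) ≤ d z x₀) =>
        show (i : ℝ) ≤ d z x₀ from le_trans (by exact_mod_cast hij) hz)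
      ⟨0, ne_top_of_le_ne_top hfin (measure_mono (Set.subset_univ _))⟩
    rwa [h0, measure_empty] at this
  set κ : ℝ := (C * (6 * A ^ 3) ^ k)⁻¹ with hκ
  have hκ0 : 0 < κ := by positivity
  have hc := P.c_pos
  set ε : ℝ≥0∞ := ENNReal.ofReal (P.c * κ ^ P.D) / ENNReal.ofReal ((max 1 (P.n x₀ 1)⁻¹) ^ P.b)
  have hε0 : 0 < ε := ENNReal.div_pos (ENNReal.ofReal_pos.2 (by positivity)).ne'
    ENNReal.ofReal_ne_top
  obtain ⟨j, hj⟩ := ((htail.eventually_lt_const hε0).and (Filter.eventually_ge_atTop 1)).exists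
  obtain ⟨hj, hj1⟩ := hj
  have hj1' : (1 : ℝ) ≤ j := by exact_mod_cast hj1
  obtain ⟨y, hy⟩ := hunb (2 * A * j)
  set Y := d y x₀ with hY
  have hY0 : 0 < Y := lt_trans (by positivity) hy
  have hY1 : 1 ≤ Y := by nlinarith
  have hr : 0 < Y / (2 * A) := by positivity
  have hR : 0 < 2 * A * Y := by positivity
  have hEtail : qball d y (Y / (2 * A)) ⊆ {z | (j : ℝ) ≤ d z x₀} := by
    intro z hz
    have h1 : d y z < Y / (2 * A) := hz
    have h2 := hA y x₀ z
    change (j : ℝ) ≤ d z x₀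
    rw [lt_div_iff₀ (by positivity)] at h1
    nlinarith
  have hEsub : qball d y (Y / (2 * A)) ⊆ qball d x₀ (2 * A * Y) := by
    intro z hz
    have h1 : d y z < Y / (2 * A) := hz
    have h2 := hA x₀ z y
    rw [hX.quasiMetric.symm x₀ y, ← hY] at h2
    rw [lt_div_iff₀ (by positivity)] at h1
    change d x₀ z < 2 * A * Y
    nlinarith
  have hsub2 : qball d x₀ (2 * A * Y) ⊆ qball d y (6 * A ^ 3 * (Y / (2 * A))) := by
    intro z hz
    have h1 : d x₀ z < 2 * A * Y := hz
    have h2 := hA y z x₀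
    rw [← hY] at h2
    change d y z < _
    have e : 6 * A ^ 3 * (Y / (2 * A)) = 3 * A ^ 2 * Y := by field_simp; ring
    rw [e]
    have : A * Y ≤ A ^ 2 * Y := by nlinarith
    nlinarith
  have hratio : κ ≤ μ.real (qball d y (Y / (2 * A))) / μ.real (qball d x₀ (2 * A * Y)) := by
    have hpos : 0 < μ.real (qball d x₀ (2 * A * Y)) :=
      ENNReal.toReal_pos (hX.measure_qball_pos x₀ hR).ne' (hX.measure_qball_lt_top x₀ _).ne
    rw [le_div_iff₀ hpos, hκ, inv_mul_le_iff₀ (by positivity)]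
    have hA3 : 1 ≤ 6 * A ^ 3 := by have := one_le_pow₀ hA1 (n := 3); linarith
    have h1 := hdoub y (Y / (2 * A)) (6 * A ^ 3 * (Y / (2 * A))) hr (by nlinarith)
    rw [mul_div_cancel_right₀ _ hr.ne'] at h1
    exact (measureReal_mono hsub2 (hX.measure_qball_lt_top _ _).ne).trans h1
  have h1 := P.lower x₀ (2 * A * Y) hR _ hEsub (hX.measurableSet_qball y hr)
  have h2 := P.Φ_le_measure (E := qball d y (Y / (2 * A))) (P.n_pos x₀ _ hR)
  have h3 : ENNReal.ofReal (P.c * κ ^ P.D) ≤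
      P.σ {z | (j : ℝ) ≤ d z x₀} * ENNReal.ofReal ((max 1 (P.n x₀ 1)⁻¹) ^ P.b) := by
    have hD := P.D_nonneg
    calc ENNReal.ofReal (P.c * κ ^ P.D) ≤ _ := by gcongr
      _ ≤ _ := h1
      _ ≤ _ := h2
      _ ≤ ENNReal.ofReal ((max 1 (P.n x₀ 1)⁻¹) ^ P.b) * P.σ {z | (j : ℝ) ≤ d z x₀} := by
          gcongr
          exact P.n_mono one_pos hR (qball_mono d x₀ (by nlinarith))
      _ = _ := mul_comm _ _
  exact absurd (ENNReal.div_le_of_le_mul h3) (not_le.2 hj)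

/-- On balls with bounded norm, the distance to the base point is essentially constant. -/
lemma exists_rad_le (hX : IsHomogeneousType d μ) (L : ℝ) :
    ∃ C : ℝ, 1 ≤ C ∧ ∀ x r, 0 < r → P.n x r ≤ L →
      ∀ y ∈ qball d x r, ∀ z ∈ qball d x r, rad d x₀ y ≤ C * rad d x₀ z := by
  obtain ⟨A, hA1, hA⟩ := hX.quasiMetric.quasi_triangle
  have hA0 : 0 < A := by linarith
  have he := two_lt_exp_one
  by_cases hbdd : ∃ T : ℝ, ∀ y, d y x₀ ≤ T
  · obtain ⟨T, hT⟩ := hbdd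
    have hT0 : 0 ≤ T := (hX.quasiMetric.nonneg x₀ x₀).trans (hT x₀)
    refine ⟨Real.exp 1 + T, by linarith, fun x r hr _ y _ z _ => ?_⟩
    have h1 := hT y
    have h2 := hX.one_lt_rad x₀ z
    calc rad d x₀ y ≤ Real.exp 1 + T := by unfold rad; linarith
      _ ≤ _ := by nlinarith
  · push Not at hbdd
    -- If the radius exceeded `R₀ + d z x₀` for some `z` in the ball, the `κ`-fold enlargement would
    -- contain `B(x₀, r)`, whose norm is too large. So `rad d x₀ z` controls the radius, and with it
    -- the distance from `z` to every other point of the ball.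
    set κ : ℝ := A + 2 * A ^ 2 with hκ
    have hκ1 : 1 ≤ κ := by nlinarith
    obtain ⟨C₁, hC₁, hdoub⟩ := P.exists_n_mul_le hX hκ1
    obtain ⟨R₀, hR₀, hbig⟩ := P.exists_lt_n_base hX hbdd (C₁ * L)
    refine ⟨A * (2 * A * (R₀ + 1) + 1) + 1, by nlinarith [mul_pos hA0 hR₀], ?_⟩
    intro x r hr hn y hy z hz
    have hy' : d x y < r := hy
    have hz' : d x z < r := hz
    have hz0 := hX.quasiMetric.nonneg z x₀
    have hrle : r ≤ R₀ + d z x₀ := by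
      by_contra! hlt
      have hsub : qball d x₀ r ⊆ qball d x (κ * r) := by
        intro u hu
        have h1 : d x₀ u < r := hu
        have h2 := hA x u z
        have h3 := hA z u x₀
        change d x u < κ * r
        have h4 : d z u ≤ A * (2 * r) := h3.trans (by gcongr; linarith)
        calc d x u ≤ A * (d x z + d z u) := h2
          _ < A * (r + A * (2 * r)) := mul_lt_mul_of_pos_left (by linarith) hA0
          _ = κ * r := by rw [hκ]; ring
      have h1 := P.n_mono hr (by positivity) hsub
      have h2 := hbig r (by linarith)
      have h3 := hdoub x r hr
      have h4 : C₁ * P.n x r ≤ C₁ * L := by gcongr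
      linarith
    have h1 := hA y x₀ z
    have h2 := hA y z x
    rw [hX.quasiMetric.symm y x] at h2
    have h3 : d y z ≤ A * (2 * (R₀ + d z x₀)) := h2.trans (by gcongr; linarith)
    have h4 : d y x₀ ≤ A * (A * (2 * (R₀ + d z x₀)) + d z x₀) := h1.trans (by gcongr)
    have h5 : d z x₀ ≤ rad d x₀ z := by unfold rad; linarith
    have h6 := hX.one_lt_rad x₀ z
    have h7 : R₀ ≤ R₀ * rad d x₀ z := by nlinarith
    calc rad d x₀ y = d y x₀ + Real.exp 1 := by unfold rad; ring
      _ ≤ A * (A * (2 * (R₀ * rad d x₀ z + rad d x₀ z)) + rad d x₀ z) + rad d x₀ z := by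
          refine add_le_add (h4.trans (by gcongr)) (hX.exp_one_le_rad x₀ z)
      _ = _ := by ring

/-- On balls with bounded norm, powers of the norm with exponents in the oscillation of a
log-Hölder exponent are bounded. -/
lemma exists_n_rpow_le (hX : IsHomogeneousType d μ) {p : X → ℝ} {a b K pinf : ℝ}
    (hp : IsLogHolderOn d x₀ G p a b K pinf) (L : ℝ) :
    ∃ C : ℝ, 1 ≤ C ∧ ∀ x r, 0 < r → P.n x r ≤ L →
      ∀ y ∈ qball d x r, y ∈ G → ∀ z ∈ qball d x r, z ∈ G → ∀ δ : ℝ, |δ| ≤ |p y - p z| →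
        P.n x r ^ δ ≤ C := by
  obtain ⟨A, hA1, hA⟩ := hX.quasiMetric.quasi_triangle
  have hA0 : 0 < A := by linarith
  obtain ⟨C₁, hC₁, hrad⟩ := P.exists_rad_le hX L
  obtain ⟨c, D, hc, hD, hn⟩ := P.exists_le_n_of_le_one hX
  have hlogC₁ : 0 ≤ Real.log C₁ := Real.log_nonneg hC₁
  have hlogA : 0 ≤ Real.log (2 * A) := Real.log_nonneg (by linarith)
  -- For `n < 1`, the bound `n ≥ c (s / rad) ^ D` splits `Δ log (1 / n)`, with `Δ` the oscillation
  -- of `p`, into three parts. The one with `log c` is bounded by the range of `p`, the one with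
  -- `log (1 / s)` by local log-Hölder continuity, and the one with `log rad` by the decay
  -- condition, because `rad` is comparable at all points of the ball.
  set Q : ℝ := (b - a) * |Real.log c| + D * ((Real.log (2 * A) + 1) * K) +
    D * ((Real.log C₁ + 1) * (2 * K)) with hQ
  refine ⟨max (max 1 L ^ (b - a)) (Real.exp Q), ?_, ?_⟩
  · refine le_max_of_le_left (Real.one_le_rpow (le_max_left _ _) ?_)
    linarith [hp.mem_inf.1, hp.mem_inf.2]
  intro x r hr hnL y hy hyG z hz hzG δ hδ
  have hn0 := P.n_pos x r hr
  have hyb := hp.mem y hyG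
  have hzb := hp.mem z hzG
  set Δ := |p y - p z| with hΔ
  have hΔ0 : 0 ≤ Δ := abs_nonneg _
  have hΔb : Δ ≤ b - a := abs_le.2 ⟨by linarith, by linarith⟩
  rcases le_or_gt 1 (P.n x r) with h1 | h1
  · refine le_max_of_le_left ?_
    calc P.n x r ^ δ ≤ P.n x r ^ (b - a) :=
          Real.rpow_le_rpow_of_exponent_le h1 ((le_abs_self δ).trans (hδ.trans hΔb))
      _ ≤ _ := by
          have : 0 ≤ b - a := hΔ0.trans hΔb
          gcongr
          exact le_max_of_le_right hnL
  refine le_max_of_le_right ?_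
  have hlogn : Real.log (P.n x r) < 0 := Real.log_neg hn0 h1
  rw [Real.rpow_def_of_pos hn0]
  refine Real.exp_le_exp.2 ?_
  have hle1 : Real.log (P.n x r) * δ ≤ Δ * (-Real.log (P.n x r)) := by
    have : -δ ≤ Δ := (neg_le_abs δ).trans hδ
    nlinarith
  refine hle1.trans ?_
  set s := min r 1 with hs
  have hs0 : 0 < s := lt_min hr one_pos
  have hs1 : s ≤ 1 := min_le_right _ _
  have hradx := hX.one_lt_rad x₀ x
  have hlow : Real.log c + D * (Real.log s - Real.log (rad d x₀ x)) ≤ Real.log (P.n x r) := by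
    have h2 : c * (s / rad d x₀ x) ^ D ≤ P.n x r :=
      (hn x s hs0 hs1).trans (P.n_mono hs0 hr (qball_mono d x (min_le_left _ _)))
    have h3 := Real.log_le_log (by positivity) h2
    rwa [Real.log_mul hc.ne' (by positivity), Real.log_rpow (by positivity),
      Real.log_div hs0.ne' (by positivity)] at h3
  have hx : x ∈ qball d x r := mem_qball_self hX.quasiMetric hr
  have hlograd : ∀ u ∈ qball d x r,
      Real.log (rad d x₀ x) ≤ (Real.log C₁ + 1) * Real.log (rad d x₀ u) := by
    intro u hu
    have h2 := hX.one_lt_rad x₀ u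
    have h3 := Real.log_le_log (by positivity) (hrad x r hr hnL x hx u hu)
    rw [Real.log_mul (by positivity) (by positivity)] at h3
    nlinarith [hX.one_le_log_rad x₀ u]
  have hterm1 : Δ * Real.log (rad d x₀ x) ≤ (Real.log C₁ + 1) * (2 * K) := by
    have h2 : Δ ≤ |p y - pinf| + |p z - pinf| := by
      have := abs_sub_le (p y) pinf (p z)
      rwa [abs_sub_comm pinf] at this
    have h3 := hp.inf y hyG
    have h4 := hp.inf z hzG
    have h5 : 0 ≤ Real.log (rad d x₀ x) := by linarith [hX.one_le_log_rad x₀ x]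
    calc Δ * Real.log (rad d x₀ x) ≤ (|p y - pinf| + |p z - pinf|) * Real.log (rad d x₀ x) := by
          gcongr
      _ ≤ |p y - pinf| * ((Real.log C₁ + 1) * Real.log (rad d x₀ y)) +
          |p z - pinf| * ((Real.log C₁ + 1) * Real.log (rad d x₀ z)) := by
          rw [add_mul]
          gcongr
          · exact hlograd y hy
          · exact hlograd z hz
      _ = (Real.log C₁ + 1) * (|p y - pinf| * Real.log (rad d x₀ y) +
          |p z - pinf| * Real.log (rad d x₀ z)) := by ring
      _ ≤ (Real.log C₁ + 1) * (K + K) := by gcongr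
      _ = _ := by ring
  have hK0 : 0 ≤ K := le_trans (mul_nonneg (abs_nonneg _)
    (by linarith [hX.one_le_log_rad x₀ y])) (hp.inf y hyG)
  have hterm2 : Δ * (-Real.log s) ≤ (Real.log (2 * A) + 1) * K := by
    rcases le_or_gt 1 r with hr1 | hr1
    · rw [hs, min_eq_right hr1]; simp; positivity
    rw [hs, min_eq_left hr1.le]
    have hdyz : d y z < 2 * A * r := by
      have hy' : d x y < r := hy
      have hz' : d x z < r := hz
      refine (hA y z x).trans_lt ?_
      rw [hX.quasiMetric.symm y x]
      calc A * (d x y + d x z) < A * (r + r) := mul_lt_mul_of_pos_left (by linarith) hA0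
        _ = _ := by ring
    have h2 := hp.loc y hyG z hzG (2 * A * r) (by positivity) hdyz
    set Λ := Real.exp 1 + 1 / (2 * A * r) with hΛ
    have hi0 : 0 < 1 / (2 * A * r) := by positivity
    have hΛ1 : 1 ≤ Real.log Λ := by
      rw [Real.le_log_iff_exp_le (by positivity), hΛ]; linarith
    have h3 : -Real.log r ≤ (Real.log (2 * A) + 1) * Real.log Λ := by
      have h4 : 1 / r ≤ 2 * A * Λ := by
        have : 1 / r = 2 * A * (1 / (2 * A * r)) := by field_simp
        rw [this, hΛ]
        gcongr
        linarith [Real.exp_pos 1]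
      have h5 := Real.log_le_log (by positivity) h4
      rw [Real.log_mul (by positivity) (by positivity), one_div, Real.log_inv] at h5
      nlinarith
    calc Δ * (-Real.log r) ≤ Δ * ((Real.log (2 * A) + 1) * Real.log Λ) := by gcongr
      _ = (Real.log (2 * A) + 1) * (Δ * Real.log Λ) := by ring
      _ ≤ _ := by gcongr
  have hterm3 : Δ * (-Real.log c) ≤ (b - a) * |Real.log c| := by
    calc Δ * (-Real.log c) ≤ Δ * |Real.log c| := by gcongr; exact neg_le_abs _
      _ ≤ _ := by gcongr
  calc Δ * (-Real.log (P.n x r))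
      ≤ Δ * (-(Real.log c + D * (Real.log s - Real.log (rad d x₀ x)))) := by gcongr
    _ = Δ * (-Real.log c) + D * (Δ * (-Real.log s)) + D * (Δ * Real.log (rad d x₀ x)) := by ring
    _ ≤ Q := by rw [hQ]; gcongr

end WeightPair

end HomType

/-! ### Exchange of exponents; size and doubling of the weight measures. -/

namespace HomType

/-- Exchanging exponents at the cost of an error term that decays with `R`. -/
lemma rpow_le_exchange {u v a K M R t : ℝ} (ha : 0 < a) (hu : a ≤ u) (hR : 1 ≤ R)
    (hM : 0 ≤ M) (huv : |u - v| * Real.log R ≤ K) (ht0 : 0 ≤ t) (ht1 : t ≤ 1) :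
    t ^ u ≤ Real.exp (2 * M / a * K) * t ^ v + t ^ (a / 2) * R ^ (-M) := by
  have hR0 : 0 < R := by linarith
  have hu0 : 0 < u := by linarith
  rcases ht0.eq_or_lt with rfl | ht
  · rw [Real.zero_rpow hu0.ne']; positivity
  -- Above the threshold `t ^ (u - v)` costs at most `exp (2 M K / a)`; below it one half of `t ^ a`
  -- already yields `R ^ (-M)`. The other half is kept, since it makes the error small on balls of
  -- large norm.
  rcases le_or_gt (R ^ (-(2 * M / a))) t with h | h
  · refine le_add_of_le_of_nonneg ?_ (by positivity)
    have h1 : t ^ (u - v) ≤ Real.exp (2 * M / a * K) := by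
      calc t ^ (u - v) ≤ t ^ (-|u - v|) :=
            Real.rpow_le_rpow_of_exponent_ge ht ht1 (neg_abs_le _)
        _ ≤ (R ^ (-(2 * M / a))) ^ (-|u - v|) :=
            Real.rpow_le_rpow_of_nonpos (by positivity) h (by simp)
        _ = R ^ (2 * M / a * |u - v|) := by
            rw [← Real.rpow_mul hR0.le]; ring_nf
        _ = Real.exp (2 * M / a * (|u - v| * Real.log R)) := by
            rw [Real.rpow_def_of_pos hR0]; ring_nf
        _ ≤ _ := by gcongr
    calc t ^ u = t ^ (u - v) * t ^ v := by rw [← Real.rpow_add ht]; ring_nf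
      _ ≤ _ := by gcongr
  · refine le_add_of_nonneg_of_le (by positivity) ?_
    calc t ^ u ≤ t ^ a := Real.rpow_le_rpow_of_exponent_ge ht ht1 hu
      _ = t ^ (a / 2) * t ^ (a / 2) := by rw [← Real.rpow_add ht]; ring_nf
      _ ≤ t ^ (a / 2) * (R ^ (-(2 * M / a))) ^ (a / 2) := by gcongr
      _ = t ^ (a / 2) * R ^ (-M) := by
          rw [← Real.rpow_mul hR0.le]
          congr 2
          field_simp

variable {X : Type*} [MeasurableSpace X] {d : X → X → ℝ} {μ : Measure X} {x₀ : X} {G : Set X}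

/-- Exponents may be exchanged with their value at infinity. -/
lemma IsLogHolderOn.exists_exchange (hX : IsHomogeneousType d μ) {p : X → ℝ} {a b K pinf : ℝ}
    (hp : IsLogHolderOn d x₀ G p a b K pinf) {M : ℝ} (hM : 0 ≤ M) :
    ∃ C : ℝ, 0 < C ∧ ∀ x ∈ G, ∀ t : ℝ, 0 ≤ t → t ≤ 1 →
      t ^ p x ≤ C * t ^ pinf + t ^ (a / 2) * rad d x₀ x ^ (-M) ∧
      t ^ pinf ≤ C * t ^ p x + t ^ (a / 2) * rad d x₀ x ^ (-M) := by
  refine ⟨Real.exp (2 * M / a * K), Real.exp_pos _, fun x hx t ht0 ht1 => ⟨?_, ?_⟩⟩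
  · exact rpow_le_exchange hp.pos (hp.mem x hx).1 (hX.one_lt_rad x₀ x).le hM (hp.inf x hx) ht0 ht1
  · exact rpow_le_exchange hp.pos hp.mem_inf.1 (hX.one_lt_rad x₀ x).le hM
      (by rw [abs_sub_comm]; exact hp.inf x hx) ht0 ht1

/-- Exchange of exponents for bounded extended nonnegative numbers. -/
lemma IsLogHolderOn.exists_exchange_ennreal (hX : IsHomogeneousType d μ) {p : X → ℝ}
    {a b K pinf : ℝ} (hp : IsLogHolderOn d x₀ G p a b K pinf) {M : ℝ} (hM : 0 ≤ M) {A : ℝ≥0}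
    (hA : 1 ≤ A) :
    ∃ C : ℝ≥0, ∀ z ∈ G, ∀ t : ℝ≥0∞, t ≤ A →
      t ^ p z ≤ C * (t ^ pinf + ENNReal.ofReal (rad d x₀ z ^ (-M))) ∧
      t ^ pinf ≤ C * (t ^ p z + ENNReal.ofReal (rad d x₀ z ^ (-M))) := by
  obtain ⟨C, hC, h⟩ := hp.exists_exchange hX hM
  have hA0 : 0 < A := one_pos.trans_le hA
  have hA1 : (1 : ℝ) ≤ A := by exact_mod_cast hA
  have hpinf := hp.mem_inf
  have ha := hp.pos
  -- Division by `A` moves the argument into `[0, 1]`, where the real exchange applies; undoing it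
  -- costs at most `A ^ b`.
  have key : ∀ z ∈ G, ∀ u : ℝ, 0 ≤ u → u ≤ A → ∀ e e' : ℝ, 0 < e → e ≤ b → 0 < e' →
      (u / A) ^ e ≤ C * (u / A) ^ e' + (u / A) ^ (a / 2) * rad d x₀ z ^ (-M) →
      u ^ e ≤ A ^ b * (C + 1) * (u ^ e' + rad d x₀ z ^ (-M)) := by
    intro z hz u hu0 hu e e' he heb he' h1
    have hr := hX.one_lt_rad x₀ z
    have huA : u / A ≤ u := div_le_self hu0 hA1
    calc u ^ e = (A : ℝ) ^ e * (u / A) ^ e := by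
          rw [← Real.mul_rpow (by positivity) (by positivity), mul_div_cancel₀ _ (by positivity)]
      _ ≤ A ^ b * (C * u ^ e' + 1 * rad d x₀ z ^ (-M)) := by
          gcongr
          refine h1.trans ?_
          gcongr
          exact Real.rpow_le_one (by positivity) ((div_le_one (by positivity)).2 hu) (by linarith)
      _ ≤ A ^ b * ((C + 1) * u ^ e' + (C + 1) * rad d x₀ z ^ (-M)) := by
          gcongr <;> linarith
      _ = _ := by ring
  refine ⟨(A ^ b * (C + 1) : ℝ).toNNReal, fun z hz t ht => ?_⟩
  have hpz := hp.mem z hz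
  have hr := hX.one_lt_rad x₀ z
  obtain ⟨u, hu0, rfl⟩ : ∃ u : ℝ, 0 ≤ u ∧ t = ENNReal.ofReal u :=
    ⟨t.toReal, ENNReal.toReal_nonneg, (ENNReal.ofReal_toReal
      (ne_top_of_le_ne_top ENNReal.coe_ne_top ht)).symm⟩
  have huA : u ≤ A := by
    rwa [← ENNReal.ofReal_coe_nnreal, ENNReal.ofReal_le_ofReal_iff A.coe_nonneg] at ht
  have h1 := h z hz (u / A) (by positivity) ((div_le_one (by positivity)).2 huA)
  change _ ≤ ENNReal.ofReal _ * _ ∧ _ ≤ ENNReal.ofReal _ * _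
  rw [ENNReal.ofReal_rpow_of_nonneg hu0 (by linarith),
    ENNReal.ofReal_rpow_of_nonneg hu0 (by linarith),
    ← ENNReal.ofReal_add (by positivity) (by positivity),
    ← ENNReal.ofReal_add (by positivity) (by positivity), ← ENNReal.ofReal_mul (by positivity),
    ← ENNReal.ofReal_mul (by positivity)]
  exact ⟨ENNReal.ofReal_le_ofReal (key z hz u hu0 huA _ _ (by linarith) hpz.2 (by linarith) h1.1),
    ENNReal.ofReal_le_ofReal (key z hz u hu0 huA _ _ (by linarith) hpinf.2 (by linarith) h1.2)⟩

namespace WeightPair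

variable (P : WeightPair d μ x₀ G)

/-- On balls with bounded norm, `σ` is comparable to the normalized measure. -/
lemma exists_measure_comparable (hX : IsHomogeneousType d μ) (L : ℝ) :
    ∃ C : ℝ, 1 ≤ C ∧ ∀ x r, 0 < r → P.n x r ≤ L → ∀ E ⊆ qball d x r, MeasurableSet E →
      ∀ z ∈ qball d x r, z ∈ G →
        P.σ E ≤ ENNReal.ofReal (C * P.n x r ^ P.ρ z) * P.Φ E (P.n x r) ∧
        ENNReal.ofReal (P.n x r ^ P.ρ z) * P.Φ E (P.n x r) ≤ ENNReal.ofReal C * P.σ E := by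
  obtain ⟨C, hC, h⟩ := P.exists_n_rpow_le hX P.lh L
  refine ⟨C, hC, fun x r hr hn E hE hEm z hz hzG => ⟨?_, ?_⟩⟩
  · have hn0 := P.n_pos x r hr
    unfold Φ
    rw [← lintegral_const_mul _ (P.measurable_ofReal_rpow _), ← setLIntegral_one]
    refine lintegral_mono_ae ?_
    filter_upwards [ae_restrict_of_ae P.ae_mem, ae_restrict_mem hEm] with y hy hyE
    rw [← ENNReal.ofReal_mul (by positivity), ENNReal.one_le_ofReal]
    have h1 := h x r hr hn y (hE hyE) hy z hz hzG (P.ρ y - P.ρ z) le_rfl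
    calc (1 : ℝ) = P.n x r ^ (P.ρ y - P.ρ z) * P.n x r ^ P.ρ z * P.n x r ^ (-P.ρ y) := by
          rw [← Real.rpow_add hn0, ← Real.rpow_add hn0]; simp
      _ ≤ _ := by gcongr
  · have hn0 := P.n_pos x r hr
    unfold Φ
    rw [← lintegral_const_mul _ (P.measurable_ofReal_rpow _), ← setLIntegral_const]
    refine lintegral_mono_ae ?_
    filter_upwards [ae_restrict_of_ae P.ae_mem, ae_restrict_mem hEm] with y hy hyE
    rw [← ENNReal.ofReal_mul (by positivity)]
    refine ENNReal.ofReal_le_ofReal ?_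
    rw [← Real.rpow_add hn0]
    exact h x r hr hn y (hE hyE) hy z hz hzG _ (by rw [abs_sub_comm (P.ρ y)]; rfl)

variable {M : ℝ}

/-- On balls with norm at least one, `σ(B)` is at most the norm to the power at infinity. -/
lemma exists_measure_le_of_one_le (hX : IsHomogeneousType d μ) (hM : 0 ≤ M)
    (hS : ∫⁻ x, ENNReal.ofReal (rad d x₀ x ^ (-M)) ∂P.σ < ∞) :
    ∃ C : ℝ, 0 < C ∧ ∀ x r, 0 < r → 1 ≤ P.n x r →
      P.σ (qball d x r) ≤ ENNReal.ofReal (C * P.n x r ^ P.ρinf) := by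
  obtain ⟨C, hC, h⟩ := P.lh.exists_exchange hX hM
  set I := (∫⁻ x, ENNReal.ofReal (rad d x₀ x ^ (-M)) ∂P.σ).toReal with hI
  have hI' : ∫⁻ x, ENNReal.ofReal (rad d x₀ x ^ (-M)) ∂P.σ = ENNReal.ofReal I :=
    (ENNReal.ofReal_toReal hS.ne).symm
  have hI0 : 0 ≤ I := ENNReal.toReal_nonneg
  refine ⟨C + I, by positivity, fun x r hr hn => ?_⟩
  have hn0 := P.n_pos x r hr
  set n := P.n x r with hndef
  -- Exchanging the limit exponent for `ρ` in the powers of `n⁻¹ ≤ 1` compares `n ^ (-ρ_∞) σ(B)`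
  -- with the modular of `B`, which is one, plus the integral of the error.
  have h1 : ENNReal.ofReal (n ^ (-P.ρinf)) * P.σ (qball d x r) ≤ ENNReal.ofReal (C + I) := by
    rw [← setLIntegral_const]
    calc ∫⁻ y in qball d x r, ENNReal.ofReal (n ^ (-P.ρinf)) ∂P.σ
        ≤ ∫⁻ y in qball d x r, (ENNReal.ofReal C * ENNReal.ofReal (n ^ (-P.ρ y)) +
          ENNReal.ofReal (rad d x₀ y ^ (-M))) ∂P.σ := by
          refine lintegral_mono_ae ?_
          filter_upwards [ae_restrict_of_ae P.ae_mem] with y hy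
          have hrad := hX.one_lt_rad x₀ y
          rw [← ENNReal.ofReal_mul hC.le, ← ENNReal.ofReal_add (by positivity) (by positivity)]
          refine ENNReal.ofReal_le_ofReal ?_
          have hinv : n⁻¹ ≤ 1 := inv_le_one_of_one_le₀ hn
          have h2 := (h y hy n⁻¹ (by positivity) hinv).2
          rw [Real.rpow_neg hn0.le, Real.rpow_neg hn0.le, ← Real.inv_rpow hn0.le,
            ← Real.inv_rpow hn0.le]
          refine h2.trans ?_
          gcongr
          exact mul_le_of_le_one_left (by positivity)
            (Real.rpow_le_one (by positivity) hinv (by linarith [P.lh.pos]))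
      _ ≤ ENNReal.ofReal C * 1 + ENNReal.ofReal I := by
          have hm : Measurable fun y => ENNReal.ofReal C * ENNReal.ofReal (n ^ (-P.ρ y)) :=
            (P.measurable_ofReal_rpow n).const_mul _
          rw [lintegral_add_left hm, lintegral_const_mul _ (P.measurable_ofReal_rpow n), ← hI']
          gcongr
          · exact (P.modular_eq x r hr).le
          · exact Measure.restrict_le_self
      _ = _ := by rw [mul_one, ← ENNReal.ofReal_add hC.le hI0]
  calc P.σ (qball d x r)
      = ENNReal.ofReal (n ^ P.ρinf) * (ENNReal.ofReal (n ^ (-P.ρinf)) * P.σ (qball d x r)) := by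
        rw [← mul_assoc, ← ENNReal.ofReal_mul (by positivity), ← Real.rpow_add hn0]; simp
    _ ≤ ENNReal.ofReal (n ^ P.ρinf) * ENNReal.ofReal (C + I) := by gcongr
    _ = _ := by rw [← ENNReal.ofReal_mul (by positivity), mul_comm]

/-- On balls with large norm, sets carrying a fixed share of the normalized measure have `σ`
measure at least the norm to the power at infinity. -/
lemma exists_le_measure_of_large (hX : IsHomogeneousType d μ) (hM : 0 ≤ M)
    (hS : ∫⁻ x, ENNReal.ofReal (rad d x₀ x ^ (-M)) ∂P.σ < ∞) {κ : ℝ} (hκ : 0 < κ) :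
    ∃ L C : ℝ, 1 ≤ L ∧ 0 < C ∧ ∀ x r, 0 < r → L ≤ P.n x r → ∀ E ⊆ qball d x r, MeasurableSet E →
      ENNReal.ofReal κ ≤ P.Φ E (P.n x r) →
      ENNReal.ofReal (P.n x r ^ P.ρinf) ≤ ENNReal.ofReal C * P.σ E := by
  obtain ⟨C, hC, h⟩ := P.lh.exists_exchange hX hM
  set I := (∫⁻ x, ENNReal.ofReal (rad d x₀ x ^ (-M)) ∂P.σ).toReal with hI
  have hI' : ∫⁻ x, ENNReal.ofReal (rad d x₀ x ^ (-M)) ∂P.σ = ENNReal.ofReal I :=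
    (ENNReal.ofReal_toReal hS.ne).symm
  have hI0 : 0 ≤ I := ENNReal.toReal_nonneg
  have ha := P.lh.pos
  -- From this norm on, the error takes at most half of the share `κ` of the modular. Here the
  -- factor `t ^ (a / 2)` retained in the exchange is needed.
  obtain ⟨L, hL1, hL⟩ : ∃ L : ℝ, 1 ≤ L ∧ ∀ n, L ≤ n → n ^ (-(P.a / 2)) * I ≤ κ / 2 := by
    have hlim : Filter.Tendsto (fun n : ℝ => n ^ (-(P.a / 2)) * I) Filter.atTop (nhds (0 * I)) :=
      (tendsto_rpow_neg_atTop (by positivity)).mul_const I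
    rw [zero_mul] at hlim
    have h1 := hlim.eventually_le_const (show (0 : ℝ) < κ / 2 by positivity)
    obtain ⟨L, hL⟩ := Filter.eventually_atTop.1 h1
    exact ⟨max 1 L, le_max_left _ _, fun n hn => hL n ((le_max_right _ _).trans hn)⟩
  refine ⟨L, C * (2 / κ), hL1, by positivity, fun x r hr hn E hE hEm hκE => ?_⟩
  have hn0 := P.n_pos x r hr
  have hn1 : 1 ≤ P.n x r := hL1.trans hn
  set n := P.n x r with hndef
  have hσE : P.σ E ≠ ∞ := ne_top_of_le_ne_top (P.measure_qball_lt_top x hr).ne (measure_mono hE)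
  set s := (P.σ E).toReal with hs
  have hs' : P.σ E = ENNReal.ofReal s := (ENNReal.ofReal_toReal hσE).symm
  have hs0 : 0 ≤ s := ENNReal.toReal_nonneg
  have h1 : P.Φ E n ≤ ENNReal.ofReal (C * n ^ (-P.ρinf) * s + n ^ (-(P.a / 2)) * I) := by
    calc P.Φ E n ≤ ∫⁻ y in E, (ENNReal.ofReal (C * n ^ (-P.ρinf)) +
          ENNReal.ofReal (n ^ (-(P.a / 2))) * ENNReal.ofReal (rad d x₀ y ^ (-M))) ∂P.σ := by
          refine lintegral_mono_ae ?_
          filter_upwards [ae_restrict_of_ae P.ae_mem] with y hy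
          have hrad := hX.one_lt_rad x₀ y
          rw [← ENNReal.ofReal_mul (by positivity),
            ← ENNReal.ofReal_add (by positivity) (by positivity)]
          refine ENNReal.ofReal_le_ofReal ?_
          have hinv : n⁻¹ ≤ 1 := inv_le_one_of_one_le₀ hn1
          have h2 := (h y hy n⁻¹ (by positivity) hinv).1
          simpa only [Real.rpow_neg hn0.le, ← Real.inv_rpow hn0.le] using h2
      _ ≤ ENNReal.ofReal (C * n ^ (-P.ρinf)) * P.σ E +
          ENNReal.ofReal (n ^ (-(P.a / 2))) * ENNReal.ofReal I := by
          rw [lintegral_add_left measurable_const, setLIntegral_const,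
            lintegral_const_mul _ ((hX.measurable_rad x₀).pow_const _).ennreal_ofReal, ← hI']
          gcongr
          exact Measure.restrict_le_self
      _ = _ := by
          rw [hs', ← ENNReal.ofReal_mul (by positivity), ← ENNReal.ofReal_mul (by positivity),
            ← ENNReal.ofReal_add (by positivity) (by positivity)]
  have h2 := hκE.trans h1
  rw [ENNReal.ofReal_le_ofReal_iff (by positivity)] at h2
  have h3 := hL n hn
  rw [hs', ← ENNReal.ofReal_mul (by positivity)]
  refine ENNReal.ofReal_le_ofReal ?_
  have h4 : κ / 2 ≤ C * n ^ (-P.ρinf) * s := by linarith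
  calc n ^ P.ρinf = 2 / κ * n ^ P.ρinf * (κ / 2) := by field_simp
    _ ≤ 2 / κ * n ^ P.ρinf * (C * n ^ (-P.ρinf) * s) := by gcongr
    _ = C * (2 / κ) * s * (n ^ P.ρinf * n ^ (-P.ρinf)) := by ring
    _ = C * (2 / κ) * s := by rw [← Real.rpow_add hn0]; simp

lemma exists_mem_qball (P : WeightPair d μ x₀ G) (x : X) {r : ℝ} (hr : 0 < r) : ∃ z ∈ qball d x r, z ∈ G := by
  by_contra! h
  have h1 : P.σ (qball d x r) ≤ P.σ Gᶜ := measure_mono fun z hz => h z hz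
  rw [P.null] at h1
  exact absurd (P.measure_qball_pos x hr) (not_lt.2 h1)

/-- Sets with a fixed share of the `μ`-measure of a ball have a fixed share of its
`σ`-measure. -/
lemma exists_mul_measure_le (hX : IsHomogeneousType d μ) (hM : 0 ≤ M)
    (hS : ∫⁻ x, ENNReal.ofReal (rad d x₀ x ^ (-M)) ∂P.σ < ∞) {κ : ℝ} (hκ : 0 < κ) :
    ∃ C : ℝ, 0 < C ∧ ∀ x r, 0 < r → ∀ E ⊆ qball d x r, MeasurableSet E →
      κ * μ.real (qball d x r) ≤ μ.real E →
      P.σ (qball d x r) ≤ ENNReal.ofReal C * P.σ E := by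
  have hc := P.c_pos
  have hκ' : 0 < P.c * κ ^ P.D := by positivity
  obtain ⟨L, C₁, hL1, hC₁, hlarge⟩ := P.exists_le_measure_of_large hX hM hS hκ'
  obtain ⟨C₂, hC₂, hup⟩ := P.exists_measure_le_of_one_le hX hM hS
  obtain ⟨C₃, hC₃, hsmall⟩ := P.exists_measure_comparable hX L
  have hC₃0 : 0 < C₃ := by linarith
  refine ⟨max (C₂ * C₁) (C₃ * (C₃ / (P.c * κ ^ P.D))), by positivity, ?_⟩
  intro x r hr E hE hEm hμE
  have hpos : 0 < μ.real (qball d x r) :=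
    ENNReal.toReal_pos (hX.measure_qball_pos x hr).ne' (hX.measure_qball_lt_top x r).ne
  have hn0 := P.n_pos x r hr
  have hΦ : ENNReal.ofReal (P.c * κ ^ P.D) ≤ P.Φ E (P.n x r) := by
    refine le_trans (ENNReal.ofReal_le_ofReal ?_) (P.lower x r hr E hE hEm)
    have hD := P.D_nonneg
    gcongr
    rwa [le_div_iff₀ hpos]
  -- For norms at least `L`, both `σ(B)` and `σ(E)` are compared with `n ^ ρ_∞`; for smaller norms,
  -- with `n ^ ρ(z)` at one and the same point `z`.
  rcases le_total L (P.n x r) with hn | hn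
  · calc P.σ (qball d x r) ≤ ENNReal.ofReal (C₂ * P.n x r ^ P.ρinf) := hup x r hr (hL1.trans hn)
      _ = ENNReal.ofReal C₂ * ENNReal.ofReal (P.n x r ^ P.ρinf) := by
          rw [ENNReal.ofReal_mul hC₂.le]
      _ ≤ ENNReal.ofReal C₂ * (ENNReal.ofReal C₁ * P.σ E) := by
          gcongr; exact hlarge x r hr hn E hE hEm hΦ
      _ = ENNReal.ofReal (C₂ * C₁) * P.σ E := by rw [← mul_assoc, ← ENNReal.ofReal_mul hC₂.le]
      _ ≤ _ := by gcongr; exact le_max_left _ _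
  · obtain ⟨z, hz, hzG⟩ := P.exists_mem_qball x hr
    have h1 := (hsmall x r hr hn _ subset_rfl (hX.measurableSet_qball x hr) z hz hzG).1
    have h2 := (hsmall x r hr hn E hE hEm z hz hzG).2
    rw [P.Φ_qball hr, mul_one] at h1
    calc P.σ (qball d x r) ≤ ENNReal.ofReal (C₃ * P.n x r ^ P.ρ z) := h1
      _ = ENNReal.ofReal (C₃ / (P.c * κ ^ P.D)) * (ENNReal.ofReal (P.n x r ^ P.ρ z) *
          ENNReal.ofReal (P.c * κ ^ P.D)) := by
          rw [← ENNReal.ofReal_mul (by positivity), ← ENNReal.ofReal_mul (by positivity)]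
          congr 1; field_simp
      _ ≤ ENNReal.ofReal (C₃ / (P.c * κ ^ P.D)) * (ENNReal.ofReal C₃ * P.σ E) := by
          refine mul_le_mul_right (le_trans (mul_le_mul_right hΦ _) h2) _
      _ = ENNReal.ofReal (C₃ * (C₃ / (P.c * κ ^ P.D))) * P.σ E := by
          rw [ENNReal.ofReal_mul hC₃0.le]; ring
      _ ≤ _ := by gcongr; exact le_max_right _ _

/-- Doubling of `μ` says that a ball has a fixed share of its enlargement, and
`exists_mul_measure_le` carries this share over to `σ`. -/
lemma isDoublingOn (hX : IsHomogeneousType d μ) (hM : 0 ≤ M)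
    (hS : ∫⁻ x, ENNReal.ofReal (rad d x₀ x ^ (-M)) ∂P.σ < ∞) : IsDoublingOn d P.σ where
  pos x _ hr := P.measure_qball_pos x hr
  lt_top x _ hr := P.measure_qball_lt_top x hr
  doubling K hK := by
    have hK0 : 0 < K := by linarith
    obtain ⟨C, k, hC, hdoub⟩ := hX.exists_measure_qball_le_pow
    obtain ⟨C', hC', h⟩ := P.exists_mul_measure_le hX hM hS (κ := (C * K ^ k)⁻¹) (by positivity)
    refine ⟨C'.toNNReal, fun x r hr => ?_⟩
    refine h x (K * r) (by positivity) _ (qball_mono d x (by nlinarith))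
      (hX.measurableSet_qball x hr) ?_
    rw [inv_mul_le_iff₀ (by positivity)]
    have := hdoub x r (K * r) hr (by nlinarith)
    rwa [mul_div_cancel_right₀ _ hr.ne'] at this

end WeightPair

/-- The geometric mean of two densities over a ball is comparable to the geometric mean of
their masses. -/
lemma WeightPair.exists_sqrt_mul_le (hX : IsHomogeneousType d μ) {M : ℝ} (hM : 0 ≤ M)
    (P Q : WeightPair d μ x₀ G) (hSP : ∫⁻ x, ENNReal.ofReal (rad d x₀ x ^ (-M)) ∂P.σ < ∞)
    (hSQ : ∫⁻ x, ENNReal.ofReal (rad d x₀ x ^ (-M)) ∂Q.σ < ∞) {s t : X → ℝ≥0∞}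
    (hs : Measurable s) (ht : Measurable t) (hPs : P.σ = μ.withDensity s)
    (hQt : Q.σ = μ.withDensity t) :
    ∃ C : ℝ≥0, ∀ x r, 0 < r → (P.σ (qball d x r) * Q.σ (qball d x r)) ^ (1 / 2 : ℝ) ≤
      C * ∫⁻ y in qball d x r, (s y * t y) ^ (1 / 2 : ℝ) ∂μ := by
  -- The density lies below `ε` times the average on at most a quarter of the ball: a larger set
  -- would carry at least `σ(B) / C`, whereas for `ε = 1 / (2 C)` it carries at most `σ(B) / (2 C)`.
  have half : ∀ (R : WeightPair d μ x₀ G),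
      (∫⁻ x, ENNReal.ofReal (rad d x₀ x ^ (-M)) ∂(R.σ)) < ∞ → ∀ u : X → ℝ≥0∞, Measurable u →
      R.σ = μ.withDensity u → ∃ ε : ℝ≥0, 0 < ε ∧ ∀ x r, 0 < r →
        μ {y ∈ qball d x r | u y < ε * (R.σ (qball d x r) / μ (qball d x r))} ≤
          μ (qball d x r) / 4 := by
    intro R hSR u hu hRu
    obtain ⟨C, hC, h⟩ := R.exists_mul_measure_le hX hM hSR (κ := 1 / 4) (by norm_num)
    refine ⟨(2 * C)⁻¹.toNNReal, by simpa using hC, fun x r hr => ?_⟩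
    set B := qball d x r
    have hB : MeasurableSet B := hX.measurableSet_qball x hr
    have hμ0 : μ B ≠ 0 := (hX.measure_qball_pos x hr).ne'
    have hμt : μ B ≠ ∞ := (hX.measure_qball_lt_top x r).ne
    have hR0 : R.σ B ≠ 0 := (R.measure_qball_pos x hr).ne'
    have hRt : R.σ B ≠ ∞ := (R.measure_qball_lt_top x hr).ne
    set E := {y ∈ B | u y < ((2 * C)⁻¹.toNNReal : ℝ≥0∞) * (R.σ B / μ B)} with hE
    have hEm : MeasurableSet E := hB.inter (measurableSet_lt hu measurable_const)
    by_contra! hlt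
    have hEB : E ⊆ B := fun y hy => hy.1
    have hEt : μ E ≠ ∞ := ne_top_of_le_ne_top hμt (measure_mono hEB)
    have h1 : 1 / 4 * μ.real B ≤ μ.real E := by
      have := ENNReal.toReal_mono hEt hlt.le
      rw [ENNReal.toReal_div] at this
      simp only [Measure.real]
      simp at this
      linarith
    have h2 := h x r hr E hEB hEm h1
    have h3 : R.σ E ≤ ((2 * C)⁻¹.toNNReal : ℝ≥0∞) * R.σ B := by
      rw [hRu, withDensity_apply _ hEm, ← hRu]
      calc ∫⁻ y in E, u y ∂μ ≤ ∫⁻ y in E, ((2 * C)⁻¹.toNNReal : ℝ≥0∞) * (R.σ B / μ B) ∂μ :=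
            setLIntegral_mono measurable_const fun y hy => hy.2.le
        _ = ((2 * C)⁻¹.toNNReal : ℝ≥0∞) * (R.σ B / μ B) * μ E := setLIntegral_const _ _
        _ ≤ ((2 * C)⁻¹.toNNReal : ℝ≥0∞) * (R.σ B / μ B) * μ B := by gcongr
        _ = _ := by rw [mul_assoc, ENNReal.div_mul_cancel hμ0 hμt]
    have h4 : R.σ B ≤ ENNReal.ofReal (1 / 2) * R.σ B := by
      refine h2.trans ((mul_le_mul_right h3 _).trans (le_of_eq ?_))
      rw [← mul_assoc]
      congr 1
      change ENNReal.ofReal C * ENNReal.ofReal (2 * C)⁻¹ = _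
      rw [← ENNReal.ofReal_mul hC.le]
      congr 1; field_simp
    refine absurd h4 (not_le.2 ?_)
    calc ENNReal.ofReal (1 / 2) * R.σ B < 1 * R.σ B := by
          refine (ENNReal.mul_lt_mul_iff_left hR0 hRt).2 ?_
          rw [ENNReal.ofReal_lt_one]; norm_num
      _ = R.σ B := one_mul _
  obtain ⟨ε₁, hε₁, h₁⟩ := half P hSP s hs hPs
  obtain ⟨ε₂, hε₂, h₂⟩ := half Q hSQ t ht hQt
  set e : ℝ≥0 := (ε₁ * ε₂) ^ (1 / 2 : ℝ) with he
  have he0 : 0 < e := NNReal.rpow_pos (mul_pos hε₁ hε₂)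
  refine ⟨2 * e⁻¹, fun x r hr => ?_⟩
  set B := qball d x r
  have hB : MeasurableSet B := hX.measurableSet_qball x hr
  have hμ0 : μ B ≠ 0 := (hX.measure_qball_pos x hr).ne'
  have hμt : μ B ≠ ∞ := (hX.measure_qball_lt_top x r).ne
  set E₁ := {y ∈ B | s y < ε₁ * (P.σ B / μ B)} with hE₁
  set E₂ := {y ∈ B | t y < ε₂ * (Q.σ B / μ B)} with hE₂
  have hE₁m : MeasurableSet E₁ := hB.inter (measurableSet_lt hs measurable_const)
  have hE₂m : MeasurableSet E₂ := hB.inter (measurableSet_lt ht measurable_const)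
  -- On at least half of `B` both densities are thus at least fixed multiples of their averages, and
  -- so is their geometric mean.
  have hF : μ B / 2 ≤ μ (B \ (E₁ ∪ E₂)) := by
    have h3 : μ B ≤ μ (B \ (E₁ ∪ E₂)) + μ B / 2 := by
      calc μ B ≤ μ ((B \ (E₁ ∪ E₂)) ∪ (E₁ ∪ E₂)) := measure_mono (by
            rw [Set.sdiff_union_self]; exact Set.subset_union_left)
        _ ≤ μ (B \ (E₁ ∪ E₂)) + (μ E₁ + μ E₂) :=
            (measure_union_le _ _).trans (add_le_add_right (measure_union_le _ _) _)
        _ ≤ μ (B \ (E₁ ∪ E₂)) + (μ B / 4 + μ B / 4) := by gcongr; exacts [h₁ x r hr, h₂ x r hr]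
        _ = _ := by
            congr 1
            rw [← ENNReal.add_div, ← two_mul, show (4 : ℝ≥0∞) = 2 * 2 by norm_num,
              ENNReal.mul_div_mul_left _ _ (by norm_num) (by norm_num)]
    have h4 : μ B / 2 ≠ ∞ := ENNReal.div_ne_top hμt (by norm_num)
    refine (ENNReal.add_le_add_iff_right h4).1 ?_
    rwa [ENNReal.add_halves]
  have hFm : MeasurableSet (B \ (E₁ ∪ E₂)) := hB.diff (hE₁m.union hE₂m)
  have hmain : (e : ℝ≥0∞) * ((P.σ B * Q.σ B) ^ (1 / 2 : ℝ) / μ B) * (μ B / 2) ≤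
      ∫⁻ y in B, (s y * t y) ^ (1 / 2 : ℝ) ∂μ := by
    calc _ ≤ (e : ℝ≥0∞) * ((P.σ B * Q.σ B) ^ (1 / 2 : ℝ) / μ B) * μ (B \ (E₁ ∪ E₂)) := by gcongr
      _ = ∫⁻ y in B \ (E₁ ∪ E₂), (e : ℝ≥0∞) * ((P.σ B * Q.σ B) ^ (1 / 2 : ℝ) / μ B) ∂μ :=
          (setLIntegral_const _ _).symm
      _ ≤ ∫⁻ y in B \ (E₁ ∪ E₂), (s y * t y) ^ (1 / 2 : ℝ) ∂μ := by
          refine setLIntegral_mono' hFm fun y hy => ?_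
          have hy1 : ε₁ * (P.σ B / μ B) ≤ s y := by
            by_contra! h; exact hy.2 (Or.inl ⟨hy.1, h⟩)
          have hy2 : ε₂ * (Q.σ B / μ B) ≤ t y := by
            by_contra! h; exact hy.2 (Or.inr ⟨hy.1, h⟩)
          calc (e : ℝ≥0∞) * ((P.σ B * Q.σ B) ^ (1 / 2 : ℝ) / μ B)
              = ((ε₁ * (P.σ B / μ B)) * (ε₂ * (Q.σ B / μ B))) ^ (1 / 2 : ℝ) := by
                have e1 : (ε₁ * (P.σ B / μ B)) * (ε₂ * (Q.σ B / μ B)) =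
                    ((ε₁ * ε₂ : ℝ≥0) : ℝ≥0∞) * ((P.σ B * Q.σ B) / (μ B) ^ (2 : ℝ)) := by
                  rw [ENNReal.rpow_two, div_eq_mul_inv, div_eq_mul_inv, div_eq_mul_inv, sq,
                    ENNReal.mul_inv (Or.inl hμ0) (Or.inl hμt)]
                  push_cast; ring
                rw [e1, ENNReal.mul_rpow_of_nonneg ((ε₁ * ε₂ : ℝ≥0) : ℝ≥0∞) _ (by norm_num),
                  ENNReal.div_rpow_of_nonneg _ _ (by norm_num), ← ENNReal.rpow_mul, he,
                  ENNReal.coe_rpow_of_nonneg _ (by norm_num)]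
                norm_num
            _ ≤ _ := by gcongr
      _ ≤ _ := lintegral_mono_set Set.sdiff_subset
  have he' : (e : ℝ≥0∞) ≠ 0 := by simpa using he0.ne'
  calc (P.σ B * Q.σ B) ^ (1 / 2 : ℝ)
      = ((2 * e⁻¹ : ℝ≥0) : ℝ≥0∞) *
        ((e : ℝ≥0∞) * ((P.σ B * Q.σ B) ^ (1 / 2 : ℝ) / μ B) * (μ B / 2)) := by
        push_cast
        rw [ENNReal.coe_inv he0.ne']
        simp only [div_eq_mul_inv]
        calc _ = (2 * 2⁻¹) * ((e : ℝ≥0∞)⁻¹ * e) * ((μ B)⁻¹ * μ B) *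
              (P.σ B * Q.σ B) ^ (1 * 2⁻¹ : ℝ) := by
              rw [ENNReal.mul_inv_cancel (by norm_num) (by norm_num),
                ENNReal.inv_mul_cancel he' (by simp), ENNReal.inv_mul_cancel hμ0 hμt]; simp
          _ = _ := by ring
    _ ≤ _ := by gcongr

end HomType

/-! ### Hölder and Jensen inequalities with variable exponent. -/

namespace HomType

lemma conjExponent_sub_one_mul {p : ℝ} (hp : 1 < p) :
    (p.conjExponent - 1) * p = p.conjExponent := by
  have : p - 1 ≠ 0 := by linarith
  simp only [Real.conjExponent]; field_simp; ring

/-- Since `p' (p - 1) = p`, the hypothesis gives `s ^ (p - 1) ≤ C ^ (p - 1) n ^ p`. With `s = σ(B)`,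
an integral normalized by the norm becomes an average times a factor `σ(B)` outside the power. -/
lemma ennreal_div_rpow_le {s : ℝ≥0∞} {n C p b : ℝ} (hp : 1 < p) (hpb : p ≤ b) (hn : 0 < n)
    (hC : 1 ≤ C) (hs : s ≤ ENNReal.ofReal (C * n ^ p.conjExponent)) :
    (s / ENNReal.ofReal n) ^ p ≤ ENNReal.ofReal (C ^ b) * s := by
  have hst : s ≠ ∞ := ne_top_of_le_ne_top ENNReal.ofReal_ne_top hs
  have hC0 : 0 < C := by linarith
  obtain ⟨t, ht, rfl⟩ : ∃ t : ℝ, 0 ≤ t ∧ s = ENNReal.ofReal t :=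
    ⟨s.toReal, ENNReal.toReal_nonneg, (ENNReal.ofReal_toReal hst).symm⟩
  rw [ENNReal.ofReal_le_ofReal_iff (by positivity)] at hs
  rw [← ENNReal.ofReal_div_of_pos hn, ENNReal.ofReal_rpow_of_nonneg (by positivity) (by linarith),
    ← ENNReal.ofReal_mul (by positivity)]
  refine ENNReal.ofReal_le_ofReal ?_
  rcases ht.eq_or_lt with rfl | ht
  · simp [(by linarith : p ≠ 0)]
  have e : (p - 1) * p.conjExponent = p := by
    have : p - 1 ≠ 0 := by linarith
    simp only [Real.conjExponent]; field_simp
  calc (t / n) ^ p = t ^ (p - 1) * t * (n ^ p)⁻¹ := by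
        rw [Real.div_rpow ht.le hn.le, Real.rpow_sub_one ht.ne']; field_simp
    _ ≤ (C * n ^ p.conjExponent) ^ (p - 1) * t * (n ^ p)⁻¹ := by
        have : 0 ≤ p - 1 := by linarith
        gcongr
    _ = C ^ (p - 1) * t := by
        rw [Real.mul_rpow hC0.le (by positivity), ← Real.rpow_mul hn.le, mul_comm p.conjExponent, e]
        have := Real.rpow_pos_of_pos hn p
        field_simp
    _ ≤ _ := by
        gcongr
        linarith

lemma ennreal_le_rpow_add_one (v : ℝ≥0∞) {p : ℝ} (hp : 1 ≤ p) : v ≤ v ^ p + 1 := by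
  rcases le_total v 1 with h | h
  · exact le_add_left h
  · refine le_add_right ?_
    calc v = v ^ (1 : ℝ) := (ENNReal.rpow_one v).symm
      _ ≤ v ^ p := ENNReal.rpow_le_rpow_of_exponent_le h hp

variable {X : Type*} [MeasurableSpace X] {d : X → X → ℝ} {μ : Measure X} {x₀ : X} {G : Set X}

namespace WeightPair

variable (P : WeightPair d μ x₀ G)

/-- Hölder's inequality for the pair `L^{p(·)}(σ)`, `L^{p'(·)}(σ)` on balls. -/
lemma lintegral_div_n_le_two {p : X → ℝ} {a b K pinf : ℝ}
    (hp : IsLogHolderOn d x₀ G p a b K pinf) (ha : 1 < a)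
    (hρ : ∀ x ∈ G, P.ρ x = (p x).conjExponent) {g : X → ℝ≥0∞} (hg : Measurable g)
    (hgint : ∫⁻ x, g x ^ p x ∂P.σ ≤ 1) (x : X) {r : ℝ} (hr : 0 < r) :
    (∫⁻ y in qball d x r, g y ∂P.σ) / ENNReal.ofReal (P.n x r) ≤ 2 := by
  have hn := P.n_pos x r hr
  set n := P.n x r with hndef
  have hn0 : ENNReal.ofReal n ≠ 0 := (ENNReal.ofReal_pos.2 hn).ne'
  rw [div_eq_mul_inv, ← lintegral_mul_const _ hg]
  calc ∫⁻ y in qball d x r, g y * (ENNReal.ofReal n)⁻¹ ∂P.σ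
      ≤ ∫⁻ y in qball d x r, (ENNReal.ofReal (n ^ (-P.ρ y)) + g y ^ p y) ∂P.σ := by
        refine lintegral_mono_ae ?_
        filter_upwards [ae_restrict_of_ae P.ae_mem] with y hy
        have hpy := hp.mem y hy
        have hp1 : 1 < p y := by linarith
        -- The scaling is chosen so that `g / n = v n ^ (-ρ)` and, by `(p' - 1) p = p'`, `v ^ p n ^
        -- (-ρ) = g ^ p`. Then `v ≤ v ^ p + 1` takes the place of Young's inequality.
        set v := g y * ENNReal.ofReal (n ^ (P.ρ y - 1)) with hv
        have e1 : g y * (ENNReal.ofReal n)⁻¹ = v * ENNReal.ofReal (n ^ (-P.ρ y)) := by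
          rw [hv, mul_assoc, ← ENNReal.ofReal_mul (by positivity), ← Real.rpow_add hn,
            ← ENNReal.ofReal_inv_of_pos hn, ← Real.rpow_neg_one]
          congr 3; ring
        have e2 : v ^ p y * ENNReal.ofReal (n ^ (-P.ρ y)) = g y ^ p y := by
          rw [hv, ENNReal.mul_rpow_of_nonneg _ _ (by linarith),
            ENNReal.ofReal_rpow_of_pos (by positivity), mul_assoc,
            ← ENNReal.ofReal_mul (by positivity), ← Real.rpow_mul hn.le, ← Real.rpow_add hn, hρ y hy,
            conjExponent_sub_one_mul hp1]
          simp
        rw [e1]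
        calc v * ENNReal.ofReal (n ^ (-P.ρ y))
            ≤ (v ^ p y + 1) * ENNReal.ofReal (n ^ (-P.ρ y)) := by
              gcongr; exact ennreal_le_rpow_add_one v hp1.le
          _ = _ := by rw [add_mul, e2, one_mul, add_comm]
    _ = 1 + ∫⁻ y in qball d x r, g y ^ p y ∂P.σ := by
        rw [lintegral_add_left (P.measurable_ofReal_rpow n), P.modular_eq x r hr]
    _ ≤ 1 + 1 := by
        gcongr
        exact (lintegral_mono' Measure.restrict_le_self le_rfl).trans hgint
    _ = 2 := by norm_num

/-- A Jensen-type inequality with variable exponent for averages over balls with norm at most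
one, for functions with values in `{0} ∪ (1, ∞]`. -/
lemma exists_average_rpow_le (hX : IsHomogeneousType d μ) {p : X → ℝ} {a b K pinf : ℝ}
    (hp : IsLogHolderOn d x₀ G p a b K pinf) (ha : 1 < a)
    (hρ : ∀ x ∈ G, P.ρ x = (p x).conjExponent) :
    ∃ C : ℝ≥0, ∀ x r, 0 < r → P.n x r ≤ 1 → ∀ z ∈ qball d x r, z ∈ G →
      ∀ g : X → ℝ≥0∞, Measurable g →
      (∫⁻ y in qball d x r, g y ∂P.σ) / ENNReal.ofReal (P.n x r) ≤ 2 →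
      ((P.σ (qball d x r))⁻¹ * ∫⁻ y in qball d x r, {y | 1 < g y}.indicator g y ∂P.σ) ^ p z ≤
        C * ((P.σ (qball d x r))⁻¹ * ∫⁻ y in qball d x r,
          {y | 1 < g y}.indicator (fun y => g y ^ (p y / a)) y ∂P.σ) ^ a := by
  obtain ⟨C₁, hC₁, hosc⟩ := P.exists_n_rpow_le hX hp 1
  obtain ⟨C₂, hC₂, hcomp⟩ := P.exists_measure_comparable hX 1
  have ha0 : 0 < a := by linarith
  have hb := P.b_pos
  set C₄ : ℝ := (2 * C₂) ^ b * C₁ ^ P.b with hC₄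
  have hC₁0 : 0 < C₁ := by linarith
  have hC₂0 : 0 < C₂ := by linarith
  have hb1 : 1 ≤ b := by linarith [hp.mem_inf.1, hp.mem_inf.2]
  have hC₄1 : 1 ≤ C₄ := by
    have h1 : 1 ≤ (2 * C₂) ^ b := Real.one_le_rpow (by linarith) (by linarith)
    have h2 : 1 ≤ C₁ ^ P.b := Real.one_le_rpow hC₁ hb.le
    nlinarith
  set C₅ : ℝ := 2 ^ b * C₄ with hC₅
  have hC₄0 : 0 < C₄ := by linarith
  have hC₅0 : 0 < C₅ := by positivity
  have hC₅1 : 1 ≤ C₅ := by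
    have : (1 : ℝ) ≤ 2 ^ b := Real.one_le_rpow (by norm_num) (by linarith)
    nlinarith
  refine ⟨((2 * C₅) ^ a).toNNReal, fun x r hr hn1 z hz hzG g hg hA => ?_⟩
  have hn := P.n_pos x r hr
  set n := P.n x r with hndef
  set B := qball d x r with hBdef
  have hBm : MeasurableSet B := hX.measurableSet_qball x hr
  have hset : MeasurableSet {y | 1 < g y} := measurableSet_lt measurable_const hg
  have hs0 : P.σ B ≠ 0 := (P.measure_qball_pos x hr).ne'
  have hst : P.σ B ≠ ∞ := (P.measure_qball_lt_top x hr).ne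
  set g₁ := {y | 1 < g y}.indicator g with hg₁
  set Γ := {y | 1 < g y}.indicator (fun y => g y ^ (p y / a)) with hΓ
  have hpz := hp.mem z hzG
  set lam := (P.σ B)⁻¹ * ∫⁻ y in B, g₁ y ∂P.σ with hlam
  have hCcoe : (((2 * C₅) ^ a).toNNReal : ℝ≥0∞) = ENNReal.ofReal ((2 * C₅) ^ a) := rfl
  rw [hCcoe]
  have hg₁Γ : ∀ y ∈ G, g₁ y ≤ Γ y := by
    intro y hy
    by_cases hy1 : 1 < g y
    · rw [hg₁, hΓ, Set.indicator_of_mem (by exact hy1), Set.indicator_of_mem (by exact hy1)]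
      calc g y = g y ^ (1 : ℝ) := (ENNReal.rpow_one _).symm
        _ ≤ _ := ENNReal.rpow_le_rpow_of_exponent_le hy1.le
            ((one_le_div ha0).2 (hp.mem y hy).1)
    · rw [hg₁, hΓ, Set.indicator_of_notMem (by exact hy1), Set.indicator_of_notMem (by exact hy1)]
  -- An average at most one admits the smaller exponent `a` at once, because `g₁ ≤ Γ`. The
  -- oscillation of `p` matters only for averages above one.
  rcases le_or_gt lam 1 with hl | hl
  · calc lam ^ p z ≤ lam ^ a := ENNReal.rpow_le_rpow_of_exponent_ge hl hpz.1
      _ ≤ ((P.σ B)⁻¹ * ∫⁻ y in B, Γ y ∂P.σ) ^ a := by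
          gcongr
          rw [hlam]
          gcongr 1
          refine lintegral_mono_ae ?_
          filter_upwards [ae_restrict_of_ae P.ae_mem] with y hy using hg₁Γ y hy
      _ ≤ _ := by
          refine le_mul_of_one_le_left' ?_
          rw [ENNReal.one_le_ofReal]
          exact Real.one_le_rpow (by linarith) ha0.le
  -- the average exceeds one
  have hcz := hcomp x r hr hn1 B subset_rfl hBm z hz hzG
  rw [P.Φ_qball hr, mul_one, mul_one] at hcz
  -- From `∫_B g dσ ≤ 2 n` and the comparability of `σ(B)` with `n ^ ρ(z)`. This ties the average to
  -- the norm, so that the bounded powers `n ^ (-|p z - p y|)` also bound `lam ^ |p z - p y|`.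
  have hlt : lam ≤ ENNReal.ofReal (2 * C₂ * n ^ (1 - P.ρ z)) := by
    have h1 : ∫⁻ y in B, g₁ y ∂P.σ ≤ 2 * ENNReal.ofReal n := by
      calc ∫⁻ y in B, g₁ y ∂P.σ ≤ ∫⁻ y in B, g y ∂P.σ :=
            lintegral_mono fun y => Set.indicator_le_self _ _ _
        _ ≤ 2 * ENNReal.ofReal n :=
            (ENNReal.div_le_iff (ENNReal.ofReal_pos.2 hn).ne' ENNReal.ofReal_ne_top).1 hA
    have h2 : (P.σ B)⁻¹ ≤ ENNReal.ofReal (C₂ * n ^ (-P.ρ z)) := by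
      rw [ENNReal.inv_le_iff_le_mul (fun _ => hs0) (fun h => absurd h hst)]
      calc (1 : ℝ≥0∞) = ENNReal.ofReal (n ^ (-P.ρ z)) * ENNReal.ofReal (n ^ P.ρ z) := by
            rw [← ENNReal.ofReal_mul (by positivity), ← Real.rpow_add hn]; simp
        _ ≤ ENNReal.ofReal (n ^ (-P.ρ z)) * (ENNReal.ofReal C₂ * P.σ B) := by
            gcongr; exact hcz.2
        _ = _ := by
            rw [← mul_assoc, ← ENNReal.ofReal_mul (by positivity), mul_comm (n ^ _), mul_comm]
    calc lam ≤ ENNReal.ofReal (C₂ * n ^ (-P.ρ z)) * (2 * ENNReal.ofReal n) := by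
          rw [hlam]; gcongr
      _ = _ := by
          rw [show (2 : ℝ≥0∞) = ENNReal.ofReal 2 by simp, ← ENNReal.ofReal_mul (by norm_num),
            ← ENNReal.ofReal_mul (by positivity)]
          congr 1
          rw [sub_eq_neg_add, Real.rpow_add hn, Real.rpow_one]; ring
  obtain ⟨l, hl0, hll⟩ : ∃ l : ℝ, 0 ≤ l ∧ lam = ENNReal.ofReal l :=
    ⟨lam.toReal, ENNReal.toReal_nonneg,
      (ENNReal.ofReal_toReal (ne_top_of_le_ne_top ENNReal.ofReal_ne_top hlt)).symm⟩
  rw [hll] at hlt hl ⊢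
  rw [ENNReal.ofReal_le_ofReal_iff (by positivity)] at hlt
  have hl1 : 1 < l := by rwa [ENNReal.one_lt_ofReal] at hl
  have hlpos : 0 < l := by linarith
  have hosc' : ∀ y ∈ B, y ∈ G → l ^ |p z - p y| ≤ C₄ := by
    intro y hy hyG
    have h1 := hosc x r hr hn1 z hz hzG y hy hyG (-|p z - p y|) (by rw [abs_neg, abs_abs])
    have hpy := hp.mem y hyG
    have hΔb : |p z - p y| ≤ b := abs_le.2 ⟨by linarith, by linarith⟩
    have hρz := P.lh.mem z hzG
    have hρ1 : 1 ≤ P.ρ z := by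
      rw [hρ z hzG]; exact (conjExponent_mem ha hpz).1
    calc l ^ |p z - p y| ≤ (2 * C₂ * n ^ (1 - P.ρ z)) ^ |p z - p y| := by gcongr
      _ = (2 * C₂) ^ |p z - p y| * (n ^ (-|p z - p y|)) ^ (P.ρ z - 1) := by
          rw [Real.mul_rpow (by positivity) (by positivity), ← Real.rpow_mul hn.le,
            ← Real.rpow_mul hn.le]
          ring_nf
      _ ≤ (2 * C₂) ^ b * C₁ ^ P.b := by
          gcongr
          · linarith
          · calc (n ^ (-|p z - p y|)) ^ (P.ρ z - 1) ≤ C₁ ^ (P.ρ z - 1) := by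
                  have : 0 ≤ P.ρ z - 1 := by linarith
                  gcongr
              _ ≤ C₁ ^ P.b := Real.rpow_le_rpow_of_exponent_le hC₁ (by linarith)
  -- Values of `g₁` up to `l / 2` will be absorbed after averaging. For larger ones `g ^ (1 - p(y) /
  -- a)` is at most its value at `l / 2`, where `hosc'` replaces the exponent at `y` by the one at
  -- `z`. The outcome is `l ^ (p(z) / a) ≤ 2 C₅ w`, with `w` the average of `Γ`.
  set c : ℝ := C₅ * l ^ (1 - p z / a) with hc
  have hc0 : 0 < c := by positivity
  have hpt : ∀ y ∈ B, y ∈ G → g₁ y ≤ ENNReal.ofReal (l / 2) + ENNReal.ofReal c * Γ y := by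
    intro y hy hyG
    by_cases hy1 : 1 < g y
    swap
    · rw [hg₁, Set.indicator_of_notMem (by exact hy1)]; exact bot_le
    have hpy := hp.mem y hyG
    have hpya : 1 ≤ p y / a := (one_le_div ha0).2 hpy.1
    rw [hg₁, hΓ, Set.indicator_of_mem (by exact hy1), Set.indicator_of_mem (by exact hy1)]
    rcases le_or_gt (g y) (ENNReal.ofReal (l / 2)) with h | h
    · exact le_add_right h
    refine le_add_left ?_
    rcases eq_or_ne (g y) ∞ with htop | htop
    · rw [htop, ENNReal.top_rpow_of_pos (by linarith), ENNReal.mul_top]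
      exact (ENNReal.ofReal_pos.2 hc0).ne'
    obtain ⟨v, hv0, hv⟩ : ∃ v : ℝ, 0 ≤ v ∧ g y = ENNReal.ofReal v :=
      ⟨(g y).toReal, ENNReal.toReal_nonneg, (ENNReal.ofReal_toReal htop).symm⟩
    rw [hv] at h hy1 ⊢
    have hv1 : 1 < v := by rwa [ENNReal.one_lt_ofReal] at hy1
    have hvpos : 0 < v := by linarith
    rw [ENNReal.ofReal_lt_ofReal_iff hvpos] at h
    rw [ENNReal.ofReal_rpow_of_pos hvpos, ← ENNReal.ofReal_mul hc0.le]
    refine ENNReal.ofReal_le_ofReal ?_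
    have h1 : v ^ (1 - p y / a) ≤ c := by
      calc v ^ (1 - p y / a) ≤ (l / 2) ^ (1 - p y / a) :=
            Real.rpow_le_rpow_of_nonpos (by positivity) h.le (by linarith)
        _ = 2 ^ (p y / a - 1) * (l ^ (1 - p z / a) * l ^ ((p z - p y) / a)) := by
            rw [Real.div_rpow hlpos.le (by norm_num), ← Real.rpow_add hlpos, div_eq_mul_inv,
              ← Real.rpow_neg (by norm_num)]
            ring_nf
        _ ≤ 2 ^ b * (l ^ (1 - p z / a) * C₄) := by
            have e1 : p y / a - 1 ≤ b := by
              have : p y / a ≤ p y := div_le_self (by linarith) ha.le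
              linarith
            have e2 : l ^ ((p z - p y) / a) ≤ C₄ := by
              refine le_trans (Real.rpow_le_rpow_of_exponent_le hl1.le ?_) (hosc' y hy hyG)
              calc (p z - p y) / a ≤ |p z - p y| / a := by gcongr; exact le_abs_self _
                _ ≤ |p z - p y| := div_le_self (abs_nonneg _) ha.le
            gcongr
            norm_num
        _ = c := by rw [hc, hC₅]; ring
    calc v = v ^ (1 - p y / a) * v ^ (p y / a) := by rw [← Real.rpow_add hvpos]; simp
      _ ≤ _ := by gcongr
  have h_int : ENNReal.ofReal l ≤ ENNReal.ofReal (l / 2) +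
      ENNReal.ofReal c * ((P.σ B)⁻¹ * ∫⁻ y in B, Γ y ∂P.σ) := by
    rw [← hll, hlam]
    calc (P.σ B)⁻¹ * ∫⁻ y in B, g₁ y ∂P.σ
        ≤ (P.σ B)⁻¹ * ∫⁻ y in B, (ENNReal.ofReal (l / 2) + ENNReal.ofReal c * Γ y) ∂P.σ := by
          gcongr 1
          refine lintegral_mono_ae ?_
          filter_upwards [ae_restrict_of_ae P.ae_mem, ae_restrict_mem hBm] with y hy hyB
            using hpt y hyB hy
      _ = (P.σ B)⁻¹ * (ENNReal.ofReal (l / 2) * P.σ B + ENNReal.ofReal c * ∫⁻ y in B, Γ y ∂P.σ) := by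
          rw [lintegral_add_left measurable_const, setLIntegral_const,
            lintegral_const_mul' _ _ ENNReal.ofReal_ne_top]
      _ = ENNReal.ofReal (l / 2) * ((P.σ B)⁻¹ * P.σ B) +
          ENNReal.ofReal c * ((P.σ B)⁻¹ * ∫⁻ y in B, Γ y ∂P.σ) := by ring
      _ = _ := by rw [ENNReal.inv_mul_cancel hs0 hst, mul_one]
  set γ := (P.σ B)⁻¹ * ∫⁻ y in B, Γ y ∂P.σ with hγ
  rcases eq_or_ne γ ∞ with htop | htop
  · rw [htop, ENNReal.top_rpow_of_pos ha0, ENNReal.mul_top]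
    · exact le_top
    · exact (ENNReal.ofReal_pos.2 (by positivity)).ne'
  obtain ⟨w, hw0, hw⟩ : ∃ w : ℝ, 0 ≤ w ∧ γ = ENNReal.ofReal w :=
    ⟨γ.toReal, ENNReal.toReal_nonneg, (ENNReal.ofReal_toReal htop).symm⟩
  rw [hw] at h_int ⊢
  rw [← ENNReal.ofReal_mul hc0.le, ← ENNReal.ofReal_add (by positivity) (by positivity),
    ENNReal.ofReal_le_ofReal_iff (by positivity)] at h_int
  rw [ENNReal.ofReal_rpow_of_pos hlpos, ENNReal.ofReal_rpow_of_nonneg hw0 ha0.le,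
    ← ENNReal.ofReal_mul (by positivity)]
  refine ENNReal.ofReal_le_ofReal ?_
  have h1 : l ^ (p z / a) ≤ 2 * C₅ * w := by
    have h2 : l ≤ 2 * C₅ * w * l ^ (1 - p z / a) := by
      have : l ≤ 2 * (c * w) := by linarith
      rw [hc] at this; linarith
    rw [Real.rpow_sub hlpos, Real.rpow_one] at h2
    have h3 := Real.rpow_pos_of_pos hlpos (p z / a)
    rw [mul_div_assoc', le_div_iff₀ h3] at h2
    nlinarith
  calc l ^ p z = (l ^ (p z / a)) ^ a := by
        rw [← Real.rpow_mul hlpos.le, div_mul_cancel₀ _ ha0.ne']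
    _ ≤ (2 * C₅ * w) ^ a := by gcongr
    _ = _ := by rw [Real.mul_rpow (by positivity) hw0]

end WeightPair

end HomType

/-! ### The linear estimate for one weight pair. -/

namespace HomType

variable {X : Type*} [MeasurableSpace X] {d : X → X → ℝ} {μ : Measure X} {x₀ : X} {G : Set X}

lemma lintegral_eq_add_indicator (ν : Measure X) {g : X → ℝ≥0∞} (hg : Measurable g) :
    ∫⁻ y, g y ∂ν = ∫⁻ y, {y | 1 < g y}.indicator g y ∂ν + ∫⁻ y, {y | g y ≤ 1}.indicator g y ∂ν := by
  have hset : MeasurableSet {y | 1 < g y} := measurableSet_lt measurable_const hg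
  have hset' : MeasurableSet {y | g y ≤ 1} := measurableSet_le hg measurable_const
  have hc : {y | g y ≤ 1} = {y | 1 < g y}ᶜ := by ext y; simp
  rw [lintegral_indicator hset, lintegral_indicator hset', hc, lintegral_add_compl _ hset]

namespace WeightPair

variable (P : WeightPair d μ x₀ G) {M : ℝ}

/-- The linear estimate: averages of a function in the unit ball of `L^{p(·)}(σ)`, normalized by
the dual norm, are controlled by a function `Z` with bounded integral. -/
lemma exists_linear_estimate (hX : IsHomogeneousType d μ) (hM : 0 ≤ M)
    (hS : ∫⁻ x, ENNReal.ofReal (rad d x₀ x ^ (-M)) ∂P.σ < ∞) {p : X → ℝ} {a b K pinf : ℝ}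
    (hpm : Measurable p) (hp : IsLogHolderOn d x₀ G p a b K pinf) (ha : 1 < a)
    (hρ : ∀ x ∈ G, P.ρ x = (p x).conjExponent) (hρinf : P.ρinf = pinf.conjExponent) :
    ∃ C : ℝ≥0, ∀ g : X → ℝ≥0∞, Measurable g → ∫⁻ x, g x ^ p x ∂P.σ ≤ 1 →
      ∃ Z : X → ℝ≥0∞, Measurable Z ∧ ∫⁻ x, Z x ∂P.σ ≤ C ∧
        (∀ y, ENNReal.ofReal (rad d x₀ y ^ (-M)) ≤ Z y) ∧
        (∀ x r, 0 < r → P.n x r ≤ 1 → ∀ z ∈ qball d x r, z ∈ G → ∀ y ∈ qball d x r,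
          ((∫⁻ y in qball d x r, g y ∂P.σ) / ENNReal.ofReal (P.n x r)) ^ p z ≤
            C * P.σ (qball d x r) * Z y) ∧
        (∀ x r, 0 < r → 1 ≤ P.n x r → ∀ y ∈ qball d x r,
          ((∫⁻ y in qball d x r, g y ∂P.σ) / ENNReal.ofReal (P.n x r)) ^ pinf ≤
            C * P.σ (qball d x r) * Z y) := by
  have ha0 : 0 < a := by linarith
  have hpinf := hp.mem_inf
  have hpinf1 : 1 < pinf := by linarith
  have hdoub := P.isDoublingOn hX hM hS
  obtain ⟨C₁, hmax₁⟩ := hdoub.exists_maximal_majorant hX ha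
  obtain ⟨C₂, hmax₂⟩ := hdoub.exists_maximal_majorant hX hpinf1
  obtain ⟨C₃, hexch⟩ := hp.exists_exchange_ennreal hX hM le_rfl
  obtain ⟨C₄, hjen⟩ := P.exists_average_rpow_le hX hp ha hρ
  obtain ⟨C₅, hC₅, hup⟩ := P.exists_measure_le_of_one_le hX hM hS
  obtain ⟨C₆, hC₆, hcomp⟩ := P.exists_measure_comparable hX 1
  obtain ⟨C₇, hC₇, hrad⟩ := P.exists_rad_le hX 1
  set I := ∫⁻ x, ENNReal.ofReal (rad d x₀ x ^ (-M)) ∂P.σ with hI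
  set Q : ℝ≥0∞ := 2 ^ b * ENNReal.ofReal ((max 1 (max C₅ C₆)) ^ b) *
    (C₄ + C₃ + C₃ * ENNReal.ofReal (C₇ ^ M) + 2) with hQ
  set T : ℝ≥0∞ := C₁ + C₂ * (C₃ * (1 + I)) + I with hT
  have hb1 : 1 < b := by linarith
  have hQt : Q ≠ ∞ := by
    rw [hQ]
    refine ENNReal.mul_ne_top (ENNReal.mul_ne_top ?_ ENNReal.ofReal_ne_top) (by finiteness)
    exact ENNReal.rpow_ne_top_of_nonneg (by linarith) (by simp)
  have hTt : T ≠ ∞ := by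
    have := hS.ne
    rw [hT]; finiteness
  have hQT : ((Q + T).toNNReal : ℝ≥0∞) = Q + T :=
    ENNReal.coe_toNNReal (ENNReal.add_ne_top.2 ⟨hQt, hTt⟩)
  refine ⟨(Q + T).toNNReal, fun g hg hgint => ?_⟩
  rw [hQT]
  have hset : MeasurableSet {y | 1 < g y} := measurableSet_lt measurable_const hg
  have hset' : MeasurableSet {y | g y ≤ 1} := measurableSet_le hg measurable_const
  -- The maximal theorem needs constant exponents. Large values are controlled by `Γ = g ^ (p / a)`,
  -- which lies in `L^a(σ)`; for values at most one the exponent is exchanged for its limit, so `g₂`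
  -- lies in `L^{pinf}(σ)`.
  set g₁ := {y | 1 < g y}.indicator g with hg₁
  set g₂ := {y | g y ≤ 1}.indicator g with hg₂
  set Γ := {y | 1 < g y}.indicator (fun y => g y ^ (p y / a)) with hΓ
  have hg₂m : Measurable g₂ := hg.indicator hset'
  have hΓm : Measurable Γ := (hg.pow (hpm.div_const a)).indicator hset
  have hSm : Measurable fun y => ENNReal.ofReal (rad d x₀ y ^ (-M)) :=
    ((hX.measurable_rad x₀).pow_const _).ennreal_ofReal
  have hΓa : ∀ y, Γ y ^ a ≤ g y ^ p y := by
    intro y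
    by_cases hy : 1 < g y
    · rw [hΓ, Set.indicator_of_mem (by exact hy), ← ENNReal.rpow_mul, div_mul_cancel₀ _ ha0.ne']
    · rw [hΓ, Set.indicator_of_notMem (by exact hy), ENNReal.zero_rpow_of_pos ha0]; exact bot_le
  have hg₂le : ∀ y, g₂ y ≤ 1 := by
    intro y
    by_cases hy : g y ≤ 1
    · rw [hg₂, Set.indicator_of_mem (by exact hy)]; exact hy
    · rw [hg₂, Set.indicator_of_notMem (by exact hy)]; exact bot_le
  have hg₂int : ∫⁻ y, g₂ y ^ pinf ∂P.σ ≤ C₃ * (1 + I) := by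
    calc ∫⁻ y, g₂ y ^ pinf ∂P.σ ≤ ∫⁻ y, C₃ * (g y ^ p y +
          ENNReal.ofReal (rad d x₀ y ^ (-M))) ∂P.σ := by
          refine lintegral_mono_ae ?_
          filter_upwards [P.ae_mem] with y hy
          refine (hexch y hy _ (by simpa using hg₂le y)).2.trans ?_
          have := hp.mem y hy
          gcongr
          · linarith
          · exact Set.indicator_le_self _ _ _
      _ = C₃ * (∫⁻ y, g y ^ p y ∂P.σ + I) := by
          rw [lintegral_const_mul' _ _ ENNReal.coe_ne_top, lintegral_add_right _ hSm]
      _ ≤ C₃ * (1 + I) := by gcongr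
  obtain ⟨H₁, hH₁m, hH₁, hH₁int⟩ := hmax₁ Γ hΓm
  obtain ⟨H₂, hH₂m, hH₂, hH₂int⟩ := hmax₂ g₂ hg₂m
  set Z : X → ℝ≥0∞ := fun y => H₁ y ^ a + H₂ y ^ pinf + ENNReal.ofReal (rad d x₀ y ^ (-M)) with hZ
  have hZ₁ : ∀ y, H₁ y ^ a ≤ Z y := fun y => le_add_right (le_add_right le_rfl)
  have hZ₂ : ∀ y, H₂ y ^ pinf ≤ Z y := fun y => le_add_right (le_add_left le_rfl)
  have hZ₃ : ∀ y, ENNReal.ofReal (rad d x₀ y ^ (-M)) ≤ Z y := fun y => le_add_left le_rfl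
  -- splitting of the normalized average
  have hsplit : ∀ x r, 0 < r → ∀ (e : ℝ), 1 < e → e ≤ b →
      P.σ (qball d x r) ≤ ENNReal.ofReal (max 1 (max C₅ C₆) * P.n x r ^ e.conjExponent) →
      ((∫⁻ y in qball d x r, g y ∂P.σ) / ENNReal.ofReal (P.n x r)) ^ e ≤
        2 ^ b * ENNReal.ofReal ((max 1 (max C₅ C₆)) ^ b) * P.σ (qball d x r) *
        (((P.σ (qball d x r))⁻¹ * ∫⁻ y in qball d x r, g₁ y ∂P.σ) ^ e +
          ((P.σ (qball d x r))⁻¹ * ∫⁻ y in qball d x r, g₂ y ∂P.σ) ^ e) := by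
    intro x r hr e he heb hσ
    have hn := P.n_pos x r hr
    have hs0 : P.σ (qball d x r) ≠ 0 := (P.measure_qball_pos x hr).ne'
    have hst : P.σ (qball d x r) ≠ ∞ := (P.measure_qball_lt_top x hr).ne
    have h1 := ennreal_div_rpow_le he heb hn (le_max_left 1 _) hσ
    have e1 : (∫⁻ y in qball d x r, g y ∂P.σ) / ENNReal.ofReal (P.n x r) =
        (P.σ (qball d x r) / ENNReal.ofReal (P.n x r)) *
        ((P.σ (qball d x r))⁻¹ * (∫⁻ y in qball d x r, g₁ y ∂P.σ) +
          (P.σ (qball d x r))⁻¹ * ∫⁻ y in qball d x r, g₂ y ∂P.σ) := by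
      rw [← mul_add, ← lintegral_eq_add_indicator _ hg]
      simp only [div_eq_mul_inv]
      calc _ = (P.σ (qball d x r) * (P.σ (qball d x r))⁻¹) *
            ((∫⁻ y in qball d x r, g y ∂P.σ) * (ENNReal.ofReal (P.n x r))⁻¹) := by
            rw [ENNReal.mul_inv_cancel hs0 hst, one_mul]
        _ = _ := by ring
    rw [e1, ENNReal.mul_rpow_of_nonneg _ _ (by linarith)]
    calc _ ≤ (ENNReal.ofReal ((max 1 (max C₅ C₆)) ^ b) * P.σ (qball d x r)) *
          (2 ^ (e - 1) * (((P.σ (qball d x r))⁻¹ * ∫⁻ y in qball d x r, g₁ y ∂P.σ) ^ e +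
          ((P.σ (qball d x r))⁻¹ * ∫⁻ y in qball d x r, g₂ y ∂P.σ) ^ e)) := by
          gcongr
          exact ENNReal.rpow_add_le_mul_rpow_add_rpow _ _ he.le
      _ ≤ (ENNReal.ofReal ((max 1 (max C₅ C₆)) ^ b) * P.σ (qball d x r)) *
          (2 ^ b * (((P.σ (qball d x r))⁻¹ * ∫⁻ y in qball d x r, g₁ y ∂P.σ) ^ e +
          ((P.σ (qball d x r))⁻¹ * ∫⁻ y in qball d x r, g₂ y ∂P.σ) ^ e)) := by
          gcongr
          · norm_num
          · linarith
      _ = _ := by ring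
  refine ⟨Z, ((hH₁m.pow_const a).add (hH₂m.pow_const pinf)).add hSm, ?_, hZ₃, ?_, ?_⟩
  · rw [hZ, lintegral_add_right _ hSm, lintegral_add_right _ (hH₂m.pow_const pinf)]
    refine le_add_left ?_
    rw [hT]
    gcongr
    · refine hH₁int.trans ?_
      calc C₁ * ∫⁻ y, Γ y ^ a ∂P.σ ≤ C₁ * 1 := by
            gcongr
            exact (lintegral_mono hΓa).trans hgint
        _ = C₁ := mul_one _
    · exact hH₂int.trans (by gcongr)
  · intro x r hr hn1 z hz hzG y hy
    have hn := P.n_pos x r hr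
    have hpz := hp.mem z hzG
    have hpz1 : 1 < p z := by linarith
    have hs0 : P.σ (qball d x r) ≠ 0 := (P.measure_qball_pos x hr).ne'
    have hst : P.σ (qball d x r) ≠ ∞ := (P.measure_qball_lt_top x hr).ne
    have hA := P.lintegral_div_n_le_two hp ha hρ hg hgint x hr
    have hσ := (hcomp x r hr hn1 _ subset_rfl (hX.measurableSet_qball x hr) z hz hzG).1
    rw [P.Φ_qball hr, mul_one, hρ z hzG] at hσ
    have hσ' : P.σ (qball d x r) ≤
        ENNReal.ofReal (max 1 (max C₅ C₆) * P.n x r ^ (p z).conjExponent) := by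
      refine hσ.trans (ENNReal.ofReal_le_ofReal ?_)
      gcongr
      exact (le_max_right _ _).trans (le_max_right _ _)
    refine (hsplit x r hr (p z) hpz1 hpz.2 hσ').trans ?_
    have h1 : ((P.σ (qball d x r))⁻¹ * ∫⁻ y in qball d x r, g₁ y ∂P.σ) ^ p z ≤ C₄ * Z y := by
      refine (hjen x r hr hn1 z hz hzG g hg hA).trans ?_
      gcongr
      exact le_trans (by gcongr; exact hH₁ x r hr y hy) (hZ₁ y)
    have hle1 : (P.σ (qball d x r))⁻¹ * ∫⁻ y in qball d x r, g₂ y ∂P.σ ≤ 1 := by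
      calc _ ≤ (P.σ (qball d x r))⁻¹ * ∫⁻ y in qball d x r, 1 ∂P.σ := by
            gcongr with y; exact hg₂le y
        _ = 1 := by rw [setLIntegral_one, ENNReal.inv_mul_cancel hs0 hst]
    -- The average is at most one, so `p z` may be exchanged for `pinf`; the error at `z` moves to
    -- `y` because `rad` is comparable on balls of norm at most one.
    have h2 : ((P.σ (qball d x r))⁻¹ * ∫⁻ y in qball d x r, g₂ y ∂P.σ) ^ p z ≤
        (C₃ + C₃ * ENNReal.ofReal (C₇ ^ M)) * Z y := by
      refine (hexch z hzG _ (by simpa using hle1)).1.trans ?_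
      rw [mul_add, add_mul, mul_assoc]
      gcongr
      · exact le_trans (by gcongr; exact hH₂ x r hr y hy) (hZ₂ y)
      · refine le_trans ?_ (mul_le_mul_right (hZ₃ y) _)
        have hz1 := hX.one_lt_rad x₀ z
        have hy1 := hX.one_lt_rad x₀ y
        rw [← ENNReal.ofReal_mul (by positivity)]
        refine ENNReal.ofReal_le_ofReal ?_
        have h3 := hrad x r hr hn1 y hy z hz
        have hC₇0 : 0 < C₇ := by linarith
        calc rad d x₀ z ^ (-M) = C₇ ^ M * (C₇ * rad d x₀ z) ^ (-M) := by
              rw [Real.mul_rpow hC₇0.le (by positivity), ← mul_assoc, ← Real.rpow_add hC₇0]; simp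
          _ ≤ C₇ ^ M * rad d x₀ y ^ (-M) := by
              gcongr 1
              exact Real.rpow_le_rpow_of_nonpos (by positivity) h3 (by linarith)
    calc _ ≤ 2 ^ b * ENNReal.ofReal ((max 1 (max C₅ C₆)) ^ b) * P.σ (qball d x r) *
          (C₄ * Z y + (C₃ + C₃ * ENNReal.ofReal (C₇ ^ M)) * Z y) := by gcongr
      _ = 2 ^ b * ENNReal.ofReal ((max 1 (max C₅ C₆)) ^ b) *
          (C₄ + C₃ + C₃ * ENNReal.ofReal (C₇ ^ M)) * P.σ (qball d x r) * Z y := by ring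
      _ ≤ _ := by
          gcongr
          exact le_add_right (mul_le_mul_right le_self_add _)
  · intro x r hr hn1 y hy
    have hn := P.n_pos x r hr
    have hs0 : P.σ (qball d x r) ≠ 0 := (P.measure_qball_pos x hr).ne'
    have hst : P.σ (qball d x r) ≠ ∞ := (P.measure_qball_lt_top x hr).ne
    have hσ := hup x r hr hn1
    rw [hρinf] at hσ
    have hσ' : P.σ (qball d x r) ≤
        ENNReal.ofReal (max 1 (max C₅ C₆) * P.n x r ^ pinf.conjExponent) := by
      refine hσ.trans (ENNReal.ofReal_le_ofReal ?_)
      gcongr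
      exact (le_max_left _ _).trans (le_max_right _ _)
    refine (hsplit x r hr pinf hpinf1 hpinf.2 hσ').trans ?_
    -- On a ball with `σ(B) ≥ 1` the average of `Γ` is at most `∫ g ^ p dσ ≤ 1`, so the exponent
    -- `pinf` may be lowered to `a`.
    have hσ1 : 1 ≤ P.σ (qball d x r) := by
      have := P.Φ_le_measure (E := qball d x r) hn
      rwa [P.Φ_qball hr, max_eq_left (inv_le_one_of_one_le₀ hn1), Real.one_rpow,
        ENNReal.ofReal_one, one_mul] at this
    have hΓge : ∀ w ∈ G, g₁ w ≤ Γ w ∧ Γ w ≤ g w ^ p w := by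
      intro w hw
      have hpw := hp.mem w hw
      have hpa : 1 ≤ p w / a := (one_le_div ha0).2 hpw.1
      by_cases hw1 : 1 < g w
      · rw [hg₁, hΓ, Set.indicator_of_mem (by exact hw1), Set.indicator_of_mem (by exact hw1)]
        constructor
        · calc g w = g w ^ (1 : ℝ) := (ENNReal.rpow_one _).symm
            _ ≤ _ := ENNReal.rpow_le_rpow_of_exponent_le hw1.le hpa
        · exact ENNReal.rpow_le_rpow_of_exponent_le hw1.le (div_le_self (by linarith) ha.le)
      · rw [hg₁, hΓ, Set.indicator_of_notMem (by exact hw1), Set.indicator_of_notMem (by exact hw1)]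
        exact ⟨le_rfl, bot_le⟩
    have hav : (P.σ (qball d x r))⁻¹ * ∫⁻ y in qball d x r, g₁ y ∂P.σ ≤
        (P.σ (qball d x r))⁻¹ * ∫⁻ y in qball d x r, Γ y ∂P.σ := by
      gcongr 1
      refine lintegral_mono_ae ?_
      filter_upwards [ae_restrict_of_ae P.ae_mem] with w hw using (hΓge w hw).1
    have hav1 : (P.σ (qball d x r))⁻¹ * ∫⁻ y in qball d x r, Γ y ∂P.σ ≤ 1 := by
      calc _ ≤ 1 * ∫⁻ y, g y ^ p y ∂P.σ := by
            gcongr 1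
            · exact ENNReal.inv_le_one.2 hσ1
            · refine (lintegral_mono_ae ?_).trans
                (lintegral_mono' Measure.restrict_le_self le_rfl)
              filter_upwards [ae_restrict_of_ae P.ae_mem] with w hw using (hΓge w hw).2
        _ ≤ 1 := by rwa [one_mul]
    have h1 : ((P.σ (qball d x r))⁻¹ * ∫⁻ y in qball d x r, g₁ y ∂P.σ) ^ pinf ≤ Z y := by
      calc _ ≤ ((P.σ (qball d x r))⁻¹ * ∫⁻ y in qball d x r, Γ y ∂P.σ) ^ pinf := by gcongr
        _ ≤ ((P.σ (qball d x r))⁻¹ * ∫⁻ y in qball d x r, Γ y ∂P.σ) ^ a :=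
            ENNReal.rpow_le_rpow_of_exponent_ge hav1 hpinf.1
        _ ≤ H₁ y ^ a := by gcongr; exact hH₁ x r hr y hy
        _ ≤ Z y := hZ₁ y
    have h2 : ((P.σ (qball d x r))⁻¹ * ∫⁻ y in qball d x r, g₂ y ∂P.σ) ^ pinf ≤ Z y :=
      le_trans (by gcongr; exact hH₂ x r hr y hy) (hZ₂ y)
    calc _ ≤ 2 ^ b * ENNReal.ofReal ((max 1 (max C₅ C₆)) ^ b) * P.σ (qball d x r) *
          (Z y + Z y) := by gcongr
      _ = 2 ^ b * ENNReal.ofReal ((max 1 (max C₅ C₆)) ^ b) * 2 *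
          P.σ (qball d x r) * Z y := by ring
      _ ≤ _ := by
          gcongr
          exact le_add_right (mul_le_mul_right le_add_self _)

end WeightPair

end HomType

/-! ### The multilinear estimate. -/

namespace HomType

lemma ennreal_rpow_sum {ι : Type*} (s : Finset ι) (T : ℝ≥0∞) {e : ι → ℝ} (he : ∀ i, 0 ≤ e i) :
    ∏ i ∈ s, T ^ e i = T ^ ∑ i ∈ s, e i := by
  classical
  induction s using Finset.induction_on with
  | empty => simp
  | insert i s hi ih =>
    rw [Finset.prod_insert hi, Finset.sum_insert hi, ih,
      ENNReal.rpow_add_of_nonneg _ _ (he i) (Finset.sum_nonneg fun j _ => he j)]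

/-- A Young-type inequality for products of numbers bounded by two. -/
lemma prod_rpow_le_sum {m : ℕ} {A : Fin m → ℝ≥0∞} (hA : ∀ i, A i ≤ 2) {e : Fin m → ℝ}
    (he : ∀ i, 0 < e i) {q b : ℝ} (hq : 0 < q) (hqb : q ≤ b) (h : 1 ≤ q * ∑ i, 1 / e i) :
    (∏ i, A i) ^ q ≤ (2 : ℝ≥0∞) ^ (m * b) * ∑ i, A i ^ e i := by
  -- Halving puts the factors into `[0, 1]`. With `T ≤ 1` the largest of the `u i ^ e i`, the power
  -- of the product is at most `T ^ (q ∑ 1 / e i) ≤ T`. Only `q ∑ 1 / e i ≥ 1` enters, not equality.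
  set u : Fin m → ℝ≥0∞ := fun i => A i / 2 with hu
  have hAu : ∀ i, A i = 2 * u i := fun i => by
    rw [hu, ENNReal.mul_div_cancel (by norm_num) (by norm_num)]
  have hu1 : ∀ i, u i ≤ 1 := fun i => ENNReal.div_le_of_le_mul (by simpa using hA i)
  have huA : ∀ i, u i ≤ A i := fun i => by
    rw [hAu i, two_mul]; exact le_self_add
  set T := Finset.univ.sup fun i => u i ^ e i with hT
  have hT1 : T ≤ 1 := Finset.sup_le fun i _ => ENNReal.rpow_le_one (hu1 i) (he i).le
  have huT : ∀ i, u i ≤ T ^ (1 / e i) := by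
    intro i
    rw [one_div, ENNReal.le_rpow_inv_iff (he i)]
    exact Finset.le_sup (f := fun i => u i ^ e i) (Finset.mem_univ i)
  have hprod : (∏ i, u i) ^ q ≤ T := by
    calc (∏ i, u i) ^ q ≤ (∏ i, T ^ (1 / e i)) ^ q := by
          gcongr with i; exact huT i
      _ = T ^ (q * ∑ i, 1 / e i) := by
          rw [ennreal_rpow_sum _ _ (fun i => (one_div_pos.2 (he i)).le), ← ENNReal.rpow_mul, mul_comm]
      _ ≤ T ^ (1 : ℝ) := ENNReal.rpow_le_rpow_of_exponent_ge hT1 h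
      _ = T := ENNReal.rpow_one T
  have hTsum : T ≤ ∑ i, A i ^ e i := by
    refine Finset.sup_le fun i _ => ?_
    refine le_trans ?_ (Finset.single_le_sum (f := fun i => A i ^ e i) (fun _ _ => bot_le)
      (Finset.mem_univ i))
    exact ENNReal.rpow_le_rpow (huA i) (he i).le
  calc (∏ i, A i) ^ q = ((2 : ℝ≥0∞) ^ (m : ℝ) * ∏ i, u i) ^ q := by
        simp_rw [hAu]
        rw [Finset.prod_mul_distrib, Finset.prod_const, Finset.card_univ, Fintype.card_fin,
          ENNReal.rpow_natCast]
    _ = (2 : ℝ≥0∞) ^ (m * q) * (∏ i, u i) ^ q := by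
        rw [ENNReal.mul_rpow_of_nonneg _ _ hq.le, ← ENNReal.rpow_mul]
    _ ≤ _ := by
        gcongr
        · norm_num
        · exact hprod.trans hTsum

/-- A bound valid at every point of the ball becomes a bound by an infimum, which can later be put
under an integral over the ball against a different measure. -/
lemma le_mul_iInf {X : Type*} {B : Set X} {Z : X → ℝ≥0∞} {T c : ℝ≥0∞} (hc0 : c ≠ 0) (hct : c ≠ ∞)
    (h : ∀ y ∈ B, T ≤ c * Z y) : T ≤ c * ⨅ y ∈ B, Z y := by
  rw [← ENNReal.div_le_iff' hc0 hct]
  exact le_iInf₂ fun y hy => (ENNReal.div_le_iff' hc0 hct).2 (h y hy)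

variable {X : Type*} [MeasurableSpace X] {d : X → X → ℝ} {μ : Measure X} {x₀ : X} {G : Set X}

namespace WeightPair

lemma one_le_measure (P : WeightPair d μ x₀ G) {x : X} {r : ℝ} (hr : 0 < r) (hn : 1 ≤ P.n x r) :
    1 ≤ P.σ (qball d x r) := by
  have := P.Φ_le_measure (E := qball d x r) (P.n_pos x r hr)
  rwa [P.Φ_qball hr, max_eq_left (inv_le_one_of_one_le₀ hn), Real.one_rpow,
    ENNReal.ofReal_one, one_mul] at this

lemma ofReal_rpow_neg_le (P : WeightPair d μ x₀ G) {x : X} {r : ℝ} (hr : 0 < r) {C e : ℝ}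
    (hC : 0 < C) (h : P.σ (qball d x r) ≤ ENNReal.ofReal (C * P.n x r ^ e)) :
    (ENNReal.ofReal (P.n x r))⁻¹ ^ e ≤ ENNReal.ofReal C * (P.σ (qball d x r))⁻¹ := by
  have hn := P.n_pos x r hr
  have hs0 : P.σ (qball d x r) ≠ 0 := (P.measure_qball_pos x hr).ne'
  have hst : P.σ (qball d x r) ≠ ∞ := (P.measure_qball_lt_top x hr).ne
  rw [← div_eq_mul_inv, ENNReal.le_div_iff_mul_le (Or.inl hs0) (Or.inl hst), ENNReal.inv_rpow,
    ENNReal.ofReal_rpow_of_pos hn]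
  calc _ ≤ (ENNReal.ofReal (P.n x r ^ e))⁻¹ * ENNReal.ofReal (C * P.n x r ^ e) := by gcongr
    _ = ENNReal.ofReal C := by
        rw [← ENNReal.ofReal_inv_of_pos (by positivity), ← ENNReal.ofReal_mul (by positivity)]
        congr 1
        have := Real.rpow_pos_of_pos hn e
        field_simp

end WeightPair

/-- The data of the multilinear estimate: the pairs of the weights, with the dual exponents, and
the pair of their product. -/
structure MultiWeight {m : ℕ} (W : WeightPair d μ x₀ G) (P : Fin m → WeightPair d μ x₀ G)
    (p : Fin m → X → ℝ) (pinf : Fin m → ℝ) (M : ℝ) : Prop where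
  measurable : ∀ i, Measurable (p i)
  lh : ∀ i, ∃ a b K, 1 < a ∧ IsLogHolderOn d x₀ G (p i) a b K (pinf i)
  conj : ∀ i, ∀ x ∈ G, (P i).ρ x = (p i x).conjExponent
  conj_inf : ∀ i, (P i).ρinf = (pinf i).conjExponent
  one_le : ∀ x ∈ G, 1 ≤ W.ρ x * ∑ i, 1 / p i x
  one_le_inf : 1 ≤ W.ρinf * ∑ i, 1 / pinf i
  M_nonneg : 0 ≤ M
  decay : ∫⁻ x, ENNReal.ofReal (rad d x₀ x ^ (-M)) ∂W.σ < ∞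
  decay_dual : ∀ i, ∫⁻ x, ENNReal.ofReal (rad d x₀ x ^ (-M)) ∂(P i).σ < ∞

namespace MultiWeight

variable {m : ℕ} {W : WeightPair d μ x₀ G} {P : Fin m → WeightPair d μ x₀ G}
  {p : Fin m → X → ℝ} {pinf : Fin m → ℝ} {M : ℝ}

/-- Pointwise control of normalized multilinear averages. -/
lemma exists_pointwise_estimate (hW : MultiWeight W P p pinf M) (hX : IsHomogeneousType d μ) :
    ∃ C : ℝ≥0, ∀ g : Fin m → X → ℝ≥0∞, (∀ i, Measurable (g i)) →
      (∀ i, ∫⁻ x, g i x ^ p i x ∂(P i).σ ≤ 1) →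
      ∃ Z : Fin m → X → ℝ≥0∞, (∀ i, Measurable (Z i)) ∧ (∀ i, ∫⁻ x, Z i x ∂(P i).σ ≤ C) ∧
        ∀ x r, 0 < r → ∀ z ∈ qball d x r, z ∈ G →
          ((∏ i, (∫⁻ y in qball d x r, g i y ∂(P i).σ) / ENNReal.ofReal ((P i).n x r)) *
            (ENNReal.ofReal (W.n x r))⁻¹) ^ W.ρ z ≤
          C * ((∑ i, (W.σ (qball d x r))⁻¹ * ((P i).σ (qball d x r) *
            ⨅ y ∈ qball d x r, Z i y)) + ENNReal.ofReal (rad d x₀ z ^ (-M))) := by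
  have hM := hW.M_nonneg
  choose a b K ha hlh using hW.lh
  choose C₁ hlin using fun i => (P i).exists_linear_estimate hX hM (hW.decay_dual i)
    (hW.measurable i) (hlh i) (ha i) (hW.conj i) (hW.conj_inf i)
  choose C₂ hexch using fun i => (hlh i).exists_exchange_ennreal hX hM (A := 2) one_le_two
  obtain ⟨C₃, hexchW⟩ := W.lh.exists_exchange_ennreal hX hM (A := 2 ^ m) (one_le_pow₀ one_le_two)
  obtain ⟨C₄, hC₄, hcompW⟩ := W.exists_measure_comparable hX 1
  obtain ⟨C₅, hC₅, hupW⟩ := W.exists_measure_le_of_one_le hX hM hW.decay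
  obtain ⟨C₆, hC₆, hradW⟩ := W.exists_rad_le hX 1
  set D₁ : ℝ≥0 := ∑ i, C₁ i with hD₁
  set D₂ : ℝ≥0 := ∑ i, C₂ i with hD₂
  have hCD₁ : ∀ i, C₁ i ≤ D₁ := fun i =>
    Finset.single_le_sum (f := C₁) (fun _ _ => bot_le) (Finset.mem_univ i)
  have hCD₂ : ∀ i, C₂ i ≤ D₂ := fun i =>
    Finset.single_le_sum (f := C₂) (fun _ _ => bot_le) (Finset.mem_univ i)
  set D₃ : ℝ≥0 := (C₆ ^ M).toNNReal with hD₃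
  set D₄ : ℝ≥0 := D₁ + D₂ * (D₁ + D₃) with hD₄
  set D₅ : ℝ≥0 := (max C₄ C₅).toNNReal with hD₅
  set D₆ : ℝ≥0 := 2 ^ (m * W.b) * D₅ with hD₆
  set D₇ : ℝ≥0 := D₁ + D₂ * (D₁ + 1) with hD₇
  have hD₆' : (D₆ : ℝ≥0∞) = (2 : ℝ≥0∞) ^ (m * W.b) * D₅ := by
    have hb := W.b_pos
    rw [hD₆, ENNReal.coe_mul, ENNReal.coe_rpow_of_nonneg _ (by positivity)]
    rfl
  refine ⟨D₁ + D₆ * D₄ + C₃ * (D₆ * D₇ * m + 1) + C₃ * D₆ * D₇, fun g hg hgint => ?_⟩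
  choose Z hZm hZint hZS hZsmall hZlarge using fun i => hlin i (g i) (hg i) (hgint i)
  refine ⟨Z, hZm, fun i => (hZint i).trans ?_, ?_⟩
  · refine le_trans (ENNReal.coe_le_coe.2 (hCD₁ i)) ?_
    refine ENNReal.coe_le_coe.2 ?_
    rw [add_assoc, add_assoc]; exact le_self_add
  intro x r hr z hz hzG
  set B := qball d x r with hB
  have hW0 := W.n_pos x r hr
  set S := ENNReal.ofReal (rad d x₀ z ^ (-M)) with hS
  set A : Fin m → ℝ≥0∞ := fun i =>
    (∫⁻ y in B, g i y ∂(P i).σ) / ENNReal.ofReal ((P i).n x r) with hAdef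
  set ζ : Fin m → ℝ≥0∞ := fun i => (P i).σ B * ⨅ y ∈ B, Z i y with hζ
  have hA2 : ∀ i, A i ≤ 2 := fun i =>
    (P i).lintegral_div_n_le_two (hlh i) (ha i) (hW.conj i) (hg i) (hgint i) x hr
  have hA2' : ∀ i, A i ≤ ((2 : ℝ≥0) : ℝ≥0∞) := fun i => by simpa using hA2 i
  have hσ0 : ∀ i, (P i).σ B ≠ 0 := fun i => ((P i).measure_qball_pos x hr).ne'
  have hσt : ∀ i, (P i).σ B ≠ ∞ := fun i => ((P i).measure_qball_lt_top x hr).ne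
  have hpull : ∀ (i : Fin m) (T : ℝ≥0∞), (∀ y ∈ B, T ≤ C₁ i * (P i).σ B * Z i y) →
      T ≤ D₁ * ζ i := by
    intro i T hT
    have h1 : T ≤ ((D₁ : ℝ≥0∞) + 0) * (P i).σ B * ⨅ y ∈ B, Z i y := by
      rcases eq_or_ne D₁ 0 with h0 | h0
      · have hC : C₁ i = 0 := le_antisymm (h0 ▸ hCD₁ i) bot_le
        have := hT z hz
        rw [hC] at this
        simp only [ENNReal.coe_zero, zero_mul] at this
        exact this.trans bot_le
      · refine le_mul_iInf ?_ ?_ fun y hy => (hT y hy).trans ?_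
        · simp [h0, hσ0 i]
        · rw [add_zero]; exact ENNReal.mul_ne_top ENNReal.coe_ne_top (hσt i)
        · rw [add_zero]; gcongr; exact hCD₁ i
    rwa [add_zero, mul_assoc] at h1
  have hsmall : ∀ i, (P i).n x r ≤ 1 → A i ^ p i z ≤ D₁ * ζ i := fun i hn =>
    hpull i _ fun y hy => hZsmall i x r hr hn z hz hzG y hy
  have hlarge : ∀ i, 1 ≤ (P i).n x r → A i ^ pinf i ≤ D₁ * ζ i := fun i hn =>
    hpull i _ fun y hy => hZlarge i x r hr hn y hy
  have hSt : S ≠ ∞ := ENNReal.ofReal_ne_top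
  have hWs0 : W.σ B ≠ 0 := (W.measure_qball_pos x hr).ne'
  have hWst : W.σ B ≠ ∞ := (W.measure_qball_lt_top x hr).ne
  have hqz := W.lh.mem z hzG
  have hqz0 : 0 < W.ρ z := W.lh.pos.trans_le hqz.1
  have hqinf := W.lh.mem_inf
  have hqinf0 : 0 < W.ρinf := W.lh.pos.trans_le hqinf.1
  have hp0 : ∀ i, 0 < p i z := fun i => by linarith [((hlh i).mem z hzG).1, ha i]
  have hpinf0 : ∀ i, 0 < pinf i := fun i => by linarith [(hlh i).mem_inf.1, ha i]
  set Tot := ∑ i, (W.σ B)⁻¹ * ζ i with hTot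
  push_cast
  rcases le_total (W.n x r) 1 with hN | hN
  · -- the norm of the product weight is at most one
    have hterm : ∀ i, A i ^ p i z ≤ D₄ * ζ i := by
      intro i
      rcases le_total ((P i).n x r) 1 with hn | hn
      · refine (hsmall i hn).trans ?_
        gcongr
        exact_mod_cast le_self_add
      · refine (hexch i z hzG _ (hA2' i)).1.trans ?_
        -- The error at `z` is absorbed: `Z i` dominates the error at every `y ∈ B`, `rad` is
        -- comparable on `B` because the norm of the product weight is at most one, and `(P i).σ B ≥
        -- 1`.
        have hSζ : S ≤ D₃ * ζ i := by
          have h1 : ∀ y ∈ B, S ≤ D₃ * Z i y := by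
            intro y hy
            refine le_trans ?_ (mul_le_mul_right (hZS i y) _)
            have hz1 := hX.one_lt_rad x₀ z
            have hy1 := hX.one_lt_rad x₀ y
            have hC₆0 : 0 < C₆ := by linarith
            change _ ≤ ENNReal.ofReal _ * _
            rw [← ENNReal.ofReal_mul (by positivity)]
            refine ENNReal.ofReal_le_ofReal ?_
            calc rad d x₀ z ^ (-M) = C₆ ^ M * (C₆ * rad d x₀ z) ^ (-M) := by
                  rw [Real.mul_rpow hC₆0.le (by positivity), ← mul_assoc, ← Real.rpow_add hC₆0]
                  simp
              _ ≤ C₆ ^ M * rad d x₀ y ^ (-M) := by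
                  gcongr 1
                  exact Real.rpow_le_rpow_of_nonpos (by positivity)
                    (hradW x r hr hN y hy z hz) (by linarith)
          have hD₃0 : (D₃ : ℝ≥0∞) ≠ 0 := by
            have : 0 < C₆ ^ M := by positivity
            simpa [hD₃] using this
          refine (le_mul_iInf hD₃0 ENNReal.coe_ne_top h1).trans ?_
          gcongr
          exact le_mul_of_one_le_left' ((P i).one_le_measure hr hn)
        calc (C₂ i : ℝ≥0∞) * (A i ^ pinf i + S) ≤ D₂ * (D₁ * ζ i + D₃ * ζ i) := by
              gcongr
              · exact hCD₂ i
              · exact hlarge i hn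
          _ = (D₂ * (D₁ + D₃)) * ζ i := by ring
          _ ≤ _ := by
              gcongr
              rw [hD₄]; push_cast; exact le_add_self
    have hNW : (ENNReal.ofReal (W.n x r))⁻¹ ^ W.ρ z ≤ D₅ * (W.σ B)⁻¹ := by
      have h1 := (hcompW x r hr hN B subset_rfl (hX.measurableSet_qball x hr) z hz hzG).1
      rw [W.Φ_qball hr, mul_one] at h1
      refine (W.ofReal_rpow_neg_le hr (by linarith) h1).trans ?_
      gcongr
      exact ENNReal.ofReal_le_ofReal (le_max_left _ _)
    calc ((∏ i, A i) * (ENNReal.ofReal (W.n x r))⁻¹) ^ W.ρ z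
        = (∏ i, A i) ^ W.ρ z * (ENNReal.ofReal (W.n x r))⁻¹ ^ W.ρ z :=
          ENNReal.mul_rpow_of_nonneg _ _ hqz0.le
      _ ≤ ((2 : ℝ≥0∞) ^ (m * W.b) * ∑ i, A i ^ p i z) * (D₅ * (W.σ B)⁻¹) := by
          gcongr
          exact prod_rpow_le_sum hA2 hp0 hqz0 hqz.2 (hW.one_le z hzG)
      _ ≤ ((2 : ℝ≥0∞) ^ (m * W.b) * ∑ i, D₄ * ζ i) * (D₅ * (W.σ B)⁻¹) := by
          gcongr with i
          exact hterm i
      _ = D₆ * D₄ * Tot := by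
          rw [hD₆', hTot, ← Finset.mul_sum, ← Finset.mul_sum]; ring
      _ ≤ _ := by
          gcongr
          · rw [add_assoc, add_assoc, add_left_comm]; exact le_self_add
          · exact le_self_add
  · -- the norm of the product weight is at least one
    have hterm : ∀ i, A i ^ pinf i ≤ D₇ * (ζ i + S) := by
      intro i
      rcases le_total ((P i).n x r) 1 with hn | hn
      · refine (hexch i z hzG _ (hA2' i)).2.trans ?_
        calc (C₂ i : ℝ≥0∞) * (A i ^ p i z + S) ≤ D₂ * (D₁ * ζ i + 1 * S) := by
              gcongr
              · exact hCD₂ i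
              · exact hsmall i hn
              · rw [one_mul]
          _ ≤ D₂ * ((D₁ + 1) * ζ i + (D₁ + 1) * S) := by
              gcongr
              · exact le_self_add
              · exact le_add_self
          _ = (D₂ * (D₁ + 1)) * (ζ i + S) := by ring
          _ ≤ _ := by
              gcongr
              rw [hD₇]; push_cast; exact le_add_self
      · refine (hlarge i hn).trans ?_
        gcongr
        · rw [hD₇]; exact le_self_add
        · exact le_self_add
    -- On these balls the errors are not absorbed into `ζ i`; `W.σ B ≥ 1` keeps them bounded by the
    -- additive term `S`.
    have hWinv : (W.σ B)⁻¹ ≤ 1 := ENNReal.inv_le_one.2 (W.one_le_measure hr hN)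
    have hNW : (ENNReal.ofReal (W.n x r))⁻¹ ^ W.ρinf ≤ D₅ * (W.σ B)⁻¹ := by
      refine (W.ofReal_rpow_neg_le hr hC₅ (hupW x r hr hN)).trans ?_
      gcongr
      exact ENNReal.ofReal_le_ofReal (le_max_right _ _)
    have ht : (∏ i, A i) * (ENNReal.ofReal (W.n x r))⁻¹ ≤ ((2 ^ m : ℝ≥0) : ℝ≥0∞) := by
      calc _ ≤ (∏ _i : Fin m, (2 : ℝ≥0∞)) * 1 := by
            gcongr with i
            · exact hA2 i
            · exact ENNReal.inv_le_one.2 (ENNReal.one_le_ofReal.2 hN)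
        _ = _ := by simp
    have hmain : ((∏ i, A i) * (ENNReal.ofReal (W.n x r))⁻¹) ^ W.ρinf ≤
        D₆ * D₇ * (Tot + m * S) := by
      calc _ = (∏ i, A i) ^ W.ρinf * (ENNReal.ofReal (W.n x r))⁻¹ ^ W.ρinf :=
            ENNReal.mul_rpow_of_nonneg _ _ hqinf0.le
        _ ≤ ((2 : ℝ≥0∞) ^ (m * W.b) * ∑ i, A i ^ pinf i) * (D₅ * (W.σ B)⁻¹) := by
            gcongr
            exact prod_rpow_le_sum hA2 hpinf0 hqinf0 hqinf.2 hW.one_le_inf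
        _ ≤ ((2 : ℝ≥0∞) ^ (m * W.b) * ∑ i, D₇ * (ζ i + S)) * (D₅ * (W.σ B)⁻¹) := by
            gcongr with i
            exact hterm i
        _ = D₆ * D₇ * (Tot + m * ((W.σ B)⁻¹ * S)) := by
            rw [hD₆', hTot, ← Finset.mul_sum, ← Finset.mul_sum, Finset.sum_add_distrib,
              Finset.sum_const, Finset.card_univ, Fintype.card_fin, nsmul_eq_mul]
            ring
        _ ≤ _ := by
            gcongr
            exact mul_le_of_le_one_left' hWinv
    -- So far the exponent was `W.ρinf`; since the base is at most `2 ^ m`, one more exchange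
    -- returns to the exponent at `z`.
    refine (hexchW z hzG _ ht).1.trans ?_
    calc (C₃ : ℝ≥0∞) * (_ + S) ≤ C₃ * (D₆ * D₇ * (Tot + m * S) + S) := by gcongr
      _ = (C₃ * D₆ * D₇) * Tot + (C₃ * (D₆ * D₇ * m + 1)) * S := by ring
      _ ≤ _ := by
          rw [mul_add _ Tot S]
          gcongr
          · exact le_add_self
          · rw [add_assoc, add_comm (_ + _ : ℝ≥0∞), add_assoc]; exact le_self_add

/-- The normalized multilinear maximal function is controlled by an integrable function. -/
lemma exists_maximal_estimate (hW : MultiWeight W P p pinf M) (hX : IsHomogeneousType d μ)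
    {s : Fin m → X → ℝ≥0∞} {t : X → ℝ≥0∞} (hs : ∀ i, Measurable (s i)) (ht : Measurable t)
    (hPs : ∀ i, (P i).σ = μ.withDensity (s i)) (hWt : W.σ = μ.withDensity t)
    (ht0 : ∀ᵐ x ∂μ, t x ≠ 0) (htt : ∀ᵐ x ∂μ, t x ≠ ∞) :
    ∃ C : ℝ≥0, ∀ g : Fin m → X → ℝ≥0∞, (∀ i, Measurable (g i)) →
      (∀ i, ∫⁻ x, g i x ^ p i x ∂(P i).σ ≤ 1) →
      ∃ Ψ : X → ℝ≥0∞, Measurable Ψ ∧ ∫⁻ x, Ψ x ∂W.σ ≤ C ∧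
        ∀ x r, 0 < r → ∀ z ∈ qball d x r, z ∈ G →
          ((∏ i, (∫⁻ y in qball d x r, g i y ∂(P i).σ) / ENNReal.ofReal ((P i).n x r)) *
            (ENNReal.ofReal (W.n x r))⁻¹) ^ W.ρ z ≤ Ψ z := by
  have hM := hW.M_nonneg
  obtain ⟨C₁, hpt⟩ := hW.exists_pointwise_estimate hX
  choose C₂ hgeo using fun i => WeightPair.exists_sqrt_mul_le hX hM (P i) W (hW.decay_dual i)
    hW.decay (hs i) ht (hPs i) hWt
  obtain ⟨C₃, hmax⟩ := (W.isDoublingOn hX hM hW.decay).exists_maximal_majorant hX one_lt_two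
  set I := ∫⁻ x, ENNReal.ofReal (rad d x₀ x ^ (-M)) ∂W.σ with hI
  have hIt : I ≠ ∞ := hW.decay.ne
  set Q : ℝ≥0∞ := C₁ * ((∑ i, (C₂ i : ℝ≥0∞) ^ (2 : ℝ) * (C₃ * C₁)) + I) with hQ
  have hQt : Q ≠ ∞ := by
    rw [hQ]
    refine ENNReal.mul_ne_top ENNReal.coe_ne_top (ENNReal.add_ne_top.2 ⟨?_, hIt⟩)
    exact ENNReal.sum_ne_top.2 fun i _ => by finiteness
  refine ⟨Q.toNNReal, fun g hg hgint => ?_⟩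
  rw [ENNReal.coe_toNNReal hQt]
  obtain ⟨Z, hZm, hZint, hZ⟩ := hpt g hg hgint
  -- Chosen so that `t h ^ 2` is at most `s i Z i`: the `L²(W)` norm of `h i` is then controlled by
  -- the integral of `Z i` against `(P i).σ`.
  set h : Fin m → X → ℝ≥0∞ := fun i x => (s i x * Z i x / t x) ^ (1 / 2 : ℝ) with hh
  have hhm : ∀ i, Measurable (h i) := fun i => (((hs i).mul (hZm i)).div ht).pow_const _
  choose H hHm hH hHint using fun i => hmax (h i) (hhm i)
  have hSm : Measurable fun y => ENNReal.ofReal (rad d x₀ y ^ (-M)) :=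
    ((hX.measurable_rad x₀).pow_const _).ennreal_ofReal
  have hHsm : Measurable fun z => ∑ i, (C₂ i : ℝ≥0∞) ^ (2 : ℝ) * H i z ^ (2 : ℝ) :=
    Finset.measurable_sum _ fun i _ => ((hHm i).pow_const _).const_mul _
  refine ⟨fun z => C₁ * ((∑ i, (C₂ i : ℝ≥0∞) ^ (2 : ℝ) * H i z ^ (2 : ℝ)) +
    ENNReal.ofReal (rad d x₀ z ^ (-M))), (hHsm.add hSm).const_mul _, ?_, ?_⟩
  · beta_reduce
    have hadd : Measurable fun z => (∑ i, (C₂ i : ℝ≥0∞) ^ (2 : ℝ) * H i z ^ (2 : ℝ)) +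
        ENNReal.ofReal (rad d x₀ z ^ (-M)) := hHsm.add hSm
    rw [lintegral_const_mul _ hadd, lintegral_add_right _ hSm,
      lintegral_finsetSum _ fun i _ => ((hHm i).pow_const _).const_mul _, hQ]
    gcongr with i
    rw [lintegral_const_mul _ ((hHm i).pow_const _)]
    gcongr
    refine (hHint i).trans ?_
    gcongr
    calc ∫⁻ y, h i y ^ (2 : ℝ) ∂W.σ = ∫⁻ y, s i y * Z i y / t y ∂W.σ := by
          refine lintegral_congr fun y => ?_
          rw [hh, ← ENNReal.rpow_mul]; norm_num
      _ = ∫⁻ y, t y * (s i y * Z i y / t y) ∂μ := by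
          have hq : Measurable fun y => s i y * Z i y / t y := ((hs i).mul (hZm i)).div ht
          rw [hWt, lintegral_withDensity_eq_lintegral_mul _ ht hq]
          rfl
      _ ≤ ∫⁻ y, s i y * Z i y ∂μ := lintegral_mono fun y => ENNReal.mul_div_le
      _ = ∫⁻ y, Z i y ∂(P i).σ := by
          rw [hPs i, lintegral_withDensity_eq_lintegral_mul _ (hs i) (hZm i)]; rfl
      _ ≤ C₁ := hZint i
  · intro x r hr z hz hzG
    refine (hZ x r hr z hz hzG).trans ?_
    refine mul_le_mul' le_rfl (add_le_add (Finset.sum_le_sum fun i _ => ?_) le_rfl)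
    set B := qball d x r with hB
    have hBm : MeasurableSet B := hX.measurableSet_qball x hr
    have hWs0 : W.σ B ≠ 0 := (W.measure_qball_pos x hr).ne'
    have hWst : W.σ B ≠ ∞ := (W.measure_qball_lt_top x hr).ne
    set ζ := ⨅ y ∈ B, Z i y with hζ
    -- The infimum `ζ` goes under the integral of `(s t) ^ (1 / 2)`, and `(s t Z) ^ (1 / 2) = t h`
    -- makes it an integral against `W`. Divided by `W.σ B`, the left side is the square root of the
    -- term to be bounded.
    have h1 : ((P i).σ B * W.σ B) ^ (1 / 2 : ℝ) * ζ ^ (1 / 2 : ℝ) ≤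
        C₂ i * ∫⁻ y in B, h i y ∂W.σ := by
      calc _ ≤ (C₂ i * ∫⁻ y in B, (s i y * t y) ^ (1 / 2 : ℝ) ∂μ) * ζ ^ (1 / 2 : ℝ) := by
            gcongr; exact hgeo i x r hr
        _ = C₂ i * ∫⁻ y in B, (s i y * t y) ^ (1 / 2 : ℝ) * ζ ^ (1 / 2 : ℝ) ∂μ := by
            have hq : Measurable fun y => (s i y * t y) ^ (1 / 2 : ℝ) :=
              ((hs i).mul ht).pow_const _
            rw [lintegral_mul_const _ hq, mul_assoc]
        _ ≤ C₂ i * ∫⁻ y in B, t y * h i y ∂μ := by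
            gcongr 1
            refine lintegral_mono_ae ?_
            filter_upwards [ae_restrict_of_ae ht0, ae_restrict_of_ae htt, ae_restrict_mem hBm]
              with y hy0 hyt hyB
            have hζy : ζ ≤ Z i y := iInf₂_le y hyB
            have e1 : t y * h i y = (s i y * t y * Z i y) ^ (1 / 2 : ℝ) := by
              have e2 : t y = (t y * t y) ^ (1 / 2 : ℝ) := by
                rw [← sq, ← ENNReal.rpow_natCast, ← ENNReal.rpow_mul]; norm_num
              calc t y * h i y = (t y * t y) ^ (1 / 2 : ℝ) * h i y := by rw [← e2]
                _ = (t y * t y * (s i y * Z i y / t y)) ^ (1 / 2 : ℝ) := by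
                    rw [ENNReal.mul_rpow_of_nonneg (t y * t y) _ (by norm_num : (0 : ℝ) ≤ 1 / 2)]
                _ = _ := by
                    congr 1
                    rw [div_eq_mul_inv]
                    calc _ = (t y * (t y)⁻¹) * (s i y * t y * Z i y) := by ring
                      _ = _ := by rw [ENNReal.mul_inv_cancel hy0 hyt, one_mul]
            rw [e1, ENNReal.mul_rpow_of_nonneg (s i y * t y) _ (by norm_num : (0 : ℝ) ≤ 1 / 2)]
            gcongr
        _ = C₂ i * ∫⁻ y in B, h i y ∂W.σ := by
            rw [hWt, restrict_withDensity hBm,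
              lintegral_withDensity_eq_lintegral_mul _ ht (hhm i)]
            rfl
    have h2 : (W.σ B)⁻¹ * ((P i).σ B * ζ) =
        ((W.σ B)⁻¹ * (((P i).σ B * W.σ B) ^ (1 / 2 : ℝ) * ζ ^ (1 / 2 : ℝ))) ^ (2 : ℝ) := by
      rw [ENNReal.mul_rpow_of_nonneg _ _ zero_le_two, ENNReal.mul_rpow_of_nonneg _ _ zero_le_two,
        ← ENNReal.rpow_mul, ← ENNReal.rpow_mul, ENNReal.rpow_two]
      norm_num
      calc (W.σ B)⁻¹ * ((P i).σ B * ζ)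
          = (W.σ B)⁻¹ * ((W.σ B)⁻¹ * W.σ B) * ((P i).σ B * ζ) := by
            rw [ENNReal.inv_mul_cancel hWs0 hWst, mul_one]
        _ = _ := by rw [sq]; ring
    rw [h2, ← ENNReal.mul_rpow_of_nonneg _ _ zero_le_two]
    refine ENNReal.rpow_le_rpow ?_ zero_le_two
    calc (W.σ B)⁻¹ * (((P i).σ B * W.σ B) ^ (1 / 2 : ℝ) * ζ ^ (1 / 2 : ℝ))
        ≤ (W.σ B)⁻¹ * (C₂ i * ∫⁻ y in B, h i y ∂W.σ) := by gcongr
      _ = C₂ i * ((W.σ B)⁻¹ * ∫⁻ y in B, h i y ∂W.σ) := by ring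
      _ ≤ C₂ i * H i z := by gcongr; exact hH i x r hr z hz

end MultiWeight

end HomType

/-! ### Log-Hölder exponents and their limits. -/

namespace HomType

variable {X : Type*} {d : X → X → ℝ} {x₀ : X} {G : Set X}

lemma one_le_log_exp_one_add {t : ℝ} (ht : 0 ≤ t) : 1 ≤ Real.log (Real.exp 1 + t) := by
  have := Real.exp_pos 1
  rw [Real.le_log_iff_exp_le (by positivity)]
  linarith

/-- Local log-Hölder continuity of a bounded exponent, at all scales. -/
lemma LH0.exists_loc {p : X → ℝ} (h : LH0 d p) (hd : ∀ x y, 0 ≤ d x y) {a b : ℝ}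
    (hab : ∀ x ∈ G, a ≤ p x ∧ p x ≤ b) (h0 : ∀ x ∈ G, ∀ y ∈ G, d x y = 0 → p x = p y) :
    ∃ K : ℝ, 0 ≤ K ∧ ∀ x ∈ G, ∀ y ∈ G, ∀ r, 0 < r → d x y < r →
      |p x - p y| * Real.log (Real.exp 1 + 1 / r) ≤ K := by
  obtain ⟨C, hC⟩ := h
  refine ⟨|C| + |b - a| * Real.log (Real.exp 1 + 2), ?_, ?_⟩
  · have := one_le_log_exp_one_add zero_le_two
    positivity
  intro x hx y hy r hr hxy
  have he := Real.exp_pos 1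
  have h2 := one_le_log_exp_one_add zero_le_two
  -- At distance zero `1 / d x y` is `0` and the hypothesis gives no smallness, so equality of the
  -- values must be supplied. At distances at least `1 / 2` the logarithm is bounded.
  rcases eq_or_ne (d x y) 0 with hz | hz
  · rw [h0 x hx y hy hz]; simp; positivity
  have hpos : 0 < d x y := lt_of_le_of_ne (hd x y) hz.symm
  rcases lt_or_ge (d x y) (1 / 2) with hlt | hge
  · have h1 := hC x y hlt
    have hl := one_le_log_exp_one_add (t := 1 / d x y) (by positivity)
    rw [le_div_iff₀ (by linarith)] at h1
    have h3 : Real.log (Real.exp 1 + 1 / r) ≤ Real.log (Real.exp 1 + 1 / d x y) := by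
      gcongr
    calc |p x - p y| * Real.log (Real.exp 1 + 1 / r)
        ≤ |p x - p y| * Real.log (Real.exp 1 + 1 / d x y) := by gcongr
      _ ≤ C := h1
      _ ≤ |C| := le_abs_self C
      _ ≤ _ := le_add_of_nonneg_right (by positivity)
  · have h3 : Real.log (Real.exp 1 + 1 / r) ≤ Real.log (Real.exp 1 + 2) := by
      gcongr
      rw [div_le_iff₀ hr]; linarith
    have h4 : |p x - p y| ≤ |b - a| := by
      refine le_trans ?_ (le_abs_self _)
      rw [abs_le]
      constructor <;> linarith [(hab x hx).1, (hab x hx).2, (hab y hy).1, (hab y hy).2]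
    have hl := one_le_log_exp_one_add (t := 1 / r) (by positivity)
    calc _ ≤ |b - a| * Real.log (Real.exp 1 + 2) :=
          mul_le_mul h4 h3 (by linarith) (abs_nonneg _)
      _ ≤ _ := le_add_of_nonneg_left (abs_nonneg C)

/-- Lipschitz functions of log-Hölder exponents are log-Hölder. -/
lemma IsLogHolderOn.comp {ι : Type*} [Fintype ι] {p : ι → X → ℝ} {a b K pinf : ι → ℝ}
    (h : ∀ i, IsLogHolderOn d x₀ G (p i) (a i) (b i) (K i) (pinf i)) {f : X → ℝ}
    {a' b' finf L : ℝ} (hd : ∀ x y, 0 ≤ d x y) (hL : 0 ≤ L) (ha : 0 < a')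
    (hmem : ∀ x ∈ G, a' ≤ f x ∧ f x ≤ b')
    (hinf : a' ≤ finf ∧ finf ≤ b')
    (hf : ∀ x ∈ G, ∀ y ∈ G, |f x - f y| ≤ L * ∑ i, |p i x - p i y|)
    (hfinf : ∀ x ∈ G, |f x - finf| ≤ L * ∑ i, |p i x - pinf i|) :
    IsLogHolderOn d x₀ G f a' b' (L * ∑ i, K i) finf where
  pos := ha
  mem := hmem
  mem_inf := hinf
  loc x hx y hy r hr hxy := by
    have hl := one_le_log_exp_one_add (t := 1 / r) (by positivity)
    calc _ ≤ (L * ∑ i, |p i x - p i y|) * Real.log (Real.exp 1 + 1 / r) := by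
          gcongr; exact hf x hx y hy
      _ = L * ∑ i, |p i x - p i y| * Real.log (Real.exp 1 + 1 / r) := by
          rw [mul_assoc, Finset.sum_mul]
      _ ≤ _ := by
          gcongr with i
          exact (h i).loc x hx y hy r hr hxy
  inf x hx := by
    have hl : 1 ≤ Real.log (rad d x₀ x) := one_le_log_exp_one_add (hd x x₀)
    calc _ ≤ (L * ∑ i, |p i x - pinf i|) * Real.log (rad d x₀ x) := by
          gcongr; exact hfinf x hx
      _ = L * ∑ i, |p i x - pinf i| * Real.log (rad d x₀ x) := by
          rw [mul_assoc, Finset.sum_mul]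
      _ ≤ _ := by
          gcongr with i
          exact (h i).inf x hx

lemma abs_conjExponent_sub_le {a s t : ℝ} (ha : 1 < a) (hs : a ≤ s) (ht : a ≤ t) :
    |s.conjExponent - t.conjExponent| ≤ (1 / (a - 1) ^ 2) * |s - t| := by
  have h1 : 0 < a - 1 := by linarith
  have h2 : 0 < s - 1 := by linarith
  have h3 : 0 < t - 1 := by linarith
  have e : s.conjExponent - t.conjExponent = (1 / ((s - 1) * (t - 1))) * (t - s) := by
    rw [Real.conjExponent, Real.conjExponent]; field_simp; ring
  rw [e, abs_mul, abs_of_pos (by positivity), abs_sub_comm]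
  gcongr
  rw [sq]; gcongr

/-- The logarithmic decay condition does not depend on the base point. -/
lemma LHinfty.exists_inf {p : X → ℝ} (h : LHinfty d p) (hd : IsQuasiMetric d) (x₀ : X) :
    ∃ L K : ℝ, ∀ x, |p x - L| * Real.log (rad d x₀ x) ≤ K := by
  obtain ⟨y₀, L, C, hC⟩ := h
  obtain ⟨A, hA, htri⟩ := hd.quasi_triangle
  have he := Real.exp_pos 1
  have he1 := two_lt_exp_one
  have hd0 := hd.nonneg y₀ x₀
  set k := 1 + A + A * d y₀ x₀ with hk
  have hk1 : 1 ≤ k := by rw [hk]; nlinarith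
  refine ⟨L, C * (Real.log k + 1), fun x => ?_⟩
  have hdx := hd.nonneg x y₀
  have hdx' := hd.nonneg x x₀
  have hl := one_le_log_exp_one_add hdx
  have h1 := hC x
  rw [le_div_iff₀ (by linarith)] at h1
  have hlk := Real.log_nonneg hk1
  have h2 : Real.log (rad d x₀ x) ≤ (Real.log k + 1) * Real.log (Real.exp 1 + d x y₀) := by
    have h3 : rad d x₀ x ≤ k * (Real.exp 1 + d x y₀) := by
      have := htri x x₀ y₀
      unfold rad
      rw [hk]
      have hA0 : 0 ≤ A := by linarith
      nlinarith [mul_nonneg hA0 hd0, mul_nonneg hA0 hdx, mul_nonneg (mul_nonneg hA0 hd0) hdx]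
    have hrad : 0 < rad d x₀ x := by unfold rad; positivity
    calc _ ≤ Real.log (k * (Real.exp 1 + d x y₀)) := Real.log_le_log hrad h3
      _ = Real.log k + Real.log (Real.exp 1 + d x y₀) :=
          Real.log_mul (by positivity) (by positivity)
      _ ≤ _ := by nlinarith
  calc _ ≤ |p x - L| * ((Real.log k + 1) * Real.log (Real.exp 1 + d x y₀)) := by gcongr
    _ = (|p x - L| * Real.log (Real.exp 1 + d x y₀)) * (Real.log k + 1) := by ring
    _ ≤ _ := by gcongr

variable [MeasurableSpace X] {μ : Measure X}

/-- Log-Hölder exponents have limits at infinity that are limits of values at good points. -/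
lemma exists_limits {m : ℕ} (hX : IsHomogeneousType d μ) {p : Fin m → X → ℝ}
    (hp : ∀ i, LHinfty d (p i)) (x₀ : X) (hG : G.Nonempty) {a b : Fin m → ℝ}
    (hab : ∀ i, ∀ x ∈ G, a i ≤ p i x ∧ p i x ≤ b i) :
    ∃ (pinf K : Fin m → ℝ) (u : ℕ → X), (∀ n, u n ∈ G) ∧
      (∀ i, Filter.Tendsto (fun n => p i (u n)) Filter.atTop (nhds (pinf i))) ∧
      ∀ i, ∀ x ∈ G, |p i x - pinf i| * Real.log (rad d x₀ x) ≤ K i := by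
  have he := Real.exp_pos 1
  have hd := hX.quasiMetric.nonneg
  -- On a bounded `G` the decay condition has no content and the given limit may violate the bounds,
  -- so the value at a point replaces it. Otherwise points of `G` escape to infinity. One sequence
  -- serves all `i`, so bounds and relations between exponents pass to the limits.
  by_cases hbd : ∃ R : ℝ, ∀ x ∈ G, d x x₀ ≤ R
  · obtain ⟨R, hR⟩ := hbd
    obtain ⟨x₁, hx₁⟩ := hG
    refine ⟨fun i => p i x₁, fun i => (b i - a i) * Real.log (Real.exp 1 + R), fun _ => x₁,
      fun _ => hx₁, fun i => tendsto_const_nhds, fun i x hx => ?_⟩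
    have h1 : |p i x - p i x₁| ≤ b i - a i := by
      rw [abs_le]
      constructor <;> linarith [(hab i x hx).1, (hab i x hx).2, (hab i x₁ hx₁).1, (hab i x₁ hx₁).2]
    have h2 : Real.log (rad d x₀ x) ≤ Real.log (Real.exp 1 + R) := by
      have := hX.one_lt_rad x₀ x
      refine Real.log_le_log (by linarith) ?_
      unfold rad; linarith [hR x hx]
    have h3 := hX.one_le_log_rad x₀ x
    exact mul_le_mul h1 h2 (by linarith) ((abs_nonneg _).trans h1)
  · push Not at hbd
    choose u huG hu using fun n : ℕ => hbd n
    choose L K hLK using fun i => (hp i).exists_inf hX.quasiMetric x₀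
    refine ⟨L, K, u, huG, fun i => ?_, fun i x _ => hLK i x⟩
    rw [tendsto_iff_dist_tendsto_zero]
    have hlog : Filter.Tendsto (fun n : ℕ => K i / Real.log (n : ℝ)) Filter.atTop (nhds 0) :=
      (Real.tendsto_log_atTop.comp tendsto_natCast_atTop_atTop).const_div_atTop (K i)
    refine squeeze_zero' (Filter.Eventually.of_forall fun n => dist_nonneg) ?_ hlog
    filter_upwards [Filter.eventually_ge_atTop 2] with n hn
    have hn' : (2 : ℝ) ≤ n := by exact_mod_cast hn
    have hlogn : 0 < Real.log n := Real.log_pos (by linarith)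
    rw [Real.dist_eq, le_div_iff₀ hlogn]
    refine le_trans ?_ (hLK i (u n))
    gcongr
    unfold rad
    linarith [hu n]

/-- The exponents of the theorem are log-Hölder continuous on a set of full measure, together with
their conjugates and the target exponent. -/
lemma exists_logHolder_exponents {m : ℕ} (hX : IsHomogeneousType d μ) {p : Fin m → X → ℝ}
    {q : X → ℝ} {η : ℝ} (hp : ∀ i, LH d (p i) ∧ ExpP μ (p i)) (hq : ExpP0 μ q)
    (hpq : ∀ x, 1 / q x = ∑ i, 1 / p i x - η) (x₀ : X) :
    ∃ (G : Set X) (pinf a b K K' : Fin m → ℝ) (qinf aq bq Kq : ℝ), μ Gᶜ = 0 ∧ (∀ i, 1 < a i) ∧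
      (∀ i, IsLogHolderOn d x₀ G (p i) (a i) (b i) (K i) (pinf i)) ∧
      (∀ i, IsLogHolderOn d x₀ G (fun x => (p i x).conjExponent) 1 (a i).conjExponent (K' i)
        (pinf i).conjExponent) ∧
      IsLogHolderOn d x₀ G q aq bq Kq qinf ∧ 1 / qinf = ∑ i, 1 / pinf i - η := by
  have hd := hX.quasiMetric.nonneg
  choose a b ha hab using fun i => (hp i).2.exists_bounds
  obtain ⟨aq, bq, haq, haqb⟩ := hq.exists_bounds
  choose N hN hNeq using fun i => hX.exists_null_eq_of_dist_eq_zero (hp i).2.measurable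
  -- A set of full measure on which the essential bounds hold at every point and points at distance
  -- zero are not separated by the exponents.
  set G : Set X := {x | (∀ i, a i ≤ p i x ∧ p i x ≤ b i) ∧ (aq ≤ q x ∧ q x ≤ bq) ∧ ∀ i, x ∉ N i}
    with hG
  have hGae : ∀ᵐ x ∂μ, x ∈ G := by
    have h1 := ae_all_iff.2 hab
    have h2 : ∀ᵐ x ∂μ, ∀ i, x ∉ N i := ae_all_iff.2 fun i => measure_eq_zero_iff_ae_notMem.1 (hN i)
    filter_upwards [h1, haqb, h2] with x hx1 hx2 hx3 using ⟨hx1, hx2, hx3⟩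
  have hGne : G.Nonempty := by
    by_contra! h
    have h1 := hX.measure_qball_pos x₀ one_pos
    have h2 : μ Gᶜ = 0 := hGae
    rw [h, Set.compl_empty] at h2
    exact absurd (measure_mono_null (Set.subset_univ _) h2) h1.ne'
  obtain ⟨pinf, K₁, u, huG, hu, hinf⟩ := exists_limits hX (fun i => (hp i).1.2) x₀ hGne
    (fun i x hx => hx.1 i)
  choose K₂ hK₂ hloc using fun i => LH0.exists_loc (G := G) (hp i).1.1 hd
    (fun x hx => hx.1 i) (fun x hx y hy h => hNeq i x (hx.2.2 i) y (hy.2.2 i) h)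
  have hpinf : ∀ i, a i ≤ pinf i ∧ pinf i ≤ b i := fun i =>
    ⟨ge_of_tendsto' (hu i) fun n => ((huG n).1 i).1, le_of_tendsto' (hu i) fun n => ((huG n).1 i).2⟩
  have hlh : ∀ i, IsLogHolderOn d x₀ G (p i) (a i) (b i) (max (K₁ i) (K₂ i)) (pinf i) := fun i =>
    { pos := by linarith [ha i]
      mem := fun x hx => hx.1 i
      mem_inf := hpinf i
      loc := fun x hx y hy r hr h => (hloc i x hx y hy r hr h).trans (le_max_right _ _)
      inf := fun x hx => (hinf i x hx).trans (le_max_left _ _) }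
  have hpinf0 : ∀ i, 1 < pinf i := fun i => (ha i).trans_le (hpinf i).1
  have hp1 : ∀ i, ∀ x ∈ G, 1 < p i x := fun i x hx => (ha i).trans_le (hx.1 i).1
  have habs : ∀ s t : ℝ, 1 < s → 1 < t → |1 / s - 1 / t| ≤ |s - t| := by
    intro s t hs ht
    have e : 1 / s - 1 / t = (1 / (s * t)) * (t - s) := by field_simp
    rw [e, abs_mul, abs_of_pos (by positivity), abs_sub_comm]
    refine mul_le_of_le_one_left (abs_nonneg _) ?_
    rw [div_le_one (by positivity)]
    nlinarith
  -- The limit exponent of `q` is defined through the relation between the exponents. As a limit of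
  -- values `1 / q (u n)`, the number `v` inherits their bounds and is positive.
  set v : ℝ := ∑ i, 1 / pinf i - η with hv
  have hvlim : Filter.Tendsto (fun n => 1 / q (u n)) Filter.atTop (nhds v) := by
    simp_rw [hpq]
    refine (tendsto_finsetSum _ fun i _ => ?_).sub_const η
    exact tendsto_const_nhds.div (hu i) (by linarith [hpinf0 i])
  have hbq : 0 < bq := by obtain ⟨x, hx⟩ := hGne; linarith [hx.2.1.1, hx.2.1.2]
  have hv1 : 1 / bq ≤ v := ge_of_tendsto' hvlim fun n =>
    one_div_le_one_div_of_le (haq.trans_le (huG n).2.1.1) (huG n).2.1.2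
  have hv2 : v ≤ 1 / aq := le_of_tendsto' hvlim fun n =>
    one_div_le_one_div_of_le haq (huG n).2.1.1
  have hv0 : 0 < v := lt_of_lt_of_le (by positivity) hv1
  -- Since `q` is bounded, it is a Lipschitz function of `1 / q`, hence of the `p i`.
  have hqdiff : ∀ s t : ℝ, 0 < s → s ≤ bq → 0 < t → t ≤ bq →
      |s - t| ≤ bq ^ 2 * |1 / s - 1 / t| := by
    intro s t hs hsb ht htb
    have e : s - t = (s * t) * (1 / t - 1 / s) := by field_simp
    rw [e, abs_mul, abs_of_pos (by positivity), abs_sub_comm (1 / t)]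
    gcongr
    rw [sq]; gcongr
  have hinvb : 1 / v ≤ bq := by
    rw [div_le_iff₀ hv0]; rwa [div_le_iff₀ hbq, mul_comm] at hv1
  have hsum : ∀ s t : Fin m → ℝ, (∀ i, 1 < s i) → (∀ i, 1 < t i) →
      |(∑ i, 1 / s i - η) - (∑ i, 1 / t i - η)| ≤ ∑ i, |s i - t i| := by
    intro s t hs ht
    rw [sub_sub_sub_cancel_right, ← Finset.sum_sub_distrib]
    exact (Finset.abs_sum_le_sum_abs _ _).trans
      (Finset.sum_le_sum fun i _ => habs _ _ (hs i) (ht i))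
  refine ⟨G, pinf, a, b, _, fun i => 1 / (a i - 1) ^ 2 * ∑ _j : Unit, max (K₁ i) (K₂ i), 1 / v, aq,
    bq, bq ^ 2 * ∑ i, max (K₁ i) (K₂ i), hGae, ha, hlh, fun i => ?_, ?_, by rw [one_div_one_div]⟩
  · refine IsLogHolderOn.comp (ι := Unit) (p := fun _ => p i) (fun _ => hlh i) hd
      (by have := ha i; positivity) one_pos (fun x hx => conjExponent_mem (ha i) (hx.1 i))
      (conjExponent_mem (ha i) (hpinf i)) ?_ ?_
    · intro x hx y hy
      simpa using abs_conjExponent_sub_le (ha i) (hx.1 i).1 (hy.1 i).1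
    · intro x hx
      simpa using abs_conjExponent_sub_le (ha i) (hx.1 i).1 (hpinf i).1
  · refine IsLogHolderOn.comp hlh hd (by positivity) haq (fun x hx => hx.2.1)
      ⟨?_, hinvb⟩ ?_ ?_
    · rw [le_div_iff₀ hv0]; rwa [le_div_iff₀ haq, mul_comm] at hv2
    · intro x hx y hy
      refine (hqdiff _ _ (haq.trans_le hx.2.1.1) hx.2.1.2 (haq.trans_le hy.2.1.1) hy.2.1.2).trans ?_
      gcongr
      rw [hpq, hpq]
      exact hsum _ _ (fun i => hp1 i x hx) fun i => hp1 i y hy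
    · intro x hx
      refine (hqdiff _ _ (haq.trans_le hx.2.1.1) hx.2.1.2 (by positivity) hinvb).trans ?_
      gcongr
      rw [hpq, one_div_one_div]
      exact hsum _ _ (fun i => hp1 i x hx) hpinf0

end HomType

/-! ### Lower bounds for densities from their geometric mean. -/

namespace HomType

variable {X : Type*} [MeasurableSpace X] {μ : Measure X}

/-- If a weighted geometric mean of densities with integral at most one is bounded from below on
`B`, then each density charges the subsets of `B` at least as a power of the relative measure. -/
lemma ofReal_le_lintegral_of_le_prod {ι : Type*} [Fintype ι] {B E : Set X} (hBm : MeasurableSet B)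
    (hB0 : μ B ≠ 0) (hBt : μ B ≠ ∞) (hE : E ⊆ B) (hEm : MeasurableSet E)
    {u : ι → X → ℝ≥0∞} (hu : ∀ j, Measurable (u j)) (h_int : ∀ j, ∫⁻ x in B, u j x ∂μ ≤ 1)
    {θ : ι → X → ℝ} {θ₀ k : ℝ} (hθ₀ : 0 < θ₀) (hk : 0 < k) (hk1 : k ≤ 1)
    (h : ∀ᵐ x ∂μ, x ∈ B → (∀ j, θ₀ ≤ θ j x) ∧ ∑ j, θ j x = 1 ∧
      ENNReal.ofReal k ≤ ∏ j, (μ B * u j x) ^ θ j x) (i : ι) :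
    ENNReal.ofReal (1 / 2 * (k / (2 * Fintype.card ι)) ^ (1 / θ₀) *
      (μ.real E / μ.real B) ^ (1 + 1 / θ₀)) ≤ ∫⁻ x in E, u i x ∂μ := by
  classical
  have hN : 1 ≤ Fintype.card ι := Fintype.card_pos_iff.2 ⟨i⟩
  have hN' : (1 : ℝ) ≤ Fintype.card ι := by exact_mod_cast hN
  have hEt : μ E ≠ ∞ := ((measure_mono hE).trans_lt hBt.lt_top).ne
  have hBr : 0 < μ.real B := ENNReal.toReal_pos hB0 hBt
  set κ := μ.real E / μ.real B with hκ
  have hκ1 : κ ≤ 1 := (div_le_one hBr).2 (measureReal_mono hE hBt)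
  have hκ0 : 0 ≤ κ := div_nonneg measureReal_nonneg hBr.le
  rcases hκ0.eq_or_lt with h0 | hκpos
  · rw [← h0, Real.zero_rpow (by positivity)]; simp
  -- By Chebyshev's inequality each density exceeds `Λ / μ(B)` on a set of measure at most `μ(E) /
  -- (2 card ι)`, so half of `E` avoids all these sets. There the other factors together are at most
  -- `Λ`, and the lower bound for the product forces `μ(B) u i ≥ (k / Λ) ^ (1 / θ₀)`.
  set Λ : ℝ := 2 * Fintype.card ι / κ with hΛ
  have hΛ1 : 1 ≤ Λ := by rw [hΛ, le_div_iff₀ hκpos]; linarith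
  have hΛ0 : 0 < Λ := by linarith
  have hΛe1 : 1 ≤ ENNReal.ofReal Λ := ENNReal.one_le_ofReal.2 hΛ1
  set F : ι → Set X := fun j => B ∩ {x | ENNReal.ofReal Λ / μ B ≤ u j x} with hF
  have hFm : ∀ j, MeasurableSet (F j) := fun j => hBm.inter (measurableSet_le measurable_const (hu j))
  have hFμ : ∀ j, μ.real (F j) ≤ μ.real E / (2 * Fintype.card ι) := by
    intro j
    have h1 : ENNReal.ofReal Λ / μ B * μ (F j) ≤ 1 := by
      refine le_trans ?_ ((mul_meas_ge_le_lintegral (μ := μ.restrict B) (hu j)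
        (ENNReal.ofReal Λ / μ B)).trans (h_int j))
      rw [Measure.restrict_apply (measurableSet_le measurable_const (hu j)), Set.inter_comm]
    have h2 : Λ / μ.real B * μ.real (F j) ≤ 1 := by
      have := ENNReal.toReal_mono ENNReal.one_ne_top h1
      rwa [ENNReal.toReal_mul, ENNReal.toReal_div, ENNReal.toReal_ofReal hΛ0.le,
        ENNReal.toReal_one] at this
    have hEpos : 0 < μ.real E := by
      rcases (measureReal_nonneg (μ := μ) (s := E)).eq_or_lt with h | h
      · rw [hκ, ← h] at hκpos; simp at hκpos
      · exact h
    rw [hΛ, hκ] at h2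
    rw [le_div_iff₀ (by positivity)]
    have e : 2 * (Fintype.card ι : ℝ) / (μ.real E / μ.real B) / μ.real B * μ.real (F j) =
        μ.real (F j) * (2 * Fintype.card ι) / μ.real E := by field_simp
    rw [e, div_le_one hEpos] at h2
    exact h2
  set E' := E \ ⋃ j, F j with hE'
  have hE'm : MeasurableSet E' := hEm.diff (MeasurableSet.iUnion hFm)
  have hE'μ : μ.real E / 2 ≤ μ.real E' := by
    have h1 : μ.real E ≤ μ.real E' + μ.real (⋃ j, F j) := by
      refine le_trans (measureReal_mono (fun x hx => ?_) ?_) (measureReal_union_le _ _)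
      · by_cases hx' : x ∈ ⋃ j, F j
        · exact Or.inr hx'
        · exact Or.inl ⟨hx, hx'⟩
      · refine ((measure_mono (Set.union_subset (Set.sdiff_subset.trans hE)
          (Set.iUnion_subset fun j => Set.inter_subset_left))).trans_lt hBt.lt_top).ne
    have h2 : μ.real (⋃ j, F j) ≤ μ.real E / 2 := by
      calc _ ≤ ∑ j, μ.real (F j) := measureReal_iUnion_fintype_le _
        _ ≤ ∑ _j : ι, μ.real E / (2 * Fintype.card ι) := Finset.sum_le_sum fun j _ => hFμ j
        _ = _ := by
            rw [Finset.sum_const, Finset.card_univ, nsmul_eq_mul]; field_simp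
    linarith
  have hkΛ : 0 < k / Λ := by positivity
  have hkΛ1 : k / Λ ≤ 1 := (div_le_one hΛ0).2 (hk1.trans hΛ1)
  have hpt : ∀ᵐ x ∂μ, x ∈ E' → ENNReal.ofReal ((k / Λ) ^ (1 / θ₀)) / μ B ≤ u i x := by
    filter_upwards [h] with x hx hxE
    have hxB := hE hxE.1
    obtain ⟨h1, h2, h3⟩ := hx hxB
    have hle : ∀ j, μ B * u j x ≤ ENNReal.ofReal Λ := by
      intro j
      have hj : x ∉ F j := fun hj => hxE.2 (Set.mem_iUnion.2 ⟨j, hj⟩)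
      have : ¬ ENNReal.ofReal Λ / μ B ≤ u j x := fun hj' => hj ⟨hxB, hj'⟩
      rw [not_le] at this
      rw [mul_comm]
      exact (ENNReal.le_div_iff_mul_le (Or.inl hB0) (Or.inl hBt)).1 this.le
    have hθpos : ∀ j, 0 < θ j x := fun j => hθ₀.trans_le (h1 j)
    have h4 : ENNReal.ofReal k ≤ (μ B * u i x) ^ θ i x * ENNReal.ofReal Λ := by
      refine h3.trans ?_
      rw [← Finset.mul_prod_erase _ _ (Finset.mem_univ i)]
      gcongr
      calc _ ≤ ∏ j ∈ Finset.univ.erase i, ENNReal.ofReal Λ ^ θ j x :=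
            Finset.prod_le_prod' fun j _ => ENNReal.rpow_le_rpow (hle j) (hθpos j).le
        _ ≤ ∏ j, ENNReal.ofReal Λ ^ θ j x :=
            Finset.prod_le_prod_of_subset_of_one_le' (Finset.erase_subset _ _)
              fun j _ _ => ENNReal.one_le_rpow hΛe1 (hθpos j)
        _ = ENNReal.ofReal Λ ^ ∑ j, max 0 (θ j x) := by
            rw [← ennreal_rpow_sum _ _ fun j => le_max_left _ _]
            exact Finset.prod_congr rfl fun j _ => by rw [max_eq_right (hθpos j).le]
        _ = ENNReal.ofReal Λ := by
            simp_rw [max_eq_right (hθpos _).le]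
            rw [h2, ENNReal.rpow_one]
    have h5 : ENNReal.ofReal (k / Λ) ≤ (μ B * u i x) ^ θ i x := by
      rw [ENNReal.ofReal_div_of_pos hΛ0]
      exact ENNReal.div_le_of_le_mul h4
    rw [ENNReal.div_le_iff hB0 hBt, mul_comm]
    calc ENNReal.ofReal ((k / Λ) ^ (1 / θ₀)) ≤ ENNReal.ofReal ((k / Λ) ^ (1 / θ i x)) :=
          ENNReal.ofReal_le_ofReal (Real.rpow_le_rpow_of_exponent_ge hkΛ hkΛ1
            (one_div_le_one_div_of_le hθ₀ (h1 i)))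
      _ = ENNReal.ofReal (k / Λ) ^ (1 / θ i x) := (ENNReal.ofReal_rpow_of_pos hkΛ).symm
      _ ≤ ((μ B * u i x) ^ θ i x) ^ (1 / θ i x) :=
          ENNReal.rpow_le_rpow h5 (one_div_pos.2 (hθpos i)).le
      _ = μ B * u i x := by
          rw [← ENNReal.rpow_mul, mul_one_div_cancel (hθpos i).ne', ENNReal.rpow_one]
  calc ENNReal.ofReal (1 / 2 * (k / (2 * Fintype.card ι)) ^ (1 / θ₀) * κ ^ (1 + 1 / θ₀))
      = ENNReal.ofReal ((k / Λ) ^ (1 / θ₀) / μ.real B * (μ.real E / 2)) := by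
        congr 1
        have e1 : k / Λ = k / (2 * Fintype.card ι) * κ := by rw [hΛ]; field_simp
        rw [e1, Real.mul_rpow (by positivity) hκ0, Real.rpow_add hκpos, Real.rpow_one]
        have e2 : μ.real E = κ * μ.real B := by rw [hκ]; field_simp
        rw [e2]; field_simp
    _ ≤ ENNReal.ofReal ((k / Λ) ^ (1 / θ₀) / μ.real B * μ.real E') := by gcongr
    _ = ENNReal.ofReal ((k / Λ) ^ (1 / θ₀)) / μ B * μ E' := by
        rw [ENNReal.ofReal_mul (by positivity), ENNReal.ofReal_div_of_pos hBr,
          ofReal_measureReal hBt,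
          ofReal_measureReal ((measure_mono Set.sdiff_subset).trans_lt hEt.lt_top).ne]
    _ = ∫⁻ _x in E', ENNReal.ofReal ((k / Λ) ^ (1 / θ₀)) / μ B ∂μ := (setLIntegral_const _ _).symm
    _ ≤ ∫⁻ x in E', u i x ∂μ :=
        lintegral_mono_ae ((ae_restrict_iff' hE'm).2 hpt)
    _ ≤ _ := lintegral_mono_set Set.sdiff_subset

end HomType

/-! ### Normalized densities and the weight condition. -/

namespace HomType

variable {X : Type*} [MeasurableSpace X] {d : X → X → ℝ} {μ : Measure X} {x₀ : X} {G : Set X}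

lemma setLIntegral_rpow_div_lux {ρ : X → ℝ} {v : X → ℝ≥0∞} {a b : ℝ} {B : Set X}
    (hρ : Measurable ρ) (hρ0 : ∀ x, 0 ≤ ρ x) (ha : 0 < a) (hρab : ∀ᵐ x ∂μ, a ≤ ρ x ∧ ρ x ≤ b)
    (hv : Measurable v) (hB : MeasurableSet B) (h0 : lux μ ρ (B.indicator v) ≠ 0)
    (htop : lux μ ρ (B.indicator v) ≠ ∞) :
    ∫⁻ x in B, (v x / lux μ ρ (B.indicator v)) ^ ρ x ∂μ = 1 := by
  rw [← lintegral_rpow_div_lux hρ hρ0 ha hρab (hv.indicator hB) h0 htop, ← lintegral_indicator hB]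
  refine lintegral_congr_ae ?_
  filter_upwards [hρab] with x hx
  by_cases hxB : x ∈ B
  · simp [hxB]
  · simp [hxB, ha.trans_le hx.1]

lemma setLIntegral_withDensity_rpow {ρ : X → ℝ} {v : X → ℝ≥0∞} (hρ : Measurable ρ)
    (hρ0 : ∀ x, 0 ≤ ρ x) (hv : Measurable v) {n : ℝ≥0∞} (hn0 : n ≠ 0) (hn : n ≠ ∞) {E : Set X}
    (hE : MeasurableSet E) :
    ∫⁻ y in E, ENNReal.ofReal (n.toReal ^ (-ρ y)) ∂μ.withDensity (fun x => v x ^ ρ x) =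
      ∫⁻ y in E, (v y / n) ^ ρ y ∂μ := by
  have hm : Measurable fun y => ENNReal.ofReal (n.toReal ^ (-ρ y)) := by fun_prop
  rw [restrict_withDensity hE, lintegral_withDensity_eq_lintegral_mul _ (hv.pow hρ) hm]
  refine lintegral_congr fun y => ?_
  rw [Pi.mul_apply, ← ENNReal.ofReal_rpow_of_pos (ENNReal.toReal_pos hn0 hn),
    ENNReal.ofReal_toReal hn, ENNReal.div_rpow_of_nonneg _ _ (hρ0 y), ENNReal.rpow_neg,
    div_eq_mul_inv]

/-- The pair of the measure `v ^ ρ μ` and the exponent `ρ`. -/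
noncomputable def WeightPair.ofDensity {ρ : X → ℝ} {v : X → ℝ≥0∞} {a b K ρinf c D : ℝ}
    (hX : IsHomogeneousType d μ) (hρ : Measurable ρ) (hρ0 : ∀ x, 0 ≤ ρ x) (hv : Measurable v)
    (lh : IsLogHolderOn d x₀ G ρ a b K ρinf) (hG : μ Gᶜ = 0)
    (h0 : ∀ x r, 0 < r → lux μ ρ ((qball d x r).indicator v) ≠ 0)
    (htop : ∀ x r, 0 < r → lux μ ρ ((qball d x r).indicator v) ≠ ∞) (hc : 0 < c) (hD : 0 ≤ D)
    (lower : ∀ x r, 0 < r → ∀ E ⊆ qball d x r, MeasurableSet E →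
      ENNReal.ofReal (c * (μ.real E / μ.real (qball d x r)) ^ D) ≤
        ∫⁻ y in E, (v y / lux μ ρ ((qball d x r).indicator v)) ^ ρ y ∂μ) :
    WeightPair d μ x₀ G where
  σ := μ.withDensity fun x => v x ^ ρ x
  ρ := ρ
  n x r := (lux μ ρ ((qball d x r).indicator v)).toReal
  a := a
  b := b
  K := K
  ρinf := ρinf
  c := c
  D := D
  measurable := hρ
  null := withDensity_absolutelyContinuous _ _ hG
  lh := lh
  n_pos x r hr := ENNReal.toReal_pos (h0 x r hr) (htop x r hr)
  modular_eq x r hr := by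
    have hB := hX.measurableSet_qball x hr
    rw [setLIntegral_withDensity_rpow hρ hρ0 hv (h0 x r hr) (htop x r hr) hB]
    have hGae : ∀ᵐ x ∂μ, x ∈ G := hG
    exact setLIntegral_rpow_div_lux hρ hρ0 lh.pos (hGae.mono lh.mem) hv hB (h0 x r hr) (htop x r hr)
  c_pos := hc
  D_nonneg := hD
  lower x r hr E hE hEm := by
    rw [setLIntegral_withDensity_rpow hρ hρ0 hv (h0 x r hr) (htop x r hr) hEm]
    exact lower x r hr E hE hEm

/-- The dual form of the `A_{p, q}` condition: a lower bound for the geometric mean of the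
normalized weights. -/
lemma ofReal_le_prod_of_norms_le {m : ℕ} {s K : ℝ} (hs : 0 < s) (hK : 0 < K) {β N : ℝ≥0∞}
    {n : Fin m → ℝ≥0∞} {w : Fin m → ℝ≥0∞} (hβ0 : β ≠ 0) (hβt : β ≠ ∞) (hN0 : N ≠ 0) (hNt : N ≠ ∞)
    (hn0 : ∀ i, n i ≠ 0) (hnt : ∀ i, n i ≠ ∞) (hw0 : ∀ i, w i ≠ 0) (hwt : ∀ i, w i ≠ ∞)
    (h : N * ∏ i, n i ≤ ENNReal.ofReal K * β ^ s) {q : ℝ} {p' : Fin m → ℝ} (hq : 0 < q)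
    (hp' : ∀ i, 0 < p' i) (hsum : 1 / q + ∑ i, 1 / p' i = s) :
    ENNReal.ofReal (K ^ (-(1 / s))) ≤
      (β * ((∏ i, w i) / N) ^ q) ^ (1 / (s * q)) *
        ∏ i, (β * ((w i)⁻¹ / n i) ^ p' i) ^ (1 / (s * p' i)) := by
  have hterm : ∀ (t : ℝ≥0∞) (e : ℝ), 0 < e →
      (β * t ^ e) ^ (1 / (s * e)) = β ^ (1 / (s * e)) * t ^ (1 / s) := by
    intro t e he
    rw [ENNReal.mul_rpow_of_nonneg _ _ (by positivity), ← ENNReal.rpow_mul]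
    congr 2; field_simp
  have hs1 : (0 : ℝ) ≤ 1 / s := by positivity
  have hnp0 : ∏ i, n i ≠ 0 := Finset.prod_ne_zero_iff.2 fun i _ => hn0 i
  have hnpt : ∏ i, n i ≠ ∞ := ENNReal.prod_ne_top fun i _ => hnt i
  have hwp0 : ∏ i, w i ≠ 0 := Finset.prod_ne_zero_iff.2 fun i _ => hw0 i
  have hwpt : ∏ i, w i ≠ ∞ := ENNReal.prod_ne_top fun i _ => hwt i
  have hinv : ∀ u : Fin m → ℝ≥0∞, (∀ i, u i ≠ 0) → (∀ i, u i ≠ ∞) →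
      ∏ i, (u i)⁻¹ = (∏ i, u i)⁻¹ := by
    intro u hu0 hut
    exact (ENNReal.prod_inv_distrib fun i _ j _ _ => Or.inl (hu0 i)).symm
  -- The exponents of the geometric mean sum to one, so the powers of `β` combine to `β`. The
  -- weights cancel between their product and the inverses, leaving only the norms.
  have hexp : β ^ (1 / (s * q)) * ∏ i, β ^ (1 / (s * p' i)) = β := by
    rw [ennreal_rpow_sum _ _ fun i => by have := hp' i; positivity,
      ← ENNReal.rpow_add_of_nonneg _ _ (by positivity)
        (Finset.sum_nonneg fun i _ => by have := hp' i; positivity)]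
    have : 1 / (s * q) + ∑ i, 1 / (s * p' i) = 1 := by
      simp_rw [← one_div_mul_one_div]
      rw [← Finset.mul_sum, ← mul_add, hsum]; field_simp
    rw [this, ENNReal.rpow_one]
  calc ENNReal.ofReal (K ^ (-(1 / s)))
      = β * (ENNReal.ofReal K * β ^ s)⁻¹ ^ (1 / s) := by
        rw [ENNReal.inv_rpow, ENNReal.mul_rpow_of_nonneg _ _ hs1, ← ENNReal.rpow_mul,
          mul_one_div_cancel hs.ne', ENNReal.rpow_one,
          ENNReal.mul_inv (Or.inr hβt) (Or.inr hβ0), ← ENNReal.rpow_neg,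
          ENNReal.ofReal_rpow_of_pos hK, mul_left_comm, ENNReal.mul_inv_cancel hβ0 hβt, mul_one]
    _ ≤ β * (N * ∏ i, n i)⁻¹ ^ (1 / s) := by
        gcongr
    _ = β * (((∏ i, w i) / N) * ∏ i, ((w i)⁻¹ / n i)) ^ (1 / s) := by
        congr 2
        simp_rw [div_eq_mul_inv]
        rw [Finset.prod_mul_distrib, hinv w hw0 hwt, hinv n hn0 hnt,
          ENNReal.mul_inv (Or.inl hN0) (Or.inl hNt), mul_mul_mul_comm,
          ENNReal.mul_inv_cancel hwp0 hwpt, one_mul]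
    _ = (β ^ (1 / (s * q)) * ∏ i, β ^ (1 / (s * p' i))) *
          (((∏ i, w i) / N) ^ (1 / s) * ∏ i, ((w i)⁻¹ / n i) ^ (1 / s)) := by
        rw [hexp, ENNReal.mul_rpow_of_nonneg _ _ hs1, ENNReal.prod_rpow_of_nonneg hs1]
    _ = _ := by
        rw [hterm _ _ hq, Finset.prod_congr rfl fun i _ => hterm _ _ (hp' i),
          Finset.prod_mul_distrib]
        ring

end HomType

/-! ### The weight pairs of a multiple weight. -/

namespace HomType

variable {X : Type*} [MeasurableSpace X] {d : X → X → ℝ} {μ : Measure X}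

lemma one_div_conjExponent {t : ℝ} (ht : 1 < t) : 1 / t.conjExponent = 1 - 1 / t := by
  have : t - 1 ≠ 0 := by linarith
  rw [Real.conjExponent]; field_simp

/-- The norms in the `A_{p, q}` condition. -/
lemma norms_of_apqConst_lt_top {m : ℕ} (hX : IsHomogeneousType d μ) {p : Fin m → X → ℝ}
    (hp : ∀ i, ExpP μ (p i)) {q : X → ℝ} (hq : ExpP0 μ q) {η : ℝ} {ω : Fin m → X → ℝ≥0∞}
    (hω : ∀ i, IsWeight d μ (ω i)) (hA : apqConst d μ η p q ω < ∞) (c : X) {r : ℝ} (hr : 0 < r) :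
    lux μ q ((qball d c r).indicator fun x => ∏ i, ω i x) ≠ 0 ∧
    lux μ q ((qball d c r).indicator fun x => ∏ i, ω i x) ≠ ∞ ∧
    (∀ i, lux μ (fun x => (p i x).conjExponent) ((qball d c r).indicator fun x => (ω i x)⁻¹) ≠ 0) ∧
    (∀ i, lux μ (fun x => (p i x).conjExponent) ((qball d c r).indicator fun x => (ω i x)⁻¹) ≠ ∞) ∧
    μ (qball d c r) ^ (η - m) * lux μ q ((qball d c r).indicator fun x => ∏ i, ω i x) *
      ∏ i, lux μ (fun x => (p i x).conjExponent) ((qball d c r).indicator fun x => (ω i x)⁻¹) ≤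
      apqConst d μ η p q ω := by
  have hle : μ (qball d c r) ^ (η - m) *
      lux μ q ((qball d c r).indicator fun x => ∏ i, ω i x) *
      ∏ i, lux μ (fun x => (p i x).conjExponent) ((qball d c r).indicator fun x => (ω i x)⁻¹) ≤
      apqConst d μ η p q ω :=
    le_iSup_of_le c (le_iSup_of_le r (le_iSup_of_le hr le_rfl))
  set N := lux μ q ((qball d c r).indicator fun x => ∏ i, ω i x) with hN
  set n : Fin m → ℝ≥0∞ := fun i =>
    lux μ (fun x => (p i x).conjExponent) ((qball d c r).indicator fun x => (ω i x)⁻¹) with hn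
  have hμ0 : μ (qball d c r) ≠ 0 := (hX.measure_qball_pos c hr).ne'
  have hμt : μ (qball d c r) ≠ ∞ := (hX.measure_qball_lt_top c r).ne
  have hb0 : μ (qball d c r) ^ (η - m) ≠ 0 := by
    simp [ENNReal.rpow_eq_zero_iff, hμ0, hμt]
  have hN0 : N ≠ 0 := by
    obtain ⟨a, b, ha, hab⟩ := hq.exists_bounds
    refine lux_indicator_pos hX hq.measurable hq.nonneg ha (hab.mono fun x hx => hx.1)
      (Finset.measurable_fun_prod _ fun i _ => (hω i).measurable) ?_ c hr
    filter_upwards [ae_all_iff.2 fun i => (hω i).pos] with x hx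
    exact pos_iff_ne_zero.2 (Finset.prod_ne_zero_iff.2 fun i _ => (hx i).ne')
  have hn0 : ∀ i, n i ≠ 0 := by
    intro i
    obtain ⟨a, b, ha, hab⟩ := (hp i).exists_bounds
    refine lux_indicator_pos hX (hp i).measurable_conjExponent (hp i).conjExponent_nonneg one_pos ?_
      (hω i).measurable.inv ?_ c hr
    · filter_upwards [hab] with x hx using (conjExponent_mem ha hx).1
    · filter_upwards [(hω i).lt_top] with x hx using ENNReal.inv_pos.2 hx.ne
  have hnp0 : ∏ i, n i ≠ 0 := Finset.prod_ne_zero_iff.2 fun i _ => hn0 i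
  have hfin : μ (qball d c r) ^ (η - m) * N * ∏ i, n i ≠ ∞ := (hle.trans_lt hA).ne
  -- No factor vanishes, so finiteness of the product makes every factor finite.
  refine ⟨hN0, fun h => hfin ?_, hn0, fun i h => hfin ?_, hle⟩
  · rw [h, ENNReal.mul_top hb0, ENNReal.top_mul hnp0]
  · rw [← Finset.mul_prod_erase _ _ (Finset.mem_univ i)]
    change _ * (n i * _) = _
    rw [show n i = ∞ from h, ENNReal.top_mul, ENNReal.mul_top (mul_ne_zero hb0 hN0)]
    exact Finset.prod_ne_zero_iff.2 fun j _ => hn0 j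

/-- The weight pairs of a multiple weight in the class `A_{p, q}`. -/
lemma exists_multiWeight {m : ℕ} (hX : IsHomogeneousType d μ) {p : Fin m → X → ℝ}
    {q : X → ℝ} {η : ℝ} (hp : ∀ i, LH d (p i) ∧ ExpP μ (p i)) (hq : ExpP0 μ q)
    (hpq : ∀ x, 1 / q x = ∑ i, 1 / p i x - η) (hη : 0 ≤ η) (hηm : η < m) {ω : Fin m → X → ℝ≥0∞}
    (hω : ∀ i, IsWeight d μ (ω i)) (hA : apqConst d μ η p q ω < ∞) :
    ∃ (x₀ : X) (G : Set X) (W : WeightPair d μ x₀ G) (P : Fin m → WeightPair d μ x₀ G)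
      (pinf : Fin m → ℝ) (M : ℝ), MultiWeight W P p pinf M ∧ μ Gᶜ = 0 ∧ W.ρ = q ∧
      W.σ = μ.withDensity (fun x => (∏ i, ω i x) ^ q x) ∧
      (∀ i, (P i).σ = μ.withDensity (fun x => (ω i x)⁻¹ ^ (p i x).conjExponent)) ∧
      (∀ x r, 0 < r → ENNReal.ofReal (W.n x r) =
        lux μ q ((qball d x r).indicator fun x => ∏ i, ω i x)) ∧
      ∀ i x r, 0 < r → ENNReal.ofReal ((P i).n x r) =
        lux μ (fun x => (p i x).conjExponent) ((qball d x r).indicator fun x => (ω i x)⁻¹) := by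
  obtain ⟨x₀⟩ := hX.nonempty
  obtain ⟨G, pinf, a, b, K, K', qinf, aq, bq, Kq, hG, ha, hlh, hlh', hlhq, hqinf⟩ :=
    exists_logHolder_exponents hX hp hq hpq x₀
  have hGae : ∀ᵐ x ∂μ, x ∈ G := hG
  set s : ℝ := m - η with hs
  have hs0 : 0 < s := by rw [hs]; linarith
  have hp1 : ∀ i, ∀ x ∈ G, 1 < p i x := fun i x hx => (ha i).trans_le ((hlh i).mem x hx).1
  have hpinf1 : ∀ i, 1 < pinf i := fun i => (ha i).trans_le (hlh i).mem_inf.1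
  have hq0 : ∀ x ∈ G, 0 < q x := fun x hx => hlhq.pos.trans_le (hlhq.mem x hx).1
  have hqinf0 : 0 < qinf := hlhq.pos.trans_le hlhq.mem_inf.1
  have hbq : 0 < bq := hqinf0.trans_le hlhq.mem_inf.2
  set β := bq + ∑ i, (a i).conjExponent with hβ
  have hac : ∀ i, 0 < (a i).conjExponent := fun i =>
    one_pos.trans_le (((hlh' i).mem_inf.1).trans (hlh' i).mem_inf.2)
  have hβq : bq ≤ β := le_add_of_nonneg_right (Finset.sum_nonneg fun i _ => (hac i).le)
  have hβa : ∀ i, (a i).conjExponent ≤ β := fun i =>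
    (Finset.single_le_sum (f := fun i => (a i).conjExponent) (fun j _ => (hac j).le)
      (Finset.mem_univ i)).trans (le_add_of_nonneg_left hbq.le)
  have hβ0 : 0 < β := hbq.trans_le hβq
  -- The geometric mean has the exponents `1 / (s q)` and `1 / (s p_i')`; as `β` bounds `q` and all
  -- `p_i'` on `G`, each is at least `θ₀`.
  set θ₀ : ℝ := 1 / (s * β) with hθ₀
  have hθ₀pos : 0 < θ₀ := by positivity
  set Ka : ℝ := max 1 (apqConst d μ η p q ω).toReal with hKa
  have hKa1 : 1 ≤ Ka := le_max_left _ _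
  have hAK : apqConst d μ η p q ω ≤ ENNReal.ofReal Ka :=
    ENNReal.le_ofReal_iff_toReal_le hA.ne (by positivity) |>.2 (le_max_right _ _)
  set k : ℝ := Ka ^ (-(1 / s)) with hk
  have hk0 : 0 < k := by positivity
  have hk1 : k ≤ 1 := Real.rpow_le_one_of_one_le_of_nonpos hKa1 (by
    have : 0 < 1 / s := by positivity
    linarith)
  have hωm : ∀ i, Measurable (ω i) := fun i => (hω i).measurable
  have hwm : Measurable fun x => ∏ i, ω i x := Finset.measurable_fun_prod _ fun i _ => hωm i
  have hnorm := fun c r (hr : 0 < r) =>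
    norms_of_apqConst_lt_top hX (fun i => (hp i).2) hq hω hA c hr
  have hp'm := fun i => (hp i).2.measurable_conjExponent
  have hp'0 := fun i => (hp i).2.conjExponent_nonneg
  set c₀ : ℝ := 1 / 2 * (k / (2 * Fintype.card (Option (Fin m)))) ^ (1 / θ₀) with hc₀
  have hc₀pos : 0 < c₀ := by
    have : 0 < Fintype.card (Option (Fin m)) := Fintype.card_pos
    positivity
  have hD : 0 ≤ 1 + 1 / θ₀ := by positivity
  -- The `m + 1` normalized densities, with `none` standing for the product weight.
  set u : X → ℝ → Option (Fin m) → X → ℝ≥0∞ := fun c r j => match j with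
    | none => fun x =>
      ((∏ i, ω i x) / lux μ q ((qball d c r).indicator fun x => ∏ i, ω i x)) ^ q x
    | some i => fun x => ((ω i x)⁻¹ / lux μ (fun x => (p i x).conjExponent)
      ((qball d c r).indicator fun x => (ω i x)⁻¹)) ^ (p i x).conjExponent with hu
  have hlower : ∀ j, ∀ c r, 0 < r → ∀ E ⊆ qball d c r, MeasurableSet E →
      ENNReal.ofReal (c₀ * (μ.real E / μ.real (qball d c r)) ^ (1 + 1 / θ₀)) ≤
        ∫⁻ y in E, u c r j y ∂μ := by
    intro j c r hr E hE hEm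
    have hBm := hX.measurableSet_qball c hr
    have hμ0 : μ (qball d c r) ≠ 0 := (hX.measure_qball_pos c hr).ne'
    have hμt : μ (qball d c r) ≠ ∞ := (hX.measure_qball_lt_top c r).ne
    obtain ⟨hN0, hNt, hn0, hnt, hle⟩ := hnorm c r hr
    refine ofReal_le_lintegral_of_le_prod (θ := fun j x => match j with
      | none => 1 / (s * q x)
      | some i => 1 / (s * (p i x).conjExponent)) hBm hμ0 hμt hE hEm ?_ ?_ hθ₀pos hk0 hk1 ?_ j
    · rintro (_ | i)
      · exact (hwm.div_const _).pow hq.measurable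
      · exact ((hωm i).inv.div_const _).pow (hp'm i)
    · rintro (_ | i)
      · exact (setLIntegral_rpow_div_lux hq.measurable hq.nonneg hlhq.pos (hGae.mono hlhq.mem)
          hwm hBm hN0 hNt).le
      · exact (setLIntegral_rpow_div_lux (hp'm i) (hp'0 i) one_pos
          (hGae.mono (hlh' i).mem) (hωm i).inv hBm (hn0 i) (hnt i)).le
    · filter_upwards [hGae, ae_all_iff.2 fun i => (hω i).pos, ae_all_iff.2 fun i => (hω i).lt_top]
        with x hx hpos hlt _
      have hqx := hlhq.mem x hx
      have hqx0 := hq0 x hx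
      have hpx := fun i => (hlh' i).mem x hx
      have hpx0 : ∀ i, 0 < (p i x).conjExponent := fun i => one_pos.trans_le (hpx i).1
      have hsum : 1 / q x + ∑ i, 1 / (p i x).conjExponent = s := by
        rw [hpq x, Finset.sum_congr rfl fun i _ => one_div_conjExponent (hp1 i x hx),
          Finset.sum_sub_distrib, Finset.sum_const, Finset.card_univ, Fintype.card_fin,
          nsmul_eq_mul, mul_one, hs]
        ring
      refine ⟨?_, ?_, ?_⟩
      · rintro (_ | i)
        · exact one_div_le_one_div_of_le (by positivity)
            (mul_le_mul_of_nonneg_left (hqx.2.trans hβq) hs0.le)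
        · exact one_div_le_one_div_of_le (mul_pos hs0 (hpx0 i))
            (mul_le_mul_of_nonneg_left ((hpx i).2.trans (hβa i)) hs0.le)
      · rw [Fintype.sum_option]
        simp only
        simp_rw [← one_div_mul_one_div]
        rw [← Finset.mul_sum, ← mul_add, hsum]; field_simp
      · rw [Fintype.prod_option]
        refine ofReal_le_prod_of_norms_le hs0 (by linarith) hμ0 hμt hN0 hNt hn0 hnt
          (fun i => (hpos i).ne') (fun i => (hlt i).ne) ?_ hqx0 hpx0 hsum
        have h1 := hle.trans hAK
        have e : η - m = -s := by rw [hs]; ring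
        rw [e, mul_assoc, ENNReal.rpow_neg, mul_comm, ← div_eq_mul_inv, ENNReal.div_le_iff] at h1
        · exact h1
        · simp [ENNReal.rpow_eq_zero_iff, hμ0, hμt]
        · simp [ENNReal.rpow_eq_top_iff, hμ0, hμt]
  let W : WeightPair d μ x₀ G := WeightPair.ofDensity hX hq.measurable hq.nonneg hwm hlhq hG
    (fun x r hr => (hnorm x r hr).1) (fun x r hr => (hnorm x r hr).2.1) hc₀pos hD (hlower none)
  let P : Fin m → WeightPair d μ x₀ G := fun i => WeightPair.ofDensity hX (hp'm i) (hp'0 i)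
    (hωm i).inv (hlh' i) hG (fun x r hr => (hnorm x r hr).2.2.1 i)
    (fun x r hr => (hnorm x r hr).2.2.2.1 i) hc₀pos hD (hlower (some i))
  obtain ⟨M₀, hM₀⟩ := W.exists_lintegral_rad_lt_top hX
  choose M₁ hM₁ using fun i => (P i).exists_lintegral_rad_lt_top hX
  -- One decay rate beyond all thresholds, so that the error is integrable against every measure
  -- involved.
  set M := max M₀ (∑ i, |M₁ i|) with hM
  refine ⟨x₀, G, W, P, pinf, M, ?_, hG, rfl, rfl, fun i => rfl,
    fun x r hr => ENNReal.ofReal_toReal (hnorm x r hr).2.1,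
    fun i x r hr => ENNReal.ofReal_toReal ((hnorm x r hr).2.2.2.1 i)⟩
  exact
    { measurable := fun i => (hp i).2.measurable
      lh := fun i => ⟨a i, b i, K i, ha i, hlh i⟩
      conj := fun i x _ => rfl
      conj_inf := fun i => rfl
      one_le := fun x hx => by
        have h1 : ∑ i, 1 / p i x = 1 / q x + η := by rw [hpq x]; ring
        have h2 := hq0 x hx
        change 1 ≤ q x * _
        rw [h1, mul_add, mul_one_div_cancel h2.ne']
        exact le_add_of_nonneg_right (by positivity)
      one_le_inf := by
        have h1 : ∑ i, 1 / pinf i = 1 / qinf + η := by rw [hqinf]; ring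
        change 1 ≤ qinf * _
        rw [h1, mul_add, mul_one_div_cancel hqinf0.ne']
        exact le_add_of_nonneg_right (by positivity)
      M_nonneg := le_max_of_le_right (Finset.sum_nonneg fun i _ => abs_nonneg _)
      decay := hM₀ M (le_max_left _ _)
      decay_dual := fun i => hM₁ i M (le_max_of_le_right ((le_abs_self _).trans
        (Finset.single_le_sum (f := fun i => |M₁ i|) (fun j _ => abs_nonneg _)
          (Finset.mem_univ i)))) }

end HomType

/-! ### Sufficiency of the weight condition. -/

namespace HomType

variable {X : Type*} [MeasurableSpace X] {d : X → X → ℝ} {μ : Measure X}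

/-- The norm of zero is finite and at least twice itself, by `mul_lux_le` with the factor `2`. -/
lemma lux_zero {q : X → ℝ} (hq : ExpP0 μ q) : lux μ q (fun _ => 0) = 0 := by
  obtain ⟨a, b, ha, hab⟩ := hq.exists_bounds
  have h1 : lux μ q (fun _ => 0) ≤ (((1 : ℝ≥0) ^ (1 / a) : ℝ≥0) : ℝ≥0∞) := by
    refine lux_lt_top_of_lintegral ha (hab.mono fun x hx => hx.1) (Ψ := fun _ => 0)
      measurable_const ?_ le_rfl (by simp)
    filter_upwards [hab] with x hx
    rw [ENNReal.zero_rpow_of_pos (ha.trans_le hx.1)]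
  have h2 := mul_lux_le (μ := μ) (p := q) (f := fun _ => 0) 2
  simp only [mul_zero, ENNReal.coe_ofNat] at h2
  rw [NNReal.one_rpow] at h1
  have h3 : lux μ q (fun _ => 0) ≠ ∞ := (h1.trans_lt (by simp)).ne
  lift lux μ q (fun _ => 0) to ℝ≥0 using h3 with t
  rw [two_mul] at h2
  have h4 : t + t ≤ t := by exact_mod_cast h2
  have h5 : t = 0 := by simpa using h4
  simp [h5]

/-- As `p' (1 - p) = -p`, division by the density `w⁻¹ ^ p'` turns the weighted modular into the
modular with respect to the dual measure; this justifies the substitution `f = s g`. -/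
lemma mul_div_rpow_conjExponent {h w : ℝ≥0∞} (hw0 : w ≠ 0) (hwt : w ≠ ∞) {p : ℝ} (hp : 1 < p) :
    w⁻¹ ^ p.conjExponent * (h / w⁻¹ ^ p.conjExponent) ^ p = (w * h) ^ p := by
  have hp0 : 0 < p := by linarith
  have hp1 : p - 1 ≠ 0 := by linarith
  have hw0' : w⁻¹ ≠ 0 := ENNReal.inv_ne_zero.2 hwt
  have hwt' : w⁻¹ ≠ ∞ := ENNReal.inv_ne_top.2 hw0
  rw [ENNReal.div_rpow_of_nonneg _ _ hp0.le, ← ENNReal.rpow_mul, div_eq_mul_inv,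
    ← ENNReal.rpow_neg, mul_left_comm, ← ENNReal.rpow_add _ _ hw0' hwt',
    ENNReal.mul_rpow_of_nonneg _ _ hp0.le, mul_comm]
  congr 1
  rw [ENNReal.inv_rpow, ← ENNReal.rpow_neg]
  congr 1
  rw [Real.conjExponent]; field_simp; ring

/-- The multilinear fractional maximal operator is bounded for weights in `A_{p, q}`. -/
lemma exists_hasBound_of_apqConst_lt_top {m : ℕ} (hX : IsHomogeneousType d μ) {p : Fin m → X → ℝ}
    {q : X → ℝ} {η : ℝ} (hp : ∀ i, LH d (p i) ∧ ExpP μ (p i)) (hq : ExpP0 μ q)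
    (hpq : ∀ x, 1 / q x = ∑ i, 1 / p i x - η) (hη : 0 ≤ η) (hηm : η < m) {ω : Fin m → X → ℝ≥0∞}
    (hω : ∀ i, IsWeight d μ (ω i)) (hA : apqConst d μ η p q ω < ∞) :
    ∃ K : ℝ≥0, HasBound μ p ω q (fun x => ∏ i, ω i x) (fracMaximal d μ η) K := by
  obtain ⟨x₀, G, W, P, pinf, M, hMW, hG, hWρ, hWσ, hPσ, hWn, hPn⟩ :=
    exists_multiWeight hX hp hq hpq hη hηm hω hA
  have hGae : ∀ᵐ x ∂μ, x ∈ G := hG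
  have hωm : ∀ i, Measurable (ω i) := fun i => (hω i).measurable
  have hωpos := ae_all_iff.2 fun i => (hω i).pos
  have hωlt := ae_all_iff.2 fun i => (hω i).lt_top
  have hwm : Measurable fun x => ∏ i, ω i x := Finset.measurable_fun_prod _ fun i _ => hωm i
  set s : Fin m → X → ℝ≥0∞ := fun i x => (ω i x)⁻¹ ^ (p i x).conjExponent with hs
  set t : X → ℝ≥0∞ := fun x => (∏ i, ω i x) ^ q x with ht
  have hsm : ∀ i, Measurable (s i) := fun i =>
    (hωm i).inv.pow (hp i).2.measurable_conjExponent
  have htm : Measurable t := hwm.pow hq.measurable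
  have hs0 : ∀ i, ∀ᵐ x ∂μ, s i x ≠ 0 ∧ s i x ≠ ∞ := by
    intro i
    filter_upwards [(hω i).pos, (hω i).lt_top] with x hx1 hx2
    exact ⟨(ENNReal.rpow_pos (ENNReal.inv_pos.2 hx2.ne) (ENNReal.inv_ne_top.2 hx1.ne')).ne',
      ENNReal.rpow_ne_top_of_nonneg ((hp i).2.conjExponent_nonneg x) (ENNReal.inv_ne_top.2 hx1.ne')⟩
  have ht0 : ∀ᵐ x ∂μ, t x ≠ 0 ∧ t x ≠ ∞ := by
    filter_upwards [hωpos, hωlt] with x hx1 hx2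
    have h1 : ∏ i, ω i x ≠ 0 := Finset.prod_ne_zero_iff.2 fun i _ => (hx1 i).ne'
    have h2 : ∏ i, ω i x ≠ ∞ := ENNReal.prod_ne_top fun i _ => (hx2 i).ne
    exact ⟨(ENNReal.rpow_pos (pos_iff_ne_zero.2 h1) h2).ne',
      ENNReal.rpow_ne_top_of_nonneg (hq.nonneg x) h2⟩
  obtain ⟨C, hC⟩ := hMW.exists_maximal_estimate hX hsm htm hPσ hWσ (ht0.mono fun x hx => hx.1)
    (ht0.mono fun x hx => hx.2)
  obtain ⟨a, b, ha, hab⟩ := hq.exists_bounds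
  set C' : ℝ≥0 := max 1 C with hC'
  set Ka : ℝ≥0 := max 1 (apqConst d μ η p q ω).toNNReal with hKa
  have hKa0 : Ka ≠ 0 := (one_pos.trans_le (le_max_left _ _)).ne'
  have hAK : apqConst d μ η p q ω ≤ Ka := by
    rw [← ENNReal.coe_toNNReal hA.ne]
    exact ENNReal.coe_le_coe.2 (le_max_right _ _)
  refine ⟨Ka * 2 ^ m * C' ^ (1 / a), fun f hf hfin => ?_⟩
  -- A component of norm zero vanishes almost everywhere, which makes the maximal function zero. The
  -- remaining case divides by the norms.
  by_cases hzero : ∃ i, wlux μ (p i) (ω i) (fun x => ‖f i x‖ₑ) = 0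
  · obtain ⟨i, hi⟩ := hzero
    obtain ⟨ai, bi, hai, habi⟩ := (hp i).2.exists_bounds
    have hfm : Measurable fun x => ω i x * ‖f i x‖ₑ := (hωm i).mul (hf i).enorm
    have h1 := ae_eq_zero_of_lux_eq_zero (hp i).2.measurable
      (fun x => zero_le_one.trans ((hp i).2.one_le x)) (by linarith : 0 < ai)
      (habi.mono fun x hx => hx.1) hfm hi
    have h2 : ∀ᵐ x ∂μ, ‖f i x‖ₑ = 0 := by
      filter_upwards [h1, (hω i).pos] with x hx hx2
      exact (mul_eq_zero.1 hx).resolve_left hx2.ne'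
    have h3 : ∀ x, fracMaximal d μ η f x = 0 := by
      intro x
      simp only [fracMaximal, ENNReal.iSup_eq_zero]
      intro c r hr
      have : ∫⁻ y in qball d c r, ‖f i y‖ₑ ∂μ = 0 := by
        rw [lintegral_congr_ae (ae_restrict_of_ae h2)]; simp
      have h4 : ∏ i, ((μ (qball d c r))⁻¹ * ∫⁻ y in qball d c r, ‖f i y‖ₑ ∂μ) = 0 :=
        Finset.prod_eq_zero (Finset.mem_univ i) (by rw [this, mul_zero])
      unfold fracAverage
      rw [h4, mul_zero]
      simp
    have h4 : wlux μ q (fun x => ∏ i, ω i x) (fracMaximal d μ η f) = 0 := by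
      simp_rw [wlux, h3, mul_zero]
      exact lux_zero hq
    rw [h4]; exact bot_le
  push Not at hzero
  set τ : Fin m → ℝ≥0 := fun i => (wlux μ (p i) (ω i) (fun x => ‖f i x‖ₑ)).toNNReal with hτ
  have hτe : ∀ i, (τ i : ℝ≥0∞) = wlux μ (p i) (ω i) (fun x => ‖f i x‖ₑ) := fun i =>
    ENNReal.coe_toNNReal (hfin i).ne
  have hτ0 : ∀ i, τ i ≠ 0 := fun i h => hzero i (by rw [← hτe, h, ENNReal.coe_zero])
  -- The factor `2` puts `T i` strictly above the norm, as `modular_le_one_of_lux_lt` requires.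
  set T : Fin m → ℝ≥0 := fun i => 2 * τ i with hT
  have hT0 : ∀ i, T i ≠ 0 := fun i => mul_ne_zero two_ne_zero (hτ0 i)
  have hTe0 : ∀ i, (T i : ℝ≥0∞) ≠ 0 := fun i => by simpa using hT0 i
  set g : Fin m → X → ℝ≥0∞ := fun i x => ‖f i x‖ₑ / T i / s i x with hg
  have hgm : ∀ i, Measurable (g i) := fun i => ((hf i).enorm.div_const _).div (hsm i)
  have hgint : ∀ i, ∫⁻ x, g i x ^ p i x ∂(P i).σ ≤ 1 := by
    intro i
    have hlt : lux μ (p i) (fun x => ω i x * ‖f i x‖ₑ) < T i := by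
      change wlux _ _ _ _ < _
      rw [← hτe, ENNReal.coe_lt_coe, hT]
      exact lt_mul_of_one_lt_left (pos_iff_ne_zero.2 (hτ0 i)) one_lt_two
    have h1 := modular_le_one_of_lux_lt (fun x => zero_le_one.trans ((hp i).2.one_le x)) hlt
    have hm : Measurable fun x => (ω i x * ‖f i x‖ₑ / T i) ^ p i x :=
      (((hωm i).mul (hf i).enorm).div_const _).pow (hp i).2.measurable
    rw [modular, upperIntegral_eq hm] at h1
    refine le_trans (le_of_eq ?_) h1
    have hgp : Measurable fun x => g i x ^ p i x := (hgm i).pow (hp i).2.measurable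
    rw [hPσ i, lintegral_withDensity_eq_lintegral_mul _ (hsm i) hgp]
    obtain ⟨ai, bi, hai, habi⟩ := (hp i).2.exists_bounds
    refine lintegral_congr_ae ?_
    filter_upwards [(hω i).pos, (hω i).lt_top, habi] with x hx1 hx2 hx3
    rw [Pi.mul_apply, mul_div_assoc]
    exact mul_div_rpow_conjExponent hx1.ne' hx2.ne (hai.trans_le hx3.1)
  have hgB : ∀ i c r, 0 < r → ∫⁻ y in qball d c r, ‖f i y‖ₑ ∂μ =
      T i * ∫⁻ y in qball d c r, g i y ∂(P i).σ := by
    intro i c r hr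
    rw [hPσ i, restrict_withDensity (hX.measurableSet_qball c hr),
      lintegral_withDensity_eq_lintegral_mul _ (hsm i) (hgm i),
      ← lintegral_const_mul _ ((hsm i).mul (hgm i))]
    refine lintegral_congr_ae (ae_restrict_of_ae ?_)
    filter_upwards [hs0 i] with x hx
    rw [Pi.mul_apply, hg, ENNReal.mul_div_cancel hx.1 hx.2,
      ENNReal.mul_div_cancel (hTe0 i) ENNReal.coe_ne_top]
  obtain ⟨Ψ, hΨm, hΨint, hΨ⟩ := hC g hgm hgint
  set cst : ℝ≥0 := Ka * ∏ i, T i with hcst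
  have hcst0 : cst ≠ 0 := mul_ne_zero hKa0 (Finset.prod_ne_zero_iff.2 fun i _ => hT0 i)
  have hcste0 : (cst : ℝ≥0∞) ≠ 0 := by simpa using hcst0
  -- The weight condition bounds `μ(B) ^ (η - m)` by the inverse norms, which turns the average over
  -- `B` into the normalized one controlled by `Ψ`. The majorant is measurable and independent of
  -- the ball, though the supremum over balls need not be measurable.
  have hmax : ∀ᵐ z ∂μ, fracMaximal d μ η f z ≤ cst * Ψ z ^ (1 / q z) := by
    filter_upwards [hGae, hab] with z hz hqz
    have hqz0 : 0 < q z := ha.trans_le hqz.1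
    refine iSup_le fun c => iSup_le fun r => iSup_le fun hr => ?_
    by_cases hzB : z ∈ qball d c r
    swap
    · rw [fracAverage, Set.indicator_of_notMem hzB]; exact bot_le
    rw [fracAverage, Set.indicator_of_mem hzB]
    obtain ⟨hN0, hNt, hn0, hnt, hle⟩ :=
      norms_of_apqConst_lt_top hX (fun i => (hp i).2) hq hω hA c hr
    have h1 := hΨ c r hr z hzB hz
    rw [hWρ, hWn c r hr] at h1
    simp_rw [hPn _ c r hr] at h1
    set B := qball d c r with hB
    have hμ0 : μ B ≠ 0 := (hX.measure_qball_pos c hr).ne'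
    have hμt : μ B ≠ ∞ := (hX.measure_qball_lt_top c r).ne
    set N := lux μ q (B.indicator fun x => ∏ i, ω i x) with hN
    set n : Fin m → ℝ≥0∞ := fun i =>
      lux μ (fun x => (p i x).conjExponent) (B.indicator fun x => (ω i x)⁻¹) with hn
    set I : Fin m → ℝ≥0∞ := fun i => ∫⁻ y in B, g i y ∂(P i).σ with hI
    have h2 : (∏ i, I i / n i) * N⁻¹ ≤ Ψ z ^ (1 / q z) := by
      rw [one_div, ENNReal.le_rpow_inv_iff hqz0]
      exact h1
    have hnp0 : ∏ i, n i ≠ 0 := Finset.prod_ne_zero_iff.2 fun i _ => hn0 i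
    have hnpt : ∏ i, n i ≠ ∞ := ENNReal.prod_ne_top fun i _ => hnt i
    have h3 : μ B ^ (η - m) ≤ Ka * (N⁻¹ * ∏ i, (n i)⁻¹) := by
      have h4 := hle.trans hAK
      rw [mul_assoc, ← ENNReal.le_div_iff_mul_le (Or.inl (mul_ne_zero hN0 hnp0))
        (Or.inl (ENNReal.mul_ne_top hNt hnpt)), div_eq_mul_inv,
        ENNReal.mul_inv (Or.inl hN0) (Or.inl hNt),
        ENNReal.prod_inv_distrib fun i _ j _ _ => Or.inl (hn0 i)] at h4
      exact h4
    calc μ B ^ η * ∏ i, ((μ B)⁻¹ * ∫⁻ y in B, ‖f i y‖ₑ ∂μ)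
        = μ B ^ (η - m) * ((∏ i, (T i : ℝ≥0∞)) * ∏ i, I i) := by
          have hgI : ∀ i, ∫⁻ y in B, ‖f i y‖ₑ ∂μ = T i * I i := fun i => hgB i c r hr
          simp_rw [hgI]
          rw [Finset.prod_mul_distrib, Finset.prod_const, Finset.card_univ, Fintype.card_fin,
            Finset.prod_mul_distrib, ← mul_assoc, ENNReal.rpow_sub _ _ hμ0 hμt,
            ENNReal.rpow_natCast, div_eq_mul_inv, ENNReal.inv_pow]
      _ ≤ Ka * (N⁻¹ * ∏ i, (n i)⁻¹) * ((∏ i, (T i : ℝ≥0∞)) * ∏ i, I i) := by gcongr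
      _ = cst * ((∏ i, I i / n i) * N⁻¹) := by
          simp_rw [div_eq_mul_inv]
          rw [Finset.prod_mul_distrib, hcst]
          push_cast
          ring
      _ ≤ _ := by gcongr
  have hlux : lux μ q (fun x => ((cst⁻¹ : ℝ≥0) : ℝ≥0∞) *
      ((∏ i, ω i x) * fracMaximal d μ η f x)) ≤ ((C' ^ (1 / a) : ℝ≥0) : ℝ≥0∞) := by
    refine lux_lt_top_of_lintegral ha (hab.mono fun x hx => hx.1) (Ψ := fun x => t x * Ψ x)
      (htm.mul hΨm) ?_ (le_max_left _ _) ?_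
    · filter_upwards [hmax, hab] with x hx hqx
      have hqx0 : 0 < q x := ha.trans_le hqx.1
      calc _ ≤ (((cst⁻¹ : ℝ≥0) : ℝ≥0∞) * ((∏ i, ω i x) * (cst * Ψ x ^ (1 / q x)))) ^ q x := by
            gcongr
        _ = ((∏ i, ω i x) * Ψ x ^ (1 / q x)) ^ q x := by
            congr 1
            rw [ENNReal.coe_inv hcst0]
            calc _ = ((cst : ℝ≥0∞)⁻¹ * cst) * ((∏ i, ω i x) * Ψ x ^ (1 / q x)) := by ring
              _ = _ := by rw [ENNReal.inv_mul_cancel hcste0 ENNReal.coe_ne_top, one_mul]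
        _ = t x * Ψ x := by
            rw [ENNReal.mul_rpow_of_nonneg _ _ hqx0.le, ← ENNReal.rpow_mul,
              one_div_mul_cancel hqx0.ne', ENNReal.rpow_one]
        _ ≤ _ := le_rfl
    · have : ∫⁻ x, t x * Ψ x ∂μ = ∫⁻ x, Ψ x ∂W.σ := by
        rw [hWσ, lintegral_withDensity_eq_lintegral_mul _ htm hΨm]; rfl
      rw [this]
      exact hΨint.trans (ENNReal.coe_le_coe.2 (le_max_right _ _))
  have hfinal := (mul_lux_le (μ := μ) (p := q) cst⁻¹).trans hlux
  rw [ENNReal.coe_inv hcst0, mul_comm, ← div_eq_mul_inv,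
    ENNReal.div_le_iff hcste0 ENNReal.coe_ne_top] at hfinal
  refine hfinal.trans (le_of_eq ?_)
  simp_rw [← hτe]
  rw [hcst, hT]
  push_cast
  rw [Finset.prod_mul_distrib, Finset.prod_const, Finset.card_univ, Fintype.card_fin]
  ring

end HomType

/-! ### The theorem. -/

theorem theorem1p3 {X : Type*} [MeasurableSpace X] {m : ℕ} (p : Fin m → X → ℝ) :
    ∃ C : ℝ≥0, 0 < C ∧
      ∀ (d : X → X → ℝ) (μ : Measure X), HomType.IsHomogeneousType d μ →
      (∀ i, HomType.LH d (p i) ∧ HomType.ExpP μ (p i)) →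
      ∀ (pbar q : X → ℝ) (η : ℝ), (∀ x, 1 / pbar x = ∑ i, 1 / p i x) →
      HomType.ExpP0 μ q → (∀ x, 1 / pbar x - 1 / q x = η) → 0 ≤ η → η < m →
      ∀ ω : Fin m → X → ℝ≥0∞, (∀ i, HomType.IsWeight d μ (ω i)) →
      (HomType.IsBoundedOp μ p ω q (fun x => ∏ i, ω i x) (HomType.fracMaximal d μ η) ↔
        HomType.apqConst d μ η p q ω < ∞) ∧
      HomType.apqConst d μ η p q ω ≤
        C * HomType.opNorm μ p ω q (fun x => ∏ i, ω i x) (HomType.fracMaximal d μ η) ∧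
      (HomType.apqConst d μ η p q ω < ∞ →
        ∃ K : ℝ≥0,
          HomType.opNorm μ p ω q (fun x => ∏ i, ω i x) (HomType.fracMaximal d μ η) ≤ K) := by
  -- The constant `1` suffices because the test functions realize the dual norms up to any strictly
  -- smaller number.
  refine ⟨1, one_pos, fun d μ hX hp pbar q η hpbar hq hpq hη hηm ω hω => ?_⟩
  have hpq' : ∀ x, 1 / q x = ∑ i, 1 / p i x - η := fun x => by
    rw [← hpbar x, ← hpq x]; ring
  have hsuff := HomType.exists_hasBound_of_apqConst_lt_top hX hp hq hpq' hη hηm hω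
  have hnec := fun C => HomType.apqConst_le_of_hasBound (C := C) (η := η) hX
    (fun i => (hp i).2) hq hω
  refine ⟨⟨fun ⟨C, hC⟩ => (hnec C hC).trans_lt ENNReal.coe_lt_top, hsuff⟩, ?_, fun hA => ?_⟩
  · rw [ENNReal.coe_one, one_mul]
    exact le_iInf fun C => le_iInf fun hC => hnec C hC
  · obtain ⟨K, hK⟩ := hsuff hA
    exact ⟨K, iInf_le_of_le K (iInf_le_of_le hK le_rfl)⟩
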